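/- Theorem 1.2. Work in the smooth category. An $n$-knot is the image of a smooth embedding of $S^n$ into $S^{n+2}$; it is trivial if some diffeomorphism of $S^{n+2}$ carries it to the standard $S^n\subset S^{n+2}$. For $k\ge 0$ and an $n$-knot $K$, write $(S^{n+2},K)=(X^{n+2},X^n)\cup(Y^{n+2},Y^n)$, where $X^{n+2}$ is a closed coordinate ball centred at a point of $K$ in which $K$ is flat, $X^n = X^{n+2}\cap K$, and $(Y^{n+2},Y^n)$ is the complementary ball pair. Let $\phi$ be the angular coordinate around $X^n$. The $k$-twist spun knot $\tau_k(K)$ is the $(n+1)$-knot in $S^{n+3}$ obtained by gluing $(\partial X^{n+2},\partial X^n)\times D^2$ to $(Y^{n+2},Y^n)\times\partial D^2$ by $((x,\phi),\theta)\mapsto((x,\phi+k\theta),\theta)$; it is considered up to diffeomorphism of $S^{n+3}$. For a $1$-knot $K\subset S^3$ and $m\ge 1$, let $\pi_1^{\mathrm{orb}}(\mathcal O(K,m))$ be the fundamental group of the orbifold with underlying space $S^3$ and ramification locus $K$ of order $m$, that is, the quotient of $\pi_1(S^3\setminus K)$ by the normal subgroup generated by the $m$-th powers of the meridians of $K$.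 Let $K$ be a $1$-knot in $S^3$, let $m_1,m_2$ be positive integers, and set $m=\gcd(m_1,m_2)$. If $K$ is non-trivial, $m\ge 2$, and the center of $\pi_1^{\mathrm{orb}}(\mathcal O(K,m))$ is trivial, then the $3$-knot $\tau_{m_2}(\tau_{m_1}(K))$ in $S^5$ is non-trivial. -/

import Mathlib

open scoped Manifold ContDiff

/-- The unit sphere `S^n` in `ℝ^(n+1)`, with Mathlib's smooth structure. -/
abbrev Sph (n : ℕ) : Type :=
  Metric.sphere (0 : EuclideanSpace ℝ (Fin (n + 1))) 1

/-- Self-diffeomorphisms of `S^n` (not required to preserve the orientation). -/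
abbrev SphDiffeo (n : ℕ) : Type :=
  Diffeomorph (𝓡 n) (𝓡 n) (Sph n) (Sph n) ∞

/-- An `n`-knot: the image of a smooth embedding of `S^n` into `S^(n+2)`. -/
structure Knot (n : ℕ) where
  carrier : Set (Sph (n + 2))
  exists_embedding : ∃ f : Sph n → Sph (n + 2),
    Manifold.IsSmoothEmbedding (𝓡 n) (𝓡 (n + 2)) ∞ f ∧ Set.range f = carrier

/-- The standard unknotted `S^n` in `S^(n+2)`: the points whose first two coordinates vanish. -/
def standardSphere (n : ℕ) : Set (Sph (n + 2)) :=
  {p | p.1 0 = 0 ∧ p.1 1 = 0}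

/-- A subset `A` of `S^(n+2)` is in normal position if, on a neighbourhood of the closed hemisphere
`{t ≤ 0}` (`t` the last coordinate), it coincides with the standard sphere.  The hemisphere
`{t ≤ 0}`, with its intersection with `A`, is the unknotted ball pair `(X^(n+2), X^n)`, and the
hemisphere `{t ≥ 0}`, with its intersection with `A`, is the complementary, possibly knotted,
ball pair `(Y^(n+2), Y^n)`. -/
def InNormalPosition {n : ℕ} (A : Set (Sph (n + 2))) : Prop :=
  ∃ ε : ℝ, 0 < ε ∧ ∀ p : Sph (n + 2), p.1 (Fin.last (n + 2)) < ε →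
    (p ∈ A ↔ p ∈ standardSphere n)

/-- `IsSpunPoint k θ q p`: writing `q = (u, x, t)` with `u ∈ ℝ^2`, `x ∈ ℝ^n`, `t ∈ ℝ`, the point `p`
is `(R u, x, t cos θ, t sin θ)`, where `R` is the rotation of `ℝ^2` through the angle `-kθ`. -/
def IsSpunPoint {n : ℕ} (k : ℕ) (θ : ℝ) (q : Sph (n + 2)) (p : Sph (n + 3)) : Prop :=
  p.1 0 = Real.cos (k * θ) * q.1 0 + Real.sin (k * θ) * q.1 1 ∧
  p.1 1 = -Real.sin (k * θ) * q.1 0 + Real.cos (k * θ) * q.1 1 ∧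
  (∀ i : Fin n, p.1 i.succ.succ.castSucc.castSucc = q.1 i.succ.succ.castSucc) ∧
  p.1 (Fin.last (n + 2)).castSucc = q.1 (Fin.last (n + 2)) * Real.cos θ ∧
  p.1 (Fin.last (n + 3)) = q.1 (Fin.last (n + 2)) * Real.sin θ

/-- The `k`-twist spinning of a set `A ⊆ S^(n+2)` in normal position: the hemisphere `Y = {t ≥ 0}` is
spun about its boundary sphere `{t = 0}`, sweeping out all of `S^(n+3)`, and during one turn
`Y ∩ A` is rotated `k` times about the standard sphere.

This is the gluing of `∂X × D^2` and `Y × ∂D^2` by `((x, φ), θ) ↦ ((x, φ + kθ), θ)`: after `Y × ∂D^2`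
has been reparametrized by `((x, φ), θ) ↦ ((x, φ - kθ), θ)` the gluing is the identity, the union is
`∂(Y × D^2) = S^(n+3)`, and `(Y ∩ A) × ∂D^2` becomes the set below.  The part `(∂X ∩ A) × D^2`
is absorbed in the collar of `∂Y`, where `A` is invariant under the rotations. -/
def twistSpinSet {n : ℕ} (k : ℕ) (A : Set (Sph (n + 2))) : Set (Sph (n + 3)) :=
  {p | ∃ q ∈ A, 0 ≤ q.1 (Fin.last (n + 2)) ∧ ∃ θ : ℝ, IsSpunPoint k θ q p}

namespace Knot

/-- A knot is trivial if a diffeomorphism of the ambient sphere takes it to the standard one. -/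
def IsTrivial {n : ℕ} (K : Knot n) : Prop :=
  ∃ φ : SphDiffeo (n + 2), φ '' K.carrier = standardSphere n

/-- `L.IsTwistSpunOf k K`: the `(n+1)`-knot `L` is (a representative of) the `k`-twist spun knot
`τ_k(K)` of the `n`-knot `K`.  That is, for some diffeomorphism `φ` of `S^(n+2)` that moves `K`
into normal position, `L` is equivalent to the `k`-twist spinning of `φ(K)`. The choice of `φ`
is the choice of a coordinate ball `X` around a point of `K` in which `K` is flat. -/
def IsTwistSpunOf {n : ℕ} (L : Knot (n + 1)) (k : ℕ) (K : Knot n) : Prop :=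
  ∃ φ : SphDiffeo (n + 2), ∃ ψ : SphDiffeo (n + 3),
    InNormalPosition (φ '' K.carrier) ∧ ψ '' L.carrier = twistSpinSet k (φ '' K.carrier)

/-- The complement `S^(n+2) \ K`. -/
abbrev Complement {n : ℕ} (K : Knot n) : Type :=
  {p : Sph (n + 2) // p ∉ K.carrier}

/-- `g` is a coordinate neighbourhood of `S^(n+2)` (a diffeomorphism from `ℝ^(n+2)` onto an open
subset) in which the knot is the linear subspace given by the vanishing of the first two
coordinates. -/
def IsSliceChart {n : ℕ} (K : Knot n)
    (g : EuclideanSpace ℝ (Fin (n + 2)) → Sph (n + 2)) : Prop :=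
  Function.Injective g ∧ IsLocalDiffeomorph (𝓡 (n + 2)) (𝓡 (n + 2)) ∞ g ∧
    ∀ x, g x ∈ K.carrier ↔ x 0 = 0 ∧ x 1 = 0

/-- The unit circle `(cos 2πt, sin 2πt, 0, …, 0)` in `ℝ^(n+2)`, linking the subspace given by the
vanishing of the first two coordinates once. -/
noncomputable def linkingCircle (n : ℕ) (t : ℝ) : EuclideanSpace ℝ (Fin (n + 2)) :=
  WithLp.toLp 2 (Fin.cons (Real.cos (2 * Real.pi * t))
    (Fin.cons (Real.sin (2 * Real.pi * t)) fun _ => 0))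

/-- The meridians in `π₁(S^(n+2) \ K, x₀)`: the classes of the loops `c · ℓ · c⁻¹`, where `ℓ` runs
once around `K` in a slice chart and `c` is a path in the complement from `x₀` to the starting
point of `ℓ`. -/
def IsMeridian {n : ℕ} (K : Knot n) (x₀ : K.Complement)
    (a : FundamentalGroup K.Complement x₀) : Prop :=
  ∃ g, K.IsSliceChart g ∧ ∃ (b : K.Complement) (c : Path x₀ b) (ℓ : Path b b),
    (∀ t : unitInterval, (ℓ t : Sph (n + 2)) = g (linkingCircle n t)) ∧
    a = FundamentalGroup.fromPath (Path.Homotopic.Quotient.mk ((c.trans ℓ).trans c.symm))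

/-- The orbifold fundamental group `π₁^orb(O(K, m))` of the orbifold with underlying space `S^3`
and ramification locus the classical knot `K`, of order `m`: the quotient of `π₁(S^3 \ K, x₀)` by
the normal subgroup generated by the `m`-th powers of the meridians of `K`. -/
abbrev OrbifoldGroup (K : Knot 1) (m : ℕ) (x₀ : K.Complement) : Type :=
  FundamentalGroup K.Complement x₀ ⧸
    Subgroup.normalClosure {a | ∃ μ, K.IsMeridian x₀ μ ∧ a = μ ^ m}

end Knot

/-! A homomorphism from a knot group to `G` is encoded by a `G`-valued function of pairs of points
of the ambient sphere that satisfies the cocycle identity near every point of the complement.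
Transport along loops recovers the homomorphism up to conjugation. This turns extension problems for
homomorphisms into local constructions, and no presentation of a knot group is needed.

The fibre at angle zero gives a map from the complement of `K` to the complement of its twist spin,
sending a meridian to a meridian (`fibreMap_comp_stdLoop`). Conversely, a cocycle on the complement
of `K` whose meridian holonomy `h` satisfies `h ^ k = 1` extends to the complement of the `k`-twist
spin. Off the axis it is pulled back by undoing the rotation. Near the axis the knot is standard and
the cocycle comes from the punctured plane. The two descriptions are glued by `axisTwist`; one turn
around the axis adds `k` turns around the knot, so `h ^ k = 1` is exactly what makes the gluing
consistent (`cohomologousAt_axisTwist`). `Knot.IsTwistSpunOf.exists_map` collects both directions.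

Since `m` divides `m₁` and `m₂`, two extensions show that the projection of the knot group onto the
orbifold group factors, up to conjugation, through the complement of the `3`-knot. If that knot were
trivial, transports along loops in its complement would commute
(`Knot.IsTrivial.commute_transport`), so the orbifold group would be abelian. It would then equal
its center and be trivial, so the `m`-th powers of meridians would normally generate the knot group
and every homomorphism to `ℤ/m` would vanish. But the winding number modulo `m` around the trivial
`3`-knot (`Knot.IsTrivial.exists_winding`) pulls back to a cocycle that is nontrivial on the
meridian of `K`, because `m ≥ 2`. -/

open Topology Filter Set

/-! ### Local cocycles, their primitives, and transport along paths -/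

section LocalCocycle

variable {X Y Z G : Type*} [TopologicalSpace X] [TopologicalSpace Y] [TopologicalSpace Z] [Group G]

/-- A `G`-valued function of two variables is a local cocycle at `p` if it satisfies the cocycle
identity on a neighbourhood of `p`. -/
def CocycleAt (φ : X → X → G) (p : X) : Prop :=
  ∃ N ∈ 𝓝 p, ∀ a ∈ N, ∀ b ∈ N, ∀ c ∈ N, φ a b * φ b c = φ a c

/-- Near `p`, the function `φ` is the coboundary of `f`. -/
def PrimitiveAt (φ : X → X → G) (f : X → G) (p : X) : Prop :=
  ∃ N ∈ 𝓝 p, ∀ a ∈ N, ∀ b ∈ N, φ a b = (f a)⁻¹ * f b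

/-- Near `p`, the functions `φ` and `ψ` differ by the coboundary of `ξ`. -/
def CohomologousAt (φ ψ : X → X → G) (ξ : X → G) (p : X) : Prop :=
  ∃ N ∈ 𝓝 p, ∀ a ∈ N, ∀ b ∈ N, φ a b = (ξ a)⁻¹ * ψ a b * ξ b

/-- The pullback of a function of two variables. -/
def pullCocycle (f : Y → X) (φ : X → X → G) : Y → Y → G := fun a b => φ (f a) (f b)

theorem CocycleAt.pull {φ : X → X → G} {f : Y → X} {y : Y} (h : CocycleAt φ (f y))
    (hf : ContinuousAt f y) : CocycleAt (pullCocycle f φ) y := by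
  obtain ⟨N, hN, H⟩ := h
  exact ⟨f ⁻¹' N, hf hN, fun a ha b hb c hc => H _ ha _ hb _ hc⟩

theorem PrimitiveAt.pull {φ : X → X → G} {g : X → G} {f : Y → X} {y : Y}
    (h : PrimitiveAt φ g (f y)) (hf : ContinuousAt f y) :
    PrimitiveAt (pullCocycle f φ) (g ∘ f) y := by
  obtain ⟨N, hN, H⟩ := h
  exact ⟨f ⁻¹' N, hf hN, fun a ha b hb => H _ ha _ hb⟩

theorem CohomologousAt.pull {φ ψ : X → X → G} {ξ : X → G} {f : Y → X} {y : Y}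
    (h : CohomologousAt φ ψ ξ (f y)) (hf : ContinuousAt f y) :
    CohomologousAt (pullCocycle f φ) (pullCocycle f ψ) (ξ ∘ f) y := by
  obtain ⟨N, hN, H⟩ := h
  exact ⟨f ⁻¹' N, hf hN, fun a ha b hb => H _ ha _ hb⟩

theorem CohomologousAt.trans {φ ψ χ : X → X → G} {ξ η : X → G} {p : X}
    (h : CohomologousAt φ ψ ξ p) (h' : CohomologousAt ψ χ η p) :
    CohomologousAt φ χ (fun a => η a * ξ a) p := by
  obtain ⟨N, hN, H⟩ := h
  obtain ⟨N', hN', H'⟩ := h'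
  refine ⟨N ∩ N', inter_mem hN hN', fun a ha b hb => ?_⟩
  rw [H a ha.1 b hb.1, H' a ha.2 b hb.2]
  group

theorem CohomologousAt.cocycleAt {φ ψ : X → X → G} {ξ : X → G} {p : X}
    (h : CohomologousAt φ ψ ξ p) (h' : CocycleAt ψ p) : CocycleAt φ p := by
  obtain ⟨N, hN, H⟩ := h
  obtain ⟨N', hN', H'⟩ := h'
  refine ⟨N ∩ N', inter_mem hN hN', fun a ha b hb c hc => ?_⟩
  rw [H a ha.1 b hb.1, H b hb.1 c hc.1, H a ha.1 c hc.1, ← H' a ha.2 b hb.2 c hc.2]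
  group

theorem CohomologousAt.primitiveAt {φ ψ : X → X → G} {ξ f : X → G} {p : X}
    (h : CohomologousAt φ ψ ξ p) (h' : PrimitiveAt ψ f p) :
    PrimitiveAt φ (fun a => f a * ξ a) p := by
  obtain ⟨N, hN, H⟩ := h
  obtain ⟨N', hN', H'⟩ := h'
  refine ⟨N ∩ N', inter_mem hN hN', fun a ha b hb => ?_⟩
  rw [H a ha.1 b hb.1, H' a ha.2 b hb.2]
  group

theorem CohomologousAt.congr {φ ψ : X → X → G} {ξ η : X → G} {p : X}
    (h : CohomologousAt φ ψ ξ p) (h' : ∀ᶠ a in 𝓝 p, ξ a = η a) : CohomologousAt φ ψ η p := by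
  obtain ⟨N, hN, H⟩ := h
  refine ⟨N ∩ {a | ξ a = η a}, inter_mem hN h', fun a ha b hb => ?_⟩
  rw [← show ξ a = η a from ha.2, ← show ξ b = η b from hb.2, H a ha.1 b hb.1]

theorem PrimitiveAt.cocycleAt {φ : X → X → G} {f : X → G} {p : X} (h : PrimitiveAt φ f p) :
    CocycleAt φ p := by
  obtain ⟨N, hN, H⟩ := h
  refine ⟨N, hN, fun a ha b hb c hc => ?_⟩
  rw [H a ha b hb, H b hb c hc, H a ha c hc]
  group

theorem PrimitiveAt.mul_left {φ : X → X → G} {f : X → G} {p : X} (h : PrimitiveAt φ f p) (g : G) :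
    PrimitiveAt φ (fun a => g * f a) p := by
  obtain ⟨N, hN, H⟩ := h
  refine ⟨N, hN, fun a ha b hb => ?_⟩
  rw [H a ha b hb]
  group

theorem PrimitiveAt.congr {φ : X → X → G} {f f' : X → G} {p : X} (h : PrimitiveAt φ f p)
    (h' : ∀ᶠ a in 𝓝 p, f a = f' a) : PrimitiveAt φ f' p := by
  obtain ⟨N, hN, H⟩ := h
  refine ⟨N ∩ {a | f a = f' a}, inter_mem hN h', fun a ha b hb => ?_⟩
  rw [← show f a = f' a from ha.2, ← show f b = f' b from hb.2, H a ha.1 b hb.1]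

omit [TopologicalSpace X] in
theorem cocycle_self {φ : X → X → G} {N : Set X}
    (H : ∀ a ∈ N, ∀ b ∈ N, ∀ c ∈ N, φ a b * φ b c = φ a c) {a : X} (ha : a ∈ N) : φ a a = 1 := by
  simpa using H a ha a ha a ha

/-- Two primitives on a preconnected set differ by a constant. -/
theorem primitive_unique {φ : X → X → G} {f g : X → G} {s : Set X} (hs : IsPreconnected s)
    (hf : ∀ x ∈ s, PrimitiveAt φ f x) (hg : ∀ x ∈ s, PrimitiveAt φ g x) {x y : X}
    (hx : x ∈ s) (hy : y ∈ s) : (f x)⁻¹ * f y = (g x)⁻¹ * g y := by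
  refine hs.induction₂ (fun x y => (f x)⁻¹ * f y = (g x)⁻¹ * g y) (fun x hx => ?_)
    (fun x y z _ _ _ h h' => ?_) (fun x y _ _ h => ?_) hx hy
  · obtain ⟨N, hN, H⟩ := hf x hx
    obtain ⟨N', hN', H'⟩ := hg x hx
    filter_upwards [mem_nhdsWithin_of_mem_nhds hN, mem_nhdsWithin_of_mem_nhds hN'] with y hy hy'
    rw [← H x (mem_of_mem_nhds hN) y hy, ← H' x (mem_of_mem_nhds hN') y hy']
  · calc (f x)⁻¹ * f z = ((f x)⁻¹ * f y) * ((f y)⁻¹ * f z) := by group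
      _ = (g x)⁻¹ * g z := by rw [h, h']; group
  · calc (f y)⁻¹ * f x = ((f x)⁻¹ * f y)⁻¹ := by group
      _ = (g y)⁻¹ * g x := by rw [h]; group

/-- Cocycles on the line have primitives on compact intervals. -/
theorem exists_primitive_Icc {ψ : ℝ → ℝ → G} (hψ : ∀ x, CocycleAt ψ x) (a b : ℝ) :
    ∃ f : ℝ → G, ∀ x ∈ Icc a b, PrimitiveAt ψ f x := by
  -- Solvability on `[a, s]` is locally constant in `s`, and it is vacuous for `s = a - 1`.
  set P : ℝ → Prop := fun s => ∃ f : ℝ → G, ∀ x ∈ Icc a s, PrimitiveAt ψ f x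
  have step : ∀ s, ∃ r > 0, ∀ s₁ ∈ Metric.ball s r, ∀ s₂ ∈ Metric.ball s r, P s₁ → P s₂ := by
    intro s
    obtain ⟨N, hN, H⟩ := hψ s
    obtain ⟨r, hr, hrN⟩ := Metric.mem_nhds_iff.1 hN
    refine ⟨r, hr, fun s₁ hs₁ s₂ hs₂ ⟨f, hf⟩ => ?_⟩
    rcases lt_or_ge s₁ a with ha | ha
    · refine ⟨fun x => ψ s₁ x, fun x hx => ⟨Metric.ball s r, ?_, ?_⟩⟩
      · refine Metric.isOpen_ball.mem_nhds ?_
        rw [Real.ball_eq_Ioo] at *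
        exact ⟨by linarith [hs₁.1, hx.1], by linarith [hs₂.2, hx.2]⟩
      · intro y hy z hz
        dsimp only
        rw [← H s₁ (hrN hs₁) y (hrN hy) z (hrN hz)]
        group
    · obtain ⟨N', hN', H'⟩ := hf s₁ ⟨ha, le_rfl⟩
      have hg : ∀ y ∈ Metric.ball s r ∩ N', f s₁ * ψ s₁ y = f y := fun y hy => by
        rw [H' s₁ (mem_of_mem_nhds hN') y hy.2]; group
      have hψ' : ∀ x ∈ Metric.ball s r, PrimitiveAt ψ (fun x => f s₁ * ψ s₁ x) x := fun x hx =>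
        ⟨Metric.ball s r, Metric.isOpen_ball.mem_nhds hx, fun y hy z hz => by
          dsimp only
          rw [← H s₁ (hrN hs₁) y (hrN hy) z (hrN hz)]; group⟩
      -- The old primitive is continued past `s₁` by the local one, normalized to agree with it near
      -- `s₁`.
      refine ⟨fun x => if x ≤ s₁ then f x else f s₁ * ψ s₁ x, fun x hx => ?_⟩
      rcases lt_trichotomy x s₁ with h | h | h
      · refine (hf x ⟨hx.1, h.le⟩).congr ?_
        filter_upwards [eventually_lt_nhds h] with y hy
        rw [if_pos hy.le]
      · subst h
        refine (hψ' x hs₁).congr ?_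
        filter_upwards [hN', Metric.isOpen_ball.mem_nhds hs₁] with y hy hy'
        split_ifs
        · exact hg y ⟨hy', hy⟩
        · rfl
      · have hxb : x ∈ Metric.ball s r := by
          rw [Real.ball_eq_Ioo] at *
          exact ⟨by linarith [hs₁.1], by linarith [hs₂.2, hx.2]⟩
        refine (hψ' x hxb).congr ?_
        filter_upwards [eventually_gt_nhds h] with y hy
        rw [if_neg hy.not_ge]
  have hP : P (a - 1) := ⟨1, fun x hx => by linarith [hx.1, hx.2]⟩
  refine isPreconnected_univ.induction₂' (fun x y => P x → P y) (fun x _ => ?_)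
    (fun x y z _ _ _ h h' => h' ∘ h) (mem_univ (a - 1)) (mem_univ b) hP
  obtain ⟨r, hr, h⟩ := step x
  filter_upwards [mem_nhdsWithin_of_mem_nhds (Metric.ball_mem_nhds x hr)] with y hy
  exact ⟨h x (Metric.mem_ball_self hr) y hy, h y hy x (Metric.mem_ball_self hr)⟩

/-- Cocycles on the line have primitives. -/
theorem exists_primitive {ψ : ℝ → ℝ → G} (hψ : ∀ x, CocycleAt ψ x) :
    ∃ f : ℝ → G, ∀ x, PrimitiveAt ψ f x := by
  choose f hf using fun n : ℕ => exists_primitive_Icc hψ (-n) n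
  -- Normalizing every primitive to be `1` at `0` makes those on different intervals agree where
  -- both are defined.
  refine ⟨fun s => (f (⌈|s|⌉₊) 0)⁻¹ * f (⌈|s|⌉₊) s, fun p => ?_⟩
  have hp : p ∈ Icc (-((⌈|p|⌉₊ + 1 : ℕ) : ℝ)) ((⌈|p|⌉₊ + 1 : ℕ) : ℝ) := by
    have h1 := Nat.le_ceil |p|
    rw [mem_Icc, ← abs_le]
    push_cast
    linarith
  refine ((hf (⌈|p|⌉₊ + 1) p hp).mul_left (f (⌈|p|⌉₊ + 1) 0)⁻¹).congr ?_
  filter_upwards [Metric.ball_mem_nhds p one_pos] with s hs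
  have h3 : |s| < |p| + 1 := by
    have := abs_sub_abs_le_abs_sub s p
    rw [Metric.mem_ball, Real.dist_eq] at hs
    linarith
  have h4 : ⌈|s|⌉₊ ≤ ⌈|p|⌉₊ + 1 := by
    refine Nat.ceil_le.2 ?_
    have h1 := Nat.le_ceil |p|
    push_cast
    linarith
  have h5 : (⌈|s|⌉₊ : ℝ) ≤ ((⌈|p|⌉₊ + 1 : ℕ) : ℝ) := by exact_mod_cast h4
  have h6 := Nat.le_ceil |s|
  refine primitive_unique isPreconnected_Icc
    (fun x hx => hf (⌈|p|⌉₊ + 1) x ⟨by linarith [hx.1], by linarith [hx.2]⟩)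
    (hf ⌈|s|⌉₊) ⟨by simp, by simp⟩ (abs_le.1 h6)

/-- The transport of a cocycle along a path between two parameters. -/
noncomputable def transport (φ : X → X → G) (γ : ℝ → X) (a b : ℝ) : G :=
  open Classical in
  if h : ∃ f : ℝ → G, ∀ x, PrimitiveAt (pullCocycle γ φ) f x then
    (h.choose a)⁻¹ * h.choose b else 1

-- By `primitive_unique` the choice hidden in the definition is immaterial, so any convenient
-- primitive computes the transport.
omit [TopologicalSpace X] in
theorem transport_eq {φ : X → X → G} {γ : ℝ → X} {f : ℝ → G}
    (hf : ∀ x, PrimitiveAt (pullCocycle γ φ) f x) (a b : ℝ) :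
    transport φ γ a b = (f a)⁻¹ * f b := by
  have h : ∃ f : ℝ → G, ∀ x, PrimitiveAt (pullCocycle γ φ) f x := ⟨f, hf⟩
  rw [transport, dif_pos h]
  exact primitive_unique isPreconnected_univ (fun x _ => h.choose_spec x) (fun x _ => hf x)
    (mem_univ _) (mem_univ _)

/-- `γ` is a path along which `φ` is a cocycle. -/
def Transportable (φ : X → X → G) (γ : ℝ → X) : Prop :=
  ∀ t, ContinuousAt γ t ∧ CocycleAt φ (γ t)

theorem Transportable.exists_primitive {φ : X → X → G} {γ : ℝ → X} (h : Transportable φ γ) :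
    ∃ f : ℝ → G, (∀ x, PrimitiveAt (pullCocycle γ φ) f x) ∧
      ∀ a b, transport φ γ a b = (f a)⁻¹ * f b := by
  obtain ⟨f, hf⟩ := _root_.exists_primitive fun t => (h t).2.pull (h t).1
  exact ⟨f, hf, transport_eq hf⟩

omit [TopologicalSpace X] [TopologicalSpace Y] in
theorem transport_pull (φ : X → X → G) (f : Y → X) (γ : ℝ → Y) (a b : ℝ) :
    transport (pullCocycle f φ) γ a b = transport φ (f ∘ γ) a b := rfl

theorem transport_mul {φ : X → X → G} {γ : ℝ → X} (h : Transportable φ γ) (a b c : ℝ) :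
    transport φ γ a b * transport φ γ b c = transport φ γ a c := by
  obtain ⟨f, -, hf⟩ := h.exists_primitive
  simp only [hf]; group

/-- Primitives pull back along `σ`, which need not be monotone; only the two end parameters matter.
-/
theorem transport_reparam {φ : X → X → G} {γ : ℝ → X} (h : Transportable φ γ) {σ : ℝ → ℝ}
    (hσ : Continuous σ) (a b : ℝ) :
    transport φ (γ ∘ σ) a b = transport φ γ (σ a) (σ b) := by
  obtain ⟨f, hf, hf'⟩ := h.exists_primitive
  have h1 : ∀ x, PrimitiveAt (pullCocycle (γ ∘ σ) φ) (f ∘ σ) x := fun x =>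
    (hf (σ x)).pull hσ.continuousAt
  rw [hf', transport_eq h1]
  rfl

/-- The transport between two parameters depends only on the path between them. -/
theorem transport_congr {φ : X → X → G} {γ δ : ℝ → X} (hγ : Transportable φ γ)
    (hδ : Transportable φ δ) {a b : ℝ} (hab : a ≤ b) (h : ∀ t ∈ Icc a b, γ t = δ t) :
    transport φ γ a b = transport φ δ a b := by
  -- Precomposing with the retraction onto `[a, b]` makes the two paths equal everywhere.
  have hc : Continuous fun t : ℝ => max a (min t b) := by fun_prop
  have e : γ ∘ (fun t : ℝ => max a (min t b)) = δ ∘ (fun t : ℝ => max a (min t b)) :=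
    funext fun t => h _ ⟨le_max_left _ _, max_le hab (min_le_right _ _)⟩
  have h1 := transport_reparam hγ hc a b
  have h2 := transport_reparam hδ hc a b
  simp only [hab, min_eq_left, max_self, min_self, max_eq_right] at h1 h2
  rw [← h1, e, h2]

/-- A primitive of `ψ` times `ξ` is a primitive of `φ`; on loops the change is therefore a
conjugation. -/
theorem Transportable.cohomologous {φ ψ : X → X → G} {ξ : X → G} {γ : ℝ → X}
    (h : Transportable ψ γ) (h' : ∀ t, CohomologousAt φ ψ ξ (γ t)) (a b : ℝ) :
    transport φ γ a b = (ξ (γ a))⁻¹ * transport ψ γ a b * ξ (γ b) := by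
  obtain ⟨f, hf, hf'⟩ := h.exists_primitive
  rw [hf', transport_eq fun t => ((h' t).pull (h t).1).primitiveAt (hf t)]
  simp [mul_assoc]

/-- The homotopy lemma: the cocycles at the two ends of a homotopy differ by the coboundary of the
transport along the homotopy. -/
theorem homotopy_cohomologous {φ : X → X → G} {W : Z → ℝ → X} {U : Set Z} (hU : IsOpen U)
    (hW : ∀ z ∈ U, ∀ s, ContinuousAt (Function.uncurry W) (z, s) ∧ CocycleAt φ (W z s))
    {z : Z} (hz : z ∈ U) (s : ℝ) :
    CohomologousAt (pullCocycle (fun z => W z s) φ) (pullCocycle (fun z => W z 0) φ)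
      (fun z => transport φ (W z) 0 s) z := by
  have hT : ∀ z ∈ U, Transportable φ (W z) := fun z hz t =>
    ⟨(hW z hz t).1.comp (f := fun t => (z, t)) (by fun_prop), (hW z hz t).2⟩
  set P : ℝ → Prop := fun s => CohomologousAt (pullCocycle (fun z => W z s) φ)
    (pullCocycle (fun z => W z 0) φ) (fun z => transport φ (W z) 0 s) z
  have step : ∀ s, ∃ r > 0, ∀ s₁ ∈ Metric.ball s r, ∀ s₂ ∈ Metric.ball s r, P s₁ → P s₂ := by
    intro s
    obtain ⟨N, hN, H⟩ := (hW z hz s).2.pull (f := Function.uncurry W) (hW z hz s).1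
    rw [nhds_prod_eq, Filter.mem_prod_iff] at hN
    obtain ⟨A, hA, B, hB, hAB⟩ := hN
    obtain ⟨r, hr, hrB⟩ := Metric.mem_nhds_iff.1 hB
    refine ⟨r, hr, fun s₁ hs₁ s₂ hs₂ ⟨M, hM, HM⟩ => ⟨M ∩ (A ∩ U),
      inter_mem hM (inter_mem hA (hU.mem_nhds hz)), fun a ha b hb => ?_⟩⟩
    have hmem : ∀ c ∈ A, ∀ t ∈ Metric.ball s r, (c, t) ∈ N := fun c hc t ht =>
      hAB (mk_mem_prod hc (hrB ht))
    -- For short steps the transport is the value of the cocycle itself.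
    have tr : ∀ c ∈ A, c ∈ U → transport φ (W c) s₁ s₂ = φ (W c s₁) (W c s₂) := by
      intro c hc hcU
      obtain ⟨f, hf, hf'⟩ := (hT c hcU).exists_primitive
      rw [hf']
      have := primitive_unique (convex_ball s r).isPreconnected (fun x _ => hf x)
        (g := fun t => φ (W c s₁) (W c t)) (fun x hx => ⟨Metric.ball s r,
          Metric.isOpen_ball.mem_nhds hx, fun y hy w hw => by
            have := H (c, s₁) (hmem c hc _ hs₁) (c, y) (hmem c hc _ hy) (c, w) (hmem c hc _ hw)
            simp only [pullCocycle, Function.uncurry] at this ⊢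
            rw [← this]
            group⟩) hs₁ hs₂
      rw [this, show φ (W c s₁) (W c s₁) = 1 from cocycle_self H (hmem c hc _ hs₁)]
      simp
    have tb : transport φ (W b) 0 s₂ = transport φ (W b) 0 s₁ * φ (W b s₁) (W b s₂) := by
      rw [← tr b hb.2.1 hb.2.2, transport_mul (hT b hb.2.2)]
    have ta : transport φ (W a) 0 s₂ = transport φ (W a) 0 s₁ * φ (W a s₁) (W a s₂) := by
      rw [← tr a ha.2.1 ha.2.2, transport_mul (hT a ha.2.2)]
    -- The two ways around the small square with corners `(a, s₁)`, `(a, s₂)`, `(b, s₁)`, `(b, s₂)`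
    -- have the same product.
    have e1 := HM a ha.1 b hb.1
    have e2 := H (a, s₁) (hmem a ha.2.1 _ hs₁) (a, s₂) (hmem a ha.2.1 _ hs₂) (b, s₂)
      (hmem b hb.2.1 _ hs₂)
    have e3 := H (a, s₁) (hmem a ha.2.1 _ hs₁) (b, s₁) (hmem b hb.2.1 _ hs₁) (b, s₂)
      (hmem b hb.2.1 _ hs₂)
    simp only [pullCocycle, Function.uncurry] at e1 e2 e3 ⊢
    rw [eq_comm, ← inv_mul_eq_iff_eq_mul] at e2
    rw [← e2, ← e3, e1, ta, tb]
    group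
  have hP : P 0 := by
    have hc : ContinuousAt (fun z => W z 0) z :=
      (hW z hz 0).1.comp (f := fun z => (z, (0 : ℝ))) (by fun_prop)
    refine ⟨univ, univ_mem, fun a _ b _ => ?_⟩
    have t0 : ∀ c, transport φ (W c) 0 0 = 1 := fun c => by
      rw [transport]; split_ifs <;> simp
    simp [t0]
  refine isPreconnected_univ.induction₂' (fun x y => P x → P y) (fun x _ => ?_)
    (fun x y z _ _ _ h h' => h' ∘ h) (mem_univ 0) (mem_univ s) hP
  obtain ⟨r, hr, h⟩ := step x
  filter_upwards [mem_nhdsWithin_of_mem_nhds (Metric.ball_mem_nhds x hr)] with y hy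
  exact ⟨h x (Metric.mem_ball_self hr) y hy, h y hy x (Metric.mem_ball_self hr)⟩

/-- Transport along the two ends of a homotopy of paths. -/
theorem transport_homotopy {φ : X → X → G} {W : ℝ → ℝ → X}
    (hW : ∀ t s, ContinuousAt (Function.uncurry W) (t, s) ∧ CocycleAt φ (W t s)) (a b s : ℝ) :
    transport φ (fun t => W t s) a b =
      (transport φ (W a) 0 s)⁻¹ * transport φ (fun t => W t 0) a b * transport φ (W b) 0 s := by
  have h0 : Transportable φ fun t => W t 0 := fun t =>
    ⟨(hW t 0).1.comp (f := fun t => (t, (0 : ℝ))) (by fun_prop), (hW t 0).2⟩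
  obtain ⟨f, hf, hf'⟩ := h0.exists_primitive
  rw [hf', transport_eq fun t => (homotopy_cohomologous isOpen_univ (fun z _ => hW z)
    (mem_univ t) s).primitiveAt (hf t)]
  simp [mul_assoc]

/-- Transport along freely homotopic loops. -/
theorem transport_pow_eq_one_of_homotopy {φ : X → X → G} {W : ℝ → ℝ → X}
    (hW : ∀ t s, ContinuousAt (Function.uncurry W) (t, s) ∧ CocycleAt φ (W t s))
    (h01 : W 0 = W 1) (d : ℕ) (s : ℝ) :
    transport φ (fun t => W t s) 0 1 ^ d = 1 ↔ transport φ (fun t => W t 0) 0 1 ^ d = 1 := by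
  rw [transport_homotopy hW, h01]
  set g := transport φ (W 1) 0 s
  have := conj_pow (a := g⁻¹) (b := transport φ (fun t => W t 0) 0 1) (i := d)
  rw [inv_inv] at this
  rw [this]
  constructor
  · intro h
    have := congrArg (fun x => g * x * g⁻¹) h
    simpa [mul_assoc] using this
  · intro h; simp [h]

end LocalCocycle

/-! ### Small loops around a locally flat set, and connectedness of its complement -/

section LocallyFlat

variable {X Y G : Type*} [TopologicalSpace X] [TopologicalSpace Y] [Group G]

/-- The `d`-th powers of the transports of `φ` along small loops off `A` near `p` are trivial. -/
def LoopsKilledAt (φ : X → X → G) (A : Set X) (d : ℕ) (p : X) : Prop :=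
  ∃ U ∈ 𝓝 p, ∀ γ : ℝ → X, Continuous γ → γ 0 = γ 1 → (∀ t, γ t ∈ U \ A) →
    transport φ γ 0 1 ^ d = 1

/-- Near `p`, the set `A` looks like a linear subspace of codimension at least two. -/
def FlatAt (A : Set X) (p : X) : Prop :=
  ∃ (B F : Type) (_ : NormedAddCommGroup B) (_ : NormedSpace ℝ B) (_ : NormedAddCommGroup F)
    (_ : NormedSpace ℝ F), 1 < Module.rank ℝ F ∧ ∃ g : B × F → X, IsOpenEmbedding g ∧
      p ∈ range g ∧ ∀ x, g x ∈ A ↔ x.2 = 0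

/-- The retraction of the line onto the unit interval. -/
noncomputable def clamp (t : ℝ) : ℝ := max 0 (min t 1)

@[fun_prop]
theorem continuous_clamp : Continuous clamp := by unfold clamp; fun_prop

theorem clamp_mem (t : ℝ) : clamp t ∈ Icc (0 : ℝ) 1 :=
  ⟨le_max_left _ _, max_le zero_le_one (min_le_right _ _)⟩

@[simp] theorem clamp_zero : clamp 0 = 0 := by simp [clamp]

@[simp] theorem clamp_one : clamp 1 = 1 := by simp [clamp]

/-- Contraction of the slice chart towards `p` preserves the complement of `A` and moves any loop in
the chart into a prescribed neighbourhood of `p`. Hence the condition at `p` controls all loops in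
the chart, including those near `q`. -/
theorem LoopsKilledAt.of_mem_slice {φ : X → X → G} {A : Set X} (hφ : ∀ p ∉ A, CocycleAt φ p)
    {B F : Type*} [NormedAddCommGroup B] [NormedSpace ℝ B] [NormedAddCommGroup F]
    [NormedSpace ℝ F] {g : B × F → X} (hg : IsOpenEmbedding g) (hgA : ∀ x, g x ∈ A ↔ x.2 = 0)
    {d : ℕ} {p q : X} (hp : p ∈ A) (hpg : p ∈ range g) (hqg : q ∈ range g)
    (h : LoopsKilledAt φ A d p) : LoopsKilledAt φ A d q := by
  obtain ⟨U, hU, H⟩ := h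
  obtain ⟨⟨b, f⟩, rfl⟩ := hpg
  obtain rfl : f = 0 := (hgA _).1 hp
  refine ⟨range g, hg.isOpen_range.mem_nhds hqg, fun γ hγ h01 hγU => ?_⟩
  choose c hc using fun t => (hγU t).1
  have hcc : Continuous c := by
    rw [hg.isEmbedding.continuous_iff]
    exact (funext hc : g ∘ c = γ) ▸ hγ
  have hc2 : ∀ t, (c t).2 ≠ 0 := fun t h => (hγU t).2 (by rw [← hc t]; exact (hgA _).2 h)
  have hc01 : c 0 = c 1 := hg.injective (by rw [hc, hc, h01])
  obtain ⟨r, hr, hrU⟩ := Metric.mem_nhds_iff.1 (hg.continuous.continuousAt (x := (b, 0)) hU)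
  obtain ⟨R, hR⟩ := (isCompact_Icc.image (f := c) hcc (s := Icc 0 1)).isBounded.subset_closedBall
    (b, 0)
  set δ : ℝ := min 1 (r / (|R| + 1))
  have hδ : 0 < δ := lt_min one_pos (by positivity)
  -- The scale runs from `1` at `s = 0` to `δ` at `s = 1`, and is positive for all real `s`, so that
  -- the homotopy never meets `A`.
  set l : ℝ → ℝ := fun s => max δ (1 - s)
  have hl : ∀ s, 0 < l s := fun s => hδ.trans_le (le_max_left _ _)
  set k : ℝ → ℝ → B × F := fun t s =>
    (b + l s • ((c (clamp t)).1 - b), l s • (c (clamp t)).2) with hk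
  have hkc : Continuous (Function.uncurry k) := by
    simp only [hk, l, Function.uncurry_def]
    fun_prop
  have hW : ∀ t s, ContinuousAt (Function.uncurry fun t s => g (k t s)) (t, s) ∧
      CocycleAt φ (g (k t s)) := fun t s => by
    refine ⟨(hg.continuous.comp hkc).continuousAt, hφ _ fun h => ?_⟩
    exact smul_ne_zero (hl s).ne' (hc2 _) ((hgA _).1 h)
  have key := transport_pow_eq_one_of_homotopy hW (by simp [hk, hc01]) d 1
  have e0 : (fun t => g (k t 0)) = γ ∘ clamp := by
    funext t
    have : l 0 = 1 := by simp [l, δ]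
    simp [hk, this, hc]
  have hγT : Transportable φ γ := fun t => ⟨hγ.continuousAt, hφ _ (hγU t).2⟩
  rw [e0, transport_reparam hγT continuous_clamp, clamp_zero, clamp_one] at key
  refine key.1 (H _ ?_ ?_ fun t => ⟨hrU ?_, fun h => ?_⟩)
  · exact hg.continuous.comp (hkc.comp (by fun_prop : Continuous fun t : ℝ => (t, (1 : ℝ))))
  · simp [hk, hc01]
  · have l1 : l 1 = δ := by simp [l, hδ.le]
    have hm : c (clamp t) ∈ Metric.closedBall (b, 0) R := hR ⟨_, clamp_mem t, rfl⟩
    rw [Metric.mem_closedBall, dist_eq_norm] at hm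
    rw [Metric.mem_ball, dist_eq_norm]
    have : k t 1 - (b, 0) = δ • (c (clamp t) - (b, 0)) := by
      ext <;> simp [hk, l1]
    rw [this, norm_smul, Real.norm_of_nonneg hδ.le]
    calc δ * ‖c (clamp t) - (b, 0)‖ ≤ r / (|R| + 1) * |R| := by
          gcongr
          · exact min_le_right _ _
          · exact hm.trans (le_abs_self R)
      _ < r := by
        rw [div_mul_eq_mul_div, div_lt_iff₀ (by positivity)]
        nlinarith
  · exact smul_ne_zero (hl 1).ne' (hc2 _) ((hgA _).1 h)

/-- Along a connected locally flat set, the powers of the small loops which are killed are the same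
everywhere. -/
theorem LoopsKilledAt.of_isPreconnected {φ : X → X → G} {A : Set X}
    (hφ : ∀ p ∉ A, CocycleAt φ p) (hA : IsPreconnected A) (hflat : ∀ p ∈ A, FlatAt A p) {d : ℕ}
    {p q : X} (hp : p ∈ A) (hq : q ∈ A) (h : LoopsKilledAt φ A d p) : LoopsKilledAt φ A d q := by
  refine hA.induction₂' (fun p q => LoopsKilledAt φ A d p → LoopsKilledAt φ A d q)
    (fun x hx => ?_) (fun _ _ _ _ _ _ h h' => h' ∘ h) hp hq h
  obtain ⟨B, F, _, _, _, _, -, g, hg, hxg, hgA⟩ := hflat x hx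
  filter_upwards [self_mem_nhdsWithin, mem_nhdsWithin_of_mem_nhds
    (hg.isOpen_range.mem_nhds hxg)] with y hy hyg
  exact ⟨.of_mem_slice hφ hg hgA hx hxg hyg, .of_mem_slice hφ hg hgA hy hyg hxg⟩

theorem LoopsKilledAt.pull {φ : X → X → G} {A : Set X} {d : ℕ} (e : Y ≃ₜ X) {p : X}
    (h : LoopsKilledAt φ A d p) :
    LoopsKilledAt (pullCocycle e φ) (e ⁻¹' A) d (e.symm p) := by
  obtain ⟨U, hU, H⟩ := h
  refine ⟨e ⁻¹' U, e.continuous.continuousAt (by simpa using hU), fun γ hγ h01 hγU => ?_⟩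
  rw [transport_pull]
  exact H _ (e.continuous.comp hγ) (congrArg e h01) hγU

/-- A coboundary only conjugates transports along loops, and conjugation does not affect the
triviality of powers. -/
theorem CohomologousAt.loopsKilledAt {φ ψ : X → X → G} {ξ : X → G} {A : Set X}
    (hψ : ∀ p ∉ A, CocycleAt ψ p) (h : ∀ p ∉ A, CohomologousAt φ ψ ξ p) {d : ℕ} {p : X}
    (hp : LoopsKilledAt ψ A d p) : LoopsKilledAt φ A d p := by
  obtain ⟨U, hU, H⟩ := hp
  refine ⟨U, hU, fun γ hγ h01 hγU => ?_⟩
  have hT : Transportable ψ γ := fun t => ⟨hγ.continuousAt, hψ _ (hγU t).2⟩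
  rw [hT.cohomologous fun t => h _ (hγU t).2, ← h01]
  have := conj_pow (a := (ξ (γ 0))⁻¹) (b := transport ψ γ 0 1) (i := d)
  rw [inv_inv] at this
  rw [this, H γ hγ h01 hγU]
  simp

/-- The complement of a locally flat set of codimension at least two is connected. -/
theorem isPreconnected_compl_of_flat [PreconnectedSpace X] {A : Set X} (hA : IsClosed A)
    (hflat : ∀ p ∈ A, FlatAt A p) : IsPreconnected Aᶜ := by
  rw [isPreconnected_iff_subset_of_disjoint]
  intro u v hu hv huv hdisj
  -- A separation of the complement is thickened to two open sets covering all of `X`: near a point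
  -- of `A` the complement is locally connected in the slice chart, so it lies in one side. They
  -- must meet, and the complement is dense, a contradiction.
  have hQ : ∀ w : Set X, IsOpen {p | ∀ᶠ q in 𝓝 p, q ∉ A → q ∈ w} := fun w =>
    isOpen_iff_mem_nhds.2 fun p hp => eventually_eventually_nhds.2 hp
  have hcov : ∀ p, (∀ᶠ q in 𝓝 p, q ∉ A → q ∈ u) ∨ (∀ᶠ q in 𝓝 p, q ∉ A → q ∈ v) := by
    intro p
    by_cases hp : p ∈ A
    · obtain ⟨B, F, _, _, _, _, hrank, g, hg, hpg, hgA⟩ := hflat p hp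
      have hpre : IsPreconnected (g '' (univ ×ˢ {0}ᶜ)) :=
        (isPreconnected_univ.prod (isPathConnected_compl_singleton_of_one_lt_rank hrank
          (0 : F)).isConnected.isPreconnected).image _ hg.continuous.continuousOn
      have hsub : g '' (univ ×ˢ {0}ᶜ) ⊆ Aᶜ := by
        rintro _ ⟨x, hx, rfl⟩ h
        exact hx.2 ((hgA x).1 h)
      have hmem : ∀ q ∈ range g, q ∉ A → q ∈ g '' (univ ×ˢ {0}ᶜ) := by
        rintro _ ⟨x, rfl⟩ hx
        exact ⟨x, ⟨mem_univ _, fun h => hx ((hgA x).2 h)⟩, rfl⟩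
      rcases isPreconnected_iff_subset_of_disjoint.1 hpre u v hu hv (hsub.trans huv)
        (subset_empty_iff.1 (hdisj ▸ inter_subset_inter_left _ hsub)) with h | h
      · refine .inl ?_
        filter_upwards [hg.isOpen_range.mem_nhds hpg] with q hq hqA using h (hmem q hq hqA)
      · refine .inr ?_
        filter_upwards [hg.isOpen_range.mem_nhds hpg] with q hq hqA using h (hmem q hq hqA)
    · rcases huv hp with h | h
      · refine .inl ?_
        filter_upwards [hu.mem_nhds h] with q hq _ using hq
      · refine .inr ?_
        filter_upwards [hv.mem_nhds h] with q hq _ using hq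
  have hne : ∀ p, ∃ᶠ q in 𝓝 p, q ∉ A := by
    intro p
    by_cases hp : p ∈ A
    · obtain ⟨B, F, _, _, _, _, hrank, g, hg, ⟨⟨b, f⟩, rfl⟩, hgA⟩ := hflat p hp
      obtain rfl : f = 0 := (hgA _).1 hp
      have : Nontrivial F := rank_pos_iff_nontrivial.1 (zero_lt_one.trans hrank)
      have : ∃ᶠ y in 𝓝 (0 : F), y ≠ 0 := by
        have := Module.punctured_nhds_neBot ℝ F 0
        exact Filter.frequently_iff_neBot.2 this
      have hc : Tendsto (fun y : F => g (b, y)) (𝓝 0) (𝓝 (g (b, 0))) :=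
        (hg.continuous.comp (by fun_prop : Continuous fun y : F => (b, y))).tendsto 0
      exact hc.frequently (this.mono fun y hy h => hy ((hgA _).1 h))
    · have : ∀ᶠ q in 𝓝 p, q ∉ A := hA.isOpen_compl.mem_nhds hp
      exact this.frequently
  by_contra! hcon
  obtain ⟨⟨x, hx, hxu⟩, ⟨y, hy, hyv⟩⟩ := hcon.imp not_subset.1 not_subset.1
  have hx' := (hcov x).resolve_left fun h => hxu (h.self_of_nhds hx)
  have hy' := (hcov y).resolve_right fun h => hyv (h.self_of_nhds hy)
  obtain ⟨z, -, hzu, hzv⟩ := (isPreconnected_univ (α := X)) _ _ (hQ u) (hQ v)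
    (fun p _ => hcov p) ⟨y, mem_univ _, hy'⟩ ⟨x, mem_univ _, hx'⟩
  obtain ⟨q, hqA, hq⟩ := ((hne z).and_eventually (hzu.and hzv)).exists
  exact (hdisj ▸ (⟨hqA, hq.1 hqA, hq.2 hqA⟩ : q ∈ Aᶜ ∩ (u ∩ v)) : q ∈ (∅ : Set X))

end LocallyFlat

/-! ### Knots are locally flat, and their complements are path connected -/

section KnotFlat

theorem one_lt_rank_complement {n : ℕ} {F : Type} [NormedAddCommGroup F] [NormedSpace ℝ F]
    (e : (EuclideanSpace ℝ (Fin n) × F) ≃L[ℝ] EuclideanSpace ℝ (Fin (n + 2))) :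
    1 < Module.rank ℝ F := by
  have : Module.Finite ℝ (EuclideanSpace ℝ (Fin n) × F) :=
    Module.Finite.equiv e.symm.toLinearEquiv
  have : Module.Finite ℝ F :=
    Module.Finite.of_surjective (LinearMap.snd ℝ (EuclideanSpace ℝ (Fin n)) F) Prod.snd_surjective
  have h := e.toLinearEquiv.finrank_eq
  rw [Module.finrank_prod, finrank_euclideanSpace_fin, finrank_euclideanSpace_fin] at h
  rw [← Module.finrank_eq_rank]
  exact_mod_cast (by omega : 1 < Module.finrank ℝ F)

theorem univBall_eq {E : Type*} [NormedAddCommGroup E] [NormedSpace ℝ E] (c : E) {r : ℝ}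
    (hr : 0 < r) (x : E) :
    OpenPartialHomeomorph.univBall c r x = (r • (√(1 + ‖x‖ ^ 2))⁻¹ • x) + c := by
  rw [OpenPartialHomeomorph.univBall, dif_pos hr]
  rfl

variable {n : ℕ}

/-- The local form of an immersion straightens one sheet, and the embedding property excludes
others. The resulting chart is restricted to a small ball, which is then reparametrized by the whole
space. -/
theorem Knot.flatAt (K : Knot n) {p : Sph (n + 2)} (hp : p ∈ K.carrier) :
    FlatAt K.carrier p := by
  obtain ⟨f, hf, hfK⟩ := K.exists_embedding
  rw [← hfK] at hp ⊢
  obtain ⟨x, rfl⟩ := hp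
  obtain ⟨F, _, _, h⟩ := hf.isImmersion.isImmersionAt x
  -- Inside `V` the knot consists only of the image of the chart domain around `x`.
  obtain ⟨V, hV, hVx⟩ := hf.isEmbedding.isOpen_iff.1 h.domChart.open_source
  have hw : ∀ u ∈ h.domChart.target, h.codChart (f (h.domChart.symm u)) = h.equiv (u, 0) := by
    intro u hu
    have := h.writtenInCharts (by simpa using hu : u ∈ (h.domChart.extend (𝓡 n)).target)
    simpa using this
  set θ := h.equiv.toHomeomorph.toOpenPartialHomeomorph.trans h.codChart.symm
  have hθ : ∀ y, θ y = h.codChart.symm (h.equiv y) := fun _ => rfl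
  have hθs : ∀ y, y ∈ θ.source ↔ h.equiv y ∈ h.codChart.target := fun y => by simp [θ]
  have hs : h.domChart.source ⊆ f ⁻¹' h.codChart.source := h.source_subset_preimage_source
  have hb : ∀ u ∈ h.domChart.target, (u, (0 : F)) ∈ θ.source ∧
      θ (u, 0) = f (h.domChart.symm u) := by
    intro u hu
    have hm := hs (h.domChart.map_target hu)
    rw [hθs, hθ, ← hw u hu]
    exact ⟨h.codChart.map_source hm, h.codChart.left_inv hm⟩
  set c : EuclideanSpace ℝ (Fin n) × F := (h.domChart x, 0)
  have hxt : h.domChart x ∈ h.domChart.target := h.domChart.map_source h.mem_domChart_source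
  have hθc : θ c = f x := by
    rw [(hb _ hxt).2, h.domChart.left_inv h.mem_domChart_source]
  have hO : θ.source ∩ θ ⁻¹' V ∩ Prod.fst ⁻¹' h.domChart.target ∈ 𝓝 c := by
    refine inter_mem ((θ.isOpen_inter_preimage hV).mem_nhds ⟨(hb _ hxt).1, ?_⟩)
      ((h.domChart.open_target.preimage continuous_fst).mem_nhds hxt)
    rw [mem_preimage, hθc]
    exact (hVx ▸ h.mem_domChart_source : x ∈ f ⁻¹' V)
  obtain ⟨r, hr, hrO⟩ := Metric.mem_nhds_iff.1 hO
  have hball : ∀ y, OpenPartialHomeomorph.univBall c r y ∈ Metric.ball c r := fun y => by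
    rw [← OpenPartialHomeomorph.univBall_target c hr]
    exact OpenPartialHomeomorph.map_source _ (by simp)
  refine ⟨EuclideanSpace ℝ (Fin n), F, inferInstance, inferInstance, inferInstance, inferInstance,
    one_lt_rank_complement h.equiv,
    (OpenPartialHomeomorph.univBall c r).trans θ, OpenPartialHomeomorph.isOpenEmbedding _ ?_,
    ⟨0, ?_⟩, fun y => ?_⟩
  · refine eq_univ_of_forall fun y => ?_
    simpa using (hrO (hball y)).1.1
  · simp [hθc]
  · rw [OpenPartialHomeomorph.coe_trans, Function.comp_apply]
    have hz := hrO (hball y)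
    -- The centre lies on the slice and the reparametrization is radial about it, so the slice is
    -- preserved.
    have hz2 : (OpenPartialHomeomorph.univBall c r y).2 = 0 ↔ y.2 = 0 := by
      have : (√(1 + ‖y‖ ^ 2)) ≠ 0 := (Real.sqrt_pos.2 (by positivity)).ne'
      simp [univBall_eq c hr, c, hr.ne', this]
    rw [← hz2]
    generalize OpenPartialHomeomorph.univBall c r y = z at hz
    constructor
    · rintro ⟨w, hw'⟩
      have hwV : w ∈ h.domChart.source := hVx ▸ (hw' ▸ hz.1.2 : f w ∈ V)
      have h1 := hb _ (h.domChart.map_source hwV)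
      rw [h.domChart.left_inv hwV, hw'] at h1
      exact (congrArg Prod.snd (θ.injOn h1.1 hz.1.1 h1.2)).symm
    · intro h0
      obtain ⟨u, v⟩ := z
      obtain rfl : v = 0 := h0
      exact ⟨_, (hb u hz.2).2.symm⟩

theorem one_lt_rank_euclidean (n : ℕ) : 1 < Module.rank ℝ (EuclideanSpace ℝ (Fin (n + 2))) := by
  rw [← Module.finrank_eq_rank, finrank_euclideanSpace_fin]
  exact_mod_cast (by omega : 1 < n + 2)

/-- Positive dimension is needed, as `S^0` is disconnected. Connectedness allows the condition on
small loops to be tested at a single point. -/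
theorem Knot.isPreconnected_carrier (K : Knot (n + 1)) : IsPreconnected K.carrier := by
  obtain ⟨f, hf, hfK⟩ := K.exists_embedding
  rw [← hfK]
  have : PreconnectedSpace (Sph (n + 1)) :=
    Subtype.preconnectedSpace (isPreconnected_sphere (one_lt_rank_euclidean n) 0 1)
  exact isPreconnected_range hf.isEmbedding.continuous

theorem Knot.isClosed_carrier (K : Knot n) : IsClosed K.carrier := by
  obtain ⟨f, hf, hfK⟩ := K.exists_embedding
  rw [← hfK]
  exact (isCompact_range hf.isEmbedding.continuous).isClosed

theorem Knot.pathConnectedSpace_complement (K : Knot n) (x₀ : K.Complement) :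
    PathConnectedSpace K.Complement := by
  have : PreconnectedSpace (Sph (n + 2)) :=
    Subtype.preconnectedSpace (isPreconnected_sphere (one_lt_rank_euclidean (n + 1)) 0 1)
  have : LocallyPathConnectedSpace (Sph (n + 2)) :=
    ChartedSpace.locallyPathConnectedSpace (EuclideanSpace ℝ (Fin (n + 2))) _
  have h : IsPreconnected K.carrierᶜ :=
    isPreconnected_compl_of_flat K.isClosed_carrier fun p hp => K.flatAt hp
  have : IsPathConnected K.carrierᶜ :=
    (K.isClosed_carrier.isOpen_compl.isConnected_iff_isPathConnected).1 ⟨⟨x₀.1, x₀.2⟩, h⟩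
  exact isPathConnected_iff_pathConnectedSpace.1 this

end KnotFlat

/-! ### Cylindrical coordinates, radial projection and branches of the argument -/

section Cylindrical

variable {m : ℕ}

/-- The first two coordinates, as a complex number. -/
noncomputable def planar (p : EuclideanSpace ℝ (Fin (m + 2))) : ℂ := ⟨p 0, p 1⟩

/-- The coordinates other than the first two. -/
def rest (p : EuclideanSpace ℝ (Fin (m + 2))) : Fin m → ℝ := fun i => p i.succ.succ

/-- The point with given planar part and remaining coordinates. -/
noncomputable def cyl (z : ℂ) (r : Fin m → ℝ) : EuclideanSpace ℝ (Fin (m + 2)) :=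
  WithLp.toLp 2 (Fin.cons z.re (Fin.cons z.im r))

@[simp] theorem planar_cyl (z : ℂ) (r : Fin m → ℝ) : planar (cyl z r) = z := rfl

@[simp] theorem rest_cyl (z : ℂ) (r : Fin m → ℝ) : rest (cyl z r) = r := rfl

@[simp] theorem cyl_planar_rest (p : EuclideanSpace ℝ (Fin (m + 2))) :
    cyl (planar p) (rest p) = p := by
  ext i
  refine Fin.cases rfl (fun i => Fin.cases rfl (fun i => rfl) i) i

theorem ext_planar_rest {p q : EuclideanSpace ℝ (Fin (m + 2))} (h : planar p = planar q)
    (h' : rest p = rest q) : p = q := by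
  rw [← cyl_planar_rest p, h, h', cyl_planar_rest]

@[fun_prop]
theorem continuous_planar : Continuous (planar (m := m)) := by
  have : planar (m := m) = fun p => Complex.equivRealProdCLM.symm (p 0, p 1) := rfl
  rw [this]
  fun_prop

@[fun_prop]
theorem continuous_rest : Continuous (rest (m := m)) := by unfold rest; fun_prop

@[fun_prop]
theorem continuous_cyl : Continuous fun x : ℂ × (Fin m → ℝ) => cyl x.1 x.2 := by
  refine (PiLp.continuous_toLp 2 _).comp (continuous_pi fun i => ?_)
  refine Fin.cases ?_ (fun i => Fin.cases ?_ (fun i => ?_) i) i <;>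
  simp only [Fin.cons_zero, Fin.cons_succ] <;> fun_prop

theorem smul_cyl (c : ℝ) (z : ℂ) (r : Fin m → ℝ) : c • cyl z r = cyl (c • z) (c • r) := by
  ext i
  refine Fin.cases ?_ (fun i => Fin.cases ?_ (fun i => ?_) i) i <;> simp [cyl]

theorem norm_cyl_sq (z : ℂ) (r : Fin m → ℝ) : ‖cyl z r‖ ^ 2 = ‖z‖ ^ 2 + ∑ i, r i ^ 2 := by
  rw [EuclideanSpace.norm_sq_eq, Fin.sum_univ_succ, Fin.sum_univ_succ, Complex.sq_norm,
    Complex.normSq_apply]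
  simp [cyl, add_assoc, sq]

theorem norm_le_norm_cyl (z : ℂ) (r : Fin m → ℝ) : ‖z‖ ≤ ‖cyl z r‖ := by
  refine le_of_sq_le_sq ?_ (norm_nonneg _)
  rw [norm_cyl_sq]
  have : 0 ≤ ∑ i, r i ^ 2 := Finset.sum_nonneg fun i _ => sq_nonneg _
  linarith

theorem cyl_ne_zero {z : ℂ} (hz : z ≠ 0) (r : Fin m → ℝ) : cyl z r ≠ 0 :=
  norm_pos_iff.1 ((norm_pos_iff.2 hz).trans_le (norm_le_norm_cyl z r))

/-- The planar part is not scaled, so the norm shrinks at most by the factor `s`. This keeps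
homogeneous inequalities valid when a point is pushed towards the plane. -/
theorem mul_norm_cyl_le (z : ℂ) (r : Fin m → ℝ) {s : ℝ} (h0 : 0 ≤ s) (h1 : s ≤ 1) :
    s * ‖cyl z r‖ ≤ ‖cyl z (s • r)‖ := by
  refine le_of_sq_le_sq ?_ (norm_nonneg _)
  rw [mul_pow, norm_cyl_sq, norm_cyl_sq]
  simp only [Pi.smul_apply, smul_eq_mul, mul_pow, ← Finset.mul_sum]
  have : s ^ 2 ≤ 1 := pow_le_one₀ h0 h1
  nlinarith [sq_nonneg ‖z‖]

/-- Radial projection to the unit sphere; the value at the origin is irrelevant. -/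
noncomputable def radial (v : EuclideanSpace ℝ (Fin (m + 2))) : Sph (m + 1) :=
  open Classical in
  if h : v = 0 then ⟨EuclideanSpace.single 0 1, by simp⟩
  else ⟨‖v‖⁻¹ • v, by simp [norm_smul, h]⟩

theorem radial_coe {v : EuclideanSpace ℝ (Fin (m + 2))} (h : v ≠ 0) :
    (radial v : EuclideanSpace ℝ (Fin (m + 2))) = ‖v‖⁻¹ • v := by rw [radial, dif_neg h]

theorem continuousAt_radial {v : EuclideanSpace ℝ (Fin (m + 2))} (h : v ≠ 0) :
    ContinuousAt radial v := by
  rw [IsInducing.subtypeVal.continuousAt_iff]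
  have : ContinuousAt (fun v : EuclideanSpace ℝ (Fin (m + 2)) => ‖v‖⁻¹ • v) v :=
    (continuousAt_id.norm.inv₀ (norm_ne_zero_iff.2 h)).smul continuousAt_id
  refine this.congr ?_
  filter_upwards [isOpen_ne.mem_nhds h] with w hw
  exact (radial_coe hw).symm

theorem radial_smul {c : ℝ} (hc : 0 < c) (v : EuclideanSpace ℝ (Fin (m + 2))) :
    radial (c • v) = radial v := by
  by_cases h : v = 0
  · simp [h]
  · refine Subtype.ext ?_
    rw [radial_coe h, radial_coe (smul_ne_zero hc.ne' h), norm_smul, Real.norm_of_nonneg hc.le,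
      smul_smul]
    congr 1
    field_simp

theorem sph_norm (p : Sph (m + 1)) : ‖p.1‖ = 1 := mem_sphere_zero_iff_norm.1 p.2

theorem radial_self (p : Sph (m + 1)) : radial p.1 = p := by
  have h := sph_norm p
  have h0 : p.1 ≠ 0 := norm_ne_zero_iff.1 (by rw [h]; exact one_ne_zero)
  refine Subtype.ext ?_
  rw [radial_coe h0, h]
  simp

theorem planar_smul (c : ℝ) (v : EuclideanSpace ℝ (Fin (m + 2))) :
    planar (c • v) = c • planar v := by
  apply Complex.ext <;> simp [planar]

theorem rest_smul (c : ℝ) (v : EuclideanSpace ℝ (Fin (m + 2))) : rest (c • v) = c • rest v := by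
  ext i; simp [rest]

/-- The direction `z` in the plane, as a point of the sphere. -/
noncomputable def circlePoint (m : ℕ) (z : ℂ) : Sph (m + 1) := radial (cyl z 0)

theorem continuousAt_circlePoint {z : ℂ} (hz : z ≠ 0) : ContinuousAt (circlePoint m) z :=
  (continuousAt_radial (cyl_ne_zero hz 0)).comp
    (f := fun z => cyl z (0 : Fin m → ℝ))
    (continuous_cyl.comp (by fun_prop : Continuous fun z : ℂ => (z, (0 : Fin m → ℝ)))).continuousAt

theorem circlePoint_smul {c : ℝ} (hc : 0 < c) (z : ℂ) :
    circlePoint m (c • z) = circlePoint m z := by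
  rw [circlePoint, circlePoint, ← radial_smul hc (cyl z 0), smul_cyl, smul_zero]

/-- The point of the great circle in the plane at angle `x`. -/
noncomputable def anglePoint (m : ℕ) (x : ℝ) : Sph (m + 1) :=
  circlePoint m (Complex.exp (x * Complex.I))

theorem continuous_anglePoint : Continuous (anglePoint m) :=
  continuous_iff_continuousAt.2 fun x =>
    (continuousAt_circlePoint (Complex.exp_ne_zero _)).comp
      (f := fun x : ℝ => Complex.exp (x * Complex.I)) (by fun_prop)

theorem anglePoint_add_int (x : ℝ) (j : ℤ) :
    anglePoint m (x + j * (2 * Real.pi)) = anglePoint m x := by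
  rw [anglePoint, anglePoint]
  congr 1
  rw [Complex.exp_eq_exp_iff_exists_int]
  exact ⟨j, by push_cast; ring⟩

/-- The great circle in the plane, as a loop parametrized by the unit interval. -/
noncomputable def stdLoop (m : ℕ) (t : ℝ) : Sph (m + 1) := anglePoint m (2 * Real.pi * t)

/-- A branch of the argument which is continuous at `w`. -/
noncomputable def argNear (w z : ℂ) : ℝ := w.arg + (z / w).arg

theorem continuousAt_argNear {w : ℂ} (hw : w ≠ 0) : ContinuousAt (argNear w) w := by
  refine continuousAt_const.add ((Complex.continuousAt_arg ?_).comp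
    (f := fun z => z / w) (continuousAt_id.div_const w))
  simp [div_self hw]

theorem norm_smul_exp_argNear {w z : ℂ} (hw : w ≠ 0) (_ : z ≠ 0) :
    ‖z‖ • Complex.exp (argNear w z * Complex.I) = z := by
  rw [argNear, Complex.ofReal_add, add_mul, Complex.exp_add, Complex.real_smul]
  have h1 := Complex.norm_mul_exp_arg_mul_I w
  have h2 := Complex.norm_mul_exp_arg_mul_I (z / w)
  have hw' : (‖w‖ : ℂ) ≠ 0 := by simpa using hw
  rw [norm_div, Complex.ofReal_div] at h2
  have h3 : (‖z‖ : ℂ) = ‖w‖ * (‖z‖ / ‖w‖) := by field_simp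
  calc _ = (‖w‖ * Complex.exp (w.arg * Complex.I)) *
        (‖z‖ / ‖w‖ * Complex.exp ((z / w).arg * Complex.I)) := by rw [h3]; ring_nf; field_simp
    _ = z := by rw [h1, h2]; field_simp

theorem arg_eq_argNear_add {w z : ℂ} (hw : w ≠ 0) (hz : z ≠ 0) :
    ∃ j : ℤ, z.arg = argNear w z + j * (2 * Real.pi) := by
  have h1 := norm_smul_exp_argNear hw hz
  have h2 := Complex.norm_mul_exp_arg_mul_I z
  rw [Complex.real_smul] at h1
  have h3 : Complex.exp (z.arg * Complex.I) = Complex.exp (argNear w z * Complex.I) :=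
    mul_left_cancel₀ (by simpa using hz : (‖z‖ : ℂ) ≠ 0) (h2.trans h1.symm)
  obtain ⟨j, hj⟩ := Complex.exp_eq_exp_iff_exists_int.1 h3
  refine ⟨j, ?_⟩
  have := congrArg Complex.im hj
  simpa using this

theorem circlePoint_eq_anglePoint {w z : ℂ} (hw : w ≠ 0) (hz : z ≠ 0) :
    circlePoint m z = anglePoint m (argNear w z) := by
  rw [anglePoint, ← circlePoint_smul (norm_pos_iff.2 hz) (Complex.exp _), norm_smul_exp_argNear hw hz]

end Cylindrical

/-! ### Cocycles in the region where the set is standard -/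

section StandardRegion

variable {m : ℕ} {G : Type*} [Group G]

/-- The set `A` is standard where `κ < ε`, for a positively homogeneous function `κ` of the
coordinates other than the first two. -/
structure StdRegion (A : Set (Sph (m + 1))) (κ : (Fin m → ℝ) → ℝ) (ε : ℝ) : Prop where
  continuous : Continuous κ
  map_smul : ∀ c : ℝ, 0 ≤ c → ∀ r, κ (c • r) = c * κ r
  pos : 0 < ε
  mem_iff : ∀ p : Sph (m + 1), κ (rest p.1) < ε → (p ∈ A ↔ planar p.1 = 0)

theorem rest_radial_cyl {z : ℂ} {r : Fin m → ℝ} (h : cyl z r ≠ 0) :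
    rest (radial (cyl z r)).1 = ‖cyl z r‖⁻¹ • r := by
  rw [radial_coe h, rest_smul, rest_cyl]

theorem planar_radial_cyl {z : ℂ} {r : Fin m → ℝ} (h : cyl z r ≠ 0) :
    planar (radial (cyl z r)).1 = ‖cyl z r‖⁻¹ • z := by
  rw [radial_coe h, planar_smul, planar_cyl]

namespace StdRegion

variable {A : Set (Sph (m + 1))} {κ : (Fin m → ℝ) → ℝ} {ε : ℝ}

/-- Homogeneity of `κ` lets the region be described before normalization to the sphere. -/
theorem lt_radial (R : StdRegion A κ ε) {z : ℂ} (hz : z ≠ 0) {r : Fin m → ℝ}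
    (h : κ r < ε * ‖cyl z r‖) : κ (rest (radial (cyl z r)).1) < ε := by
  have h0 := cyl_ne_zero hz r
  have h1 : 0 < ‖cyl z r‖ := norm_pos_iff.2 h0
  rw [rest_radial_cyl h0, R.map_smul _ (inv_nonneg.2 h1.le), inv_mul_lt_iff₀ h1, mul_comm]
  exact h

theorem radial_notMem (R : StdRegion A κ ε) {z : ℂ} (hz : z ≠ 0) {r : Fin m → ℝ}
    (h : κ r < ε * ‖cyl z r‖) : radial (cyl z r) ∉ A := by
  have h0 := cyl_ne_zero hz r
  rw [R.mem_iff _ (R.lt_radial hz h), planar_radial_cyl h0]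
  exact smul_ne_zero (inv_ne_zero (norm_ne_zero_iff.2 h0)) hz

theorem map_zero (R : StdRegion A κ ε) : κ 0 = 0 := by
  simpa using R.map_smul 0 le_rfl 0

theorem lt_smul (R : StdRegion A κ ε) {z : ℂ} (hz : z ≠ 0) {r : Fin m → ℝ}
    (h : κ r < ε * ‖cyl z r‖) {s : ℝ} (h0 : 0 ≤ s) (h1 : s ≤ 1) :
    κ (s • r) < ε * ‖cyl z (s • r)‖ := by
  rw [R.map_smul s h0]
  have hp : 0 < ε * ‖cyl z (s • r)‖ := mul_pos R.pos (norm_pos_iff.2 (cyl_ne_zero hz _))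
  rcases h0.eq_or_lt with rfl | h0
  · simpa using hp
  · calc s * κ r < s * (ε * ‖cyl z r‖) := by gcongr
      _ = ε * (s * ‖cyl z r‖) := by ring
      _ ≤ _ := mul_le_mul_of_nonneg_left (mul_norm_cyl_le z r h0.le h1) R.pos.le

theorem lt_of_nonpos (R : StdRegion A κ ε) {z : ℂ} (hz : z ≠ 0) {r : Fin m → ℝ} (h : κ r ≤ 0) :
    κ r < ε * ‖cyl z r‖ :=
  h.trans_lt (mul_pos R.pos (norm_pos_iff.2 (cyl_ne_zero hz r)))

theorem circlePoint_notMem (R : StdRegion A κ ε) {z : ℂ} (hz : z ≠ 0) : circlePoint m z ∉ A :=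
  R.radial_notMem hz (R.lt_of_nonpos hz R.map_zero.le)

theorem anglePoint_notMem (R : StdRegion A κ ε) (x : ℝ) : anglePoint m x ∉ A :=
  R.circlePoint_notMem (Complex.exp_ne_zero _)

end StdRegion

/-- A homotopy pushing a point to the great circle in the plane. -/
noncomputable def pushToCircle (p : EuclideanSpace ℝ (Fin (m + 2))) (s : ℝ) : Sph (m + 1) :=
  radial (cyl (planar p) ((1 - clamp s) • rest p))

theorem pushToCircle_zero (p : EuclideanSpace ℝ (Fin (m + 2))) : pushToCircle p 0 = radial p := by
  simp [pushToCircle]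

theorem pushToCircle_one (p : EuclideanSpace ℝ (Fin (m + 2))) :
    pushToCircle p 1 = circlePoint m (planar p) := by
  simp [pushToCircle, circlePoint]

theorem continuousAt_pushToCircle {p : EuclideanSpace ℝ (Fin (m + 2))} (hp : planar p ≠ 0) (s : ℝ) :
    ContinuousAt (Function.uncurry pushToCircle) (p, s) :=
  (continuousAt_radial (cyl_ne_zero hp _)).comp
    (f := fun x : EuclideanSpace ℝ (Fin (m + 2)) × ℝ =>
      cyl (planar x.1) ((1 - clamp x.2) • rest x.1))
    (continuous_cyl.comp (by fun_prop : Continuous fun x : EuclideanSpace ℝ (Fin (m + 2)) × ℝ =>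
      (planar x.1, (1 - clamp x.2) • rest x.1))).continuousAt

theorem StdRegion.pushToCircle_notMem {A : Set (Sph (m + 1))} {κ : (Fin m → ℝ) → ℝ} {ε : ℝ}
    (R : StdRegion A κ ε) {p : EuclideanSpace ℝ (Fin (m + 2))} (hp : planar p ≠ 0)
    (hκ : κ (rest p) < ε * ‖p‖) (s : ℝ) : pushToCircle p s ∉ A := by
  have hs := clamp_mem s
  refine R.radial_notMem hp (R.lt_smul hp ?_ (by linarith [hs.2]) (by linarith [hs.1]))
  rwa [cyl_planar_rest]

/-- The function `f` of the angle is a primitive of `φ` along the great circle in the plane, with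
monodromy `h`. -/
structure IsAngularPrimitive (φ : Sph (m + 1) → Sph (m + 1) → G) (f : ℝ → G) (h : G) : Prop where
  primitiveAt : ∀ x, PrimitiveAt (pullCocycle (anglePoint m) φ) f x
  period : ∀ (x : ℝ) (j : ℤ), f (x + j * (2 * Real.pi)) = h ^ j * f x

/-- On the line covering the great circle a primitive exists. Its translate by `2π` is again a
primitive, so the two differ by a constant left factor, the monodromy. -/
theorem exists_angularPrimitive {φ : Sph (m + 1) → Sph (m + 1) → G}
    (hφ : ∀ x, CocycleAt φ (anglePoint m x)) : ∃ f h, IsAngularPrimitive φ f h := by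
  obtain ⟨f, hf, -⟩ := Transportable.exists_primitive (φ := φ) (γ := anglePoint m)
    fun t => ⟨continuous_anglePoint.continuousAt, hφ t⟩
  have hf' : ∀ x, PrimitiveAt (pullCocycle (anglePoint m) φ) (fun x => f (x + 2 * Real.pi)) x := by
    intro x
    have h1 := (hf (x + 2 * Real.pi)).pull (f := fun x => x + 2 * Real.pi)
      (continuous_id.add continuous_const).continuousAt
    have h2 : pullCocycle (fun x => x + 2 * Real.pi) (pullCocycle (anglePoint m) φ) =
        pullCocycle (anglePoint m) φ := by
      funext a b
      have := fun x => anglePoint_add_int (m := m) x 1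
      simp only [Int.cast_one, one_mul] at this
      simp [pullCocycle, this]
    rwa [h2] at h1
  have key : ∀ x, f (x + 2 * Real.pi) = f (2 * Real.pi) * (f 0)⁻¹ * f x := by
    intro x
    have := primitive_unique isPreconnected_univ (fun x _ => hf x) (fun x _ => hf' x)
      (mem_univ 0) (mem_univ x)
    simp only [zero_add] at this
    rw [mul_assoc, this]
    group
  refine ⟨f, f (2 * Real.pi) * (f 0)⁻¹, hf, fun x j => ?_⟩
  induction j using Int.induction_on with
  | zero => simp
  | succ i ih =>
    have := key (x + (i : ℤ) * (2 * Real.pi))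
    rw [ih] at this
    rw [show x + ((i + 1 : ℤ) : ℝ) * (2 * Real.pi) = x + (i : ℤ) * (2 * Real.pi) + 2 * Real.pi by
      push_cast; ring, this, ← mul_assoc, ← zpow_one_add, add_comm]
  | pred i ih =>
    have := key (x + ((-i - 1 : ℤ) : ℝ) * (2 * Real.pi))
    rw [show x + ((-i - 1 : ℤ) : ℝ) * (2 * Real.pi) + 2 * Real.pi
      = x + ((-i : ℤ) : ℝ) * (2 * Real.pi) by push_cast; ring, ih] at this
    rw [sub_eq_add_neg, add_comm (-(i : ℤ)), zpow_add, zpow_neg_one, mul_assoc, this]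
    group

namespace IsAngularPrimitive

variable {φ : Sph (m + 1) → Sph (m + 1) → G} {f : ℝ → G} {h : G}

theorem primitiveAt_comp (F : IsAngularPrimitive φ f h) {Y : Type*} [TopologicalSpace Y]
    {ζ : Y → ℂ} {y : Y} {α : Y → ℝ} (hα : ContinuousAt α y)
    (hαζ : ∀ᶠ a in 𝓝 y, circlePoint m (ζ a) = anglePoint m (α a)) :
    PrimitiveAt (pullCocycle (circlePoint m ∘ ζ) φ) (f ∘ α) y := by
  obtain ⟨N, hN, H⟩ := (F.primitiveAt (α y)).pull hα
  refine ⟨_, inter_mem hN hαζ, fun a ha b hb => ?_⟩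
  rw [← H a ha.1 b hb.1]
  have ha' : circlePoint m (ζ a) = anglePoint m (α a) := ha.2
  have hb' : circlePoint m (ζ b) = anglePoint m (α b) := hb.2
  simp [pullCocycle, ha', hb']

theorem primitiveAt_argNear (F : IsAngularPrimitive φ f h) {Y : Type*} [TopologicalSpace Y]
    {ζ : Y → ℂ} {y : Y} (hζ : ContinuousAt ζ y) (h0 : ζ y ≠ 0) :
    PrimitiveAt (pullCocycle (circlePoint m ∘ ζ) φ) (fun a => f (argNear (ζ y) (ζ a))) y :=
  F.primitiveAt_comp (ContinuousAt.comp (f := ζ) (continuousAt_argNear h0) hζ) (by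
    filter_upwards [hζ.eventually_ne h0] with a ha using circlePoint_eq_anglePoint h0 ha)

/-- The transport along a loop projected to the plane. -/
theorem transport_circlePoint (F : IsAngularPrimitive φ f h) {ζ : ℝ → ℂ} (hζ : Continuous ζ)
    (h0 : ∀ t, ζ t ≠ 0) (a b : ℝ) :
    ∃ j : ℤ, transport φ (circlePoint m ∘ ζ) a b = (f (ζ a).arg)⁻¹ * h ^ j * f (ζ b).arg := by
  obtain ⟨g, hg⟩ := exists_primitive (ψ := pullCocycle (circlePoint m ∘ ζ) φ) fun t =>
    (F.primitiveAt_argNear (hζ.continuousAt (x := t)) (h0 t)).cocycleAt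
  rw [transport_eq hg]
  refine isPreconnected_univ.induction₂
    (fun a b => ∃ j : ℤ, (g a)⁻¹ * g b = (f (ζ a).arg)⁻¹ * h ^ j * f (ζ b).arg)
    (fun x _ => ?_) (fun x y z _ _ _ hxy hyz => ?_) (fun x y _ _ hxy => ?_)
    (mem_univ a) (mem_univ b)
  · obtain ⟨N, hN, H⟩ := F.primitiveAt_argNear (hζ.continuousAt (x := x)) (h0 x)
    obtain ⟨N', hN', H'⟩ := hg x
    rw [nhdsWithin_univ]
    filter_upwards [hN, hN'] with y hy hy'
    rw [← H' x (mem_of_mem_nhds hN') y hy', H x (mem_of_mem_nhds hN) y hy]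
    obtain ⟨i, hi⟩ := arg_eq_argNear_add (h0 x) (h0 x)
    obtain ⟨j, hj⟩ := arg_eq_argNear_add (h0 x) (h0 y)
    refine ⟨i - j, ?_⟩
    rw [hi, hj, F.period, F.period, zpow_sub]
    group
  · obtain ⟨i, hi⟩ := hxy
    obtain ⟨j, hj⟩ := hyz
    refine ⟨i + j, ?_⟩
    rw [show (g x)⁻¹ * g z = ((g x)⁻¹ * g y) * ((g y)⁻¹ * g z) by group, hi, hj, zpow_add]
    group
  · obtain ⟨i, hi⟩ := hxy
    refine ⟨-i, ?_⟩
    rw [show (g y)⁻¹ * g x = ((g x)⁻¹ * g y)⁻¹ by group, hi]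
    group

theorem transport_stdLoop (F : IsAngularPrimitive φ f h) :
    transport φ (stdLoop m) 0 1 = (f 0)⁻¹ * h * f 0 := by
  have h1 : ∀ x, PrimitiveAt (pullCocycle (stdLoop m) φ) (f ∘ fun t => 2 * Real.pi * t) x :=
    fun x => (F.primitiveAt _).pull (f := fun t => 2 * Real.pi * t) (by fun_prop)
  have h2 := F.period 0 1
  rw [transport_eq h1]
  simp only [Function.comp_apply, mul_zero, mul_one]
  simp only [Int.cast_one, one_mul, zero_add, zpow_one] at h2
  rw [h2]
  group

theorem transport_stdLoop_pow (F : IsAngularPrimitive φ f h) (d : ℕ) :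
    transport φ (stdLoop m) 0 1 ^ d = 1 ↔ h ^ d = 1 := by
  have := conj_pow (a := (f 0)⁻¹) (b := h) (i := d)
  rw [inv_inv] at this
  rw [F.transport_stdLoop, this]
  constructor
  · intro e
    have := congrArg (fun x => f 0 * x * (f 0)⁻¹) e
    simpa [mul_assoc] using this
  · intro e; simp [e]

end IsAngularPrimitive

namespace StdRegion

variable {A : Set (Sph (m + 1))} {κ : (Fin m → ℝ) → ℝ} {ε : ℝ}
  {φ : Sph (m + 1) → Sph (m + 1) → G}

/-- The transports along the loops in the standard region are conjugate to powers of the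
monodromy. -/
theorem exists_transport_eq (R : StdRegion A κ ε) (hφ : ∀ p ∉ A, CocycleAt φ p) {f : ℝ → G} {h : G}
    (F : IsAngularPrimitive φ f h) (p : Sph (m + 1)) :
    ∃ c : G, ∀ γ : ℝ → Sph (m + 1), Continuous γ → γ 0 = p → γ 1 = p →
      (∀ t, γ t ∉ A ∧ κ (rest (γ t).1) < ε) → ∃ j : ℤ, transport φ γ 0 1 = c⁻¹ * h ^ j * c := by
  refine ⟨f (planar p.1).arg * (transport φ (pushToCircle p.1) 0 1)⁻¹, fun γ hγ h0 h1 hγA => ?_⟩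
  have hz : ∀ t, planar (γ t).1 ≠ 0 := fun t h => (hγA t).1 ((R.mem_iff _ (hγA t).2).2 h)
  have hW : ∀ t s, ContinuousAt (Function.uncurry fun t s => pushToCircle (γ t).1 s) (t, s) ∧
      CocycleAt φ (pushToCircle (γ t).1 s) := fun t s =>
    ⟨ContinuousAt.comp (x := (t, s)) (f := fun x : ℝ × ℝ => ((γ x.1).1, x.2))
      (continuousAt_pushToCircle (hz t) s) (((continuous_subtype_val.comp hγ).comp
        continuous_fst).prodMk continuous_snd).continuousAt,
      hφ _ (R.pushToCircle_notMem (hz t) (by rw [sph_norm, mul_one]; exact (hγA t).2) s)⟩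
  have key := transport_homotopy hW 0 1 1
  simp only [pushToCircle_zero, pushToCircle_one, radial_self, h0, h1] at key
  obtain ⟨j, hj⟩ := F.transport_circlePoint
    (continuous_planar.comp (continuous_subtype_val.comp hγ)) hz 0 1
  refine ⟨j, ?_⟩
  simp only [Function.comp_def, h0, h1] at hj
  rw [hj] at key
  rw [mul_inv_rev, inv_inv]
  have := congrArg (fun x => transport φ (pushToCircle p.1) 0 1 * x *
    (transport φ (pushToCircle p.1) 0 1)⁻¹) key
  simp only [mul_assoc, mul_inv_cancel_left, mul_inv_cancel, mul_one] at this
  simp only [mul_assoc]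
  exact this.symm

/-- Shrinking the great circle towards `v` inside the standard region produces a small loop around
`A`. Conversely, a small loop near `v` is pushed to the great circle, where its transport is
conjugate to a power of the monodromy. -/
theorem loopsKilledAt_iff (R : StdRegion A κ ε) (hφ : ∀ p ∉ A, CocycleAt φ p) {v : Sph (m + 1)}
    (hv : planar v.1 = 0) (hκ : κ (rest v.1) ≤ 0) (d : ℕ) :
    LoopsKilledAt φ A d v ↔ transport φ (stdLoop m) 0 1 ^ d = 1 := by
  obtain ⟨f, h, F⟩ := exists_angularPrimitive fun x => hφ _ (R.anglePoint_notMem x)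
  constructor
  · rintro ⟨U, hU, H⟩
    have hv0 : v.1 ≠ 0 := norm_ne_zero_iff.1 (by rw [sph_norm]; exact one_ne_zero)
    have hU' : radial ⁻¹' U ∈ 𝓝 v.1 := continuousAt_radial hv0 (by rwa [radial_self])
    obtain ⟨ρ, hρ, hρU⟩ := Metric.mem_nhds_iff.1 hU'
    set δ : ℝ := min 1 (ρ / 3)
    have hδ : 0 < δ := lt_min one_pos (by positivity)
    -- Positivity keeps the homotopy off `A`; the bound by `1` makes the coefficient of `rest v`
    -- nonnegative, so that `κ` stays nonpositive.
    set l : ℝ → ℝ := fun s => max δ (min 1 (1 - s)) with hl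
    have hl0 : ∀ s, 0 < l s := fun s => hδ.trans_le (le_max_left _ _)
    have hl1 : ∀ s, l s ≤ 1 := fun s => max_le (min_le_left _ _) (min_le_left _ _)
    set e : ℝ → ℂ := fun t => Complex.exp ((2 * Real.pi * t : ℝ) * Complex.I) with he
    have hen : ∀ t, ‖e t‖ = 1 := fun t => Complex.norm_exp_ofReal_mul_I _
    set k : ℝ → ℝ → EuclideanSpace ℝ (Fin (m + 2)) := fun t s =>
      cyl (l s • e t) ((1 - l s) • rest v.1) with hk
    have hne : ∀ t s, l s • e t ≠ 0 := fun t s => smul_ne_zero (hl0 s).ne' (Complex.exp_ne_zero _)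
    have hkc : Continuous (Function.uncurry k) := by
      simp only [hk, hl, he, Function.uncurry_def]
      exact continuous_cyl.comp (f := fun x : ℝ × ℝ => (max δ (min 1 (1 - x.2)) •
        Complex.exp ((2 * Real.pi * x.1 : ℝ) * Complex.I),
        (1 - max δ (min 1 (1 - x.2))) • rest v.1)) (by fun_prop)
    have hkA : ∀ t s, radial (k t s) ∉ A := fun t s => by
      refine R.radial_notMem (hne t s) (R.lt_of_nonpos (hne t s) ?_)
      rw [R.map_smul _ (by linarith [hl1 s])]
      exact mul_nonpos_of_nonneg_of_nonpos (by linarith [hl1 s]) hκ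
    have hkr : ∀ t s, ContinuousAt (fun x : ℝ × ℝ => radial (k x.1 x.2)) (t, s) := fun t s =>
      ContinuousAt.comp (g := radial) (f := fun x : ℝ × ℝ => k x.1 x.2) (x := (t, s))
        (continuousAt_radial (cyl_ne_zero (hne t s) _)) hkc.continuousAt
    have he01 : e 0 = e 1 := by
      simp only [he]
      rw [Complex.exp_eq_exp_iff_exists_int]
      exact ⟨-1, by push_cast; ring⟩
    have key := transport_pow_eq_one_of_homotopy (φ := φ) (W := fun t s => radial (k t s))
      (fun t s => ⟨hkr t s, hφ _ (hkA t s)⟩) (by simp only [hk, he01]) d 1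
    have e0 : (fun t => radial (k t 0)) = stdLoop m := by
      funext t
      have : l 0 = 1 := by simp [hl, δ]
      simp [hk, this, stdLoop, anglePoint, circlePoint, he]
    rw [e0] at key
    refine key.1 (H _ ?_ (by simp only [hk, he01]) fun t => ⟨hρU ?_, hkA t 1⟩)
    · exact continuous_iff_continuousAt.2 fun t =>
        ContinuousAt.comp (g := fun x : ℝ × ℝ => radial (k x.1 x.2))
          (f := fun t : ℝ => (t, (1 : ℝ))) (x := t) (hkr t 1) (by fun_prop)
    · have l1 : l 1 = δ := by simp [hl, hδ.le]
      have hd : k t 1 - v.1 = δ • (cyl (e t) 0 - v.1) := by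
        refine ext_planar_rest ?_ ?_
        · have : ∀ x y : EuclideanSpace ℝ (Fin (m + 2)), planar (x - y) = planar x - planar y :=
            fun x y => by apply Complex.ext <;> simp [planar]
          simp [planar_smul, this, hk, l1, hv]
        · have : ∀ x y : EuclideanSpace ℝ (Fin (m + 2)), rest (x - y) = rest x - rest y :=
            fun x y => by ext; simp [rest]
          simp only [rest_smul, this, hk, l1, rest_cyl]
          module
      have hn : ‖(cyl (e t) 0 : EuclideanSpace ℝ (Fin (m + 2)))‖ = 1 := by
        have := norm_cyl_sq (e t) (0 : Fin m → ℝ)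
        rw [hen] at this
        nlinarith [norm_nonneg (cyl (e t) (0 : Fin m → ℝ)), show ‖cyl (e t) (0 : Fin m → ℝ)‖ ^ 2 = 1 by
          simpa using this]
      rw [Metric.mem_ball, dist_eq_norm, hd, norm_smul, Real.norm_of_nonneg hδ.le]
      calc δ * ‖cyl (e t) 0 - v.1‖ ≤ ρ / 3 * (1 + 1) := by
            gcongr
            · exact min_le_right _ _
            · exact (norm_sub_le _ _).trans (by rw [hn, sph_norm])
        _ < ρ := by linarith
  · intro hd
    rw [F.transport_stdLoop_pow] at hd
    refine ⟨{p | κ (rest p.1) < ε}, ?_, fun γ hγ h01 hγU => ?_⟩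
    · exact (isOpen_lt (R.continuous.comp (continuous_rest.comp continuous_subtype_val))
        continuous_const).mem_nhds (hκ.trans_lt R.pos)
    · obtain ⟨c, hc⟩ := R.exists_transport_eq hφ F (γ 0)
      obtain ⟨j, hj⟩ := hc γ hγ rfl h01.symm fun t => ⟨(hγU t).2, (hγU t).1⟩
      have := conj_pow (a := c⁻¹) (b := h ^ j) (i := d)
      rw [inv_inv] at this
      rw [hj, this, ← zpow_natCast, ← zpow_mul, mul_comm, zpow_mul, zpow_natCast, hd]
      simp

end StdRegion

end StandardRegion

/-! ### Geometry of twist spinning -/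

section TwistSpin

variable {n : ℕ} {G : Type*} [Group G]

/-- The last two coordinates, as a complex number. -/
noncomputable def axial (r : Fin (n + 2) → ℝ) : ℂ := ⟨r (Fin.last n).castSucc, r (Fin.last (n + 1))⟩

theorem continuous_axial : Continuous (axial (n := n)) := by
  have : axial (n := n) = fun r => Complex.equivRealProdCLM.symm
    (r (Fin.last n).castSucc, r (Fin.last (n + 1))) := rfl
  rw [this]
  fun_prop

theorem axial_smul (c : ℝ) (r : Fin (n + 2) → ℝ) : axial (c • r) = c • axial r := by
  apply Complex.ext <;> simp [axial]

/-- The coordinates obtained by replacing the last two coordinates by their norm. -/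
noncomputable def meridional (r : Fin (n + 2) → ℝ) : Fin (n + 1) → ℝ :=
  Fin.snoc (fun i : Fin n => r i.castSucc.castSucc) ‖axial r‖

theorem continuous_meridional : Continuous (meridional (n := n)) := by
  refine continuous_pi fun i => ?_
  refine Fin.lastCases ?_ (fun i => ?_) i
  · simpa [meridional] using continuous_axial.norm
  · simp only [meridional, Fin.snoc_castSucc]
    fun_prop

theorem sum_sq_meridional (r : Fin (n + 2) → ℝ) :
    ∑ i, meridional r i ^ 2 = ∑ i, r i ^ 2 := by
  rw [Fin.sum_univ_castSucc, Fin.sum_univ_castSucc (n := n + 1), Fin.sum_univ_castSucc]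
  simp only [meridional, Fin.snoc_castSucc, Fin.snoc_last, Complex.sq_norm, Complex.normSq_apply,
    axial]
  ring

/-- The coordinates of a point of the half space, in the spun space at angle zero. -/
noncomputable def halfCoords (r : Fin (n + 1) → ℝ) : Fin (n + 2) → ℝ :=
  Fin.snoc (Fin.snoc (fun i : Fin n => r i.castSucc) (max (r (Fin.last n)) 0) : Fin (n + 1) → ℝ) 0

theorem continuous_halfCoords : Continuous (halfCoords (n := n)) := by
  refine continuous_pi fun i => ?_
  refine Fin.lastCases ?_ (fun i => ?_) i
  · simpa [halfCoords] using continuous_const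
  · refine Fin.lastCases ?_ (fun i => ?_) i
    · simp only [halfCoords, Fin.snoc_castSucc, Fin.snoc_last]
      fun_prop
    · simp only [halfCoords, Fin.snoc_castSucc]
      fun_prop

theorem axial_halfCoords (r : Fin (n + 1) → ℝ) :
    axial (halfCoords r) = ((max (r (Fin.last n)) 0 : ℝ) : ℂ) := by
  apply Complex.ext <;> simp [axial, halfCoords]

theorem meridional_halfCoords {r : Fin (n + 1) → ℝ} (h : 0 ≤ r (Fin.last n)) :
    meridional (halfCoords r) = r := by
  funext i
  refine Fin.lastCases ?_ (fun i => ?_) i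
  · simp [meridional, axial_halfCoords, h]
  · simp [meridional, halfCoords]

theorem isSpunPoint_iff {k : ℕ} {θ : ℝ} {q : Sph (n + 2)} {p : Sph (n + 3)} :
    IsSpunPoint k θ q p ↔
      planar (m := n + 2) p.1 = Complex.exp (-(k * θ : ℝ) * Complex.I) * planar (m := n + 1) q.1 ∧
      (∀ i : Fin n, rest (m := n + 2) p.1 i.castSucc.castSucc =
        rest (m := n + 1) q.1 i.castSucc) ∧
      axial (rest (m := n + 2) p.1) =
        (rest (m := n + 1) q.1 (Fin.last n) : ℂ) * Complex.exp (θ * Complex.I) := by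
  have e1 : Complex.exp (-(k * θ : ℝ) * Complex.I) =
      ⟨Real.cos (k * θ), -Real.sin (k * θ)⟩ := by
    rw [← Complex.ofReal_neg]
    apply Complex.ext
    · rw [Complex.exp_ofReal_mul_I_re, Real.cos_neg]
    · rw [Complex.exp_ofReal_mul_I_im, Real.sin_neg]
  have e2 : Complex.exp (θ * Complex.I) = ⟨Real.cos θ, Real.sin θ⟩ := by
    apply Complex.ext
    · rw [Complex.exp_ofReal_mul_I_re]
    · rw [Complex.exp_ofReal_mul_I_im]
  rw [e1, e2, Complex.ext_iff, Complex.ext_iff, IsSpunPoint]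
  simp only [Complex.mul_re, Complex.mul_im, Complex.ofReal_re, Complex.ofReal_im, zero_mul,
    sub_zero, add_zero, planar, axial, rest]
  constructor
  · rintro ⟨h1, h2, h3, h4, h5⟩
    refine ⟨⟨by rw [h1]; ring, by rw [h2]; ring⟩, h3, h4, h5⟩
  · rintro ⟨⟨h1, h2⟩, h3, h4, h5⟩
    refine ⟨by rw [h1]; ring, by rw [h2]; ring, h3, h4, h5⟩

/-- The point of the half space from which a point off the axis has been spun. -/
noncomputable def unspin (k : ℕ) (p : EuclideanSpace ℝ (Fin (n + 2 + 2))) :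
    EuclideanSpace ℝ (Fin (n + 1 + 2)) :=
  cyl (planar p * (axial (rest p) / ‖axial (rest p)‖) ^ k) (meridional (rest p))

theorem continuousAt_unspin (k : ℕ) {p : EuclideanSpace ℝ (Fin (n + 2 + 2))}
    (hp : axial (rest p) ≠ 0) : ContinuousAt (unspin k) p := by
  have h1 : Continuous fun p : EuclideanSpace ℝ (Fin (n + 2 + 2)) => axial (rest p) :=
    continuous_axial.comp continuous_rest
  have h2 : ContinuousAt (fun p : EuclideanSpace ℝ (Fin (n + 2 + 2)) =>
      planar p * (axial (rest p) / ‖axial (rest p)‖) ^ k) p := by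
    refine continuous_planar.continuousAt.mul ((h1.continuousAt.div ?_ (by simpa using hp)).pow k)
    exact (Complex.continuous_ofReal.comp h1.norm).continuousAt
  exact ContinuousAt.comp (g := fun x : ℂ × (Fin (n + 1) → ℝ) => cyl x.1 x.2)
    continuous_cyl.continuousAt
    (h2.prodMk (continuous_meridional.comp continuous_rest).continuousAt)

theorem norm_unspin (k : ℕ) (p : Sph (n + 3))
    (hp : axial (rest (m := n + 2) p.1) ≠ 0) : ‖unspin k p.1‖ = 1 := by
  have h1 := sph_norm (m := n + 2) p
  have h2 := norm_cyl_sq (planar (m := n + 2) p.1) (rest p.1)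
  have h3 := norm_cyl_sq (planar (m := n + 2) p.1 *
    (axial (rest p.1) / ‖axial (rest (m := n + 2) p.1)‖) ^ k) (meridional (rest p.1))
  rw [cyl_planar_rest, h1] at h2
  rw [sum_sq_meridional, norm_mul, norm_pow, norm_div, Complex.norm_real, norm_norm,
    div_self (norm_ne_zero_iff.2 hp), one_pow, mul_one, ← h2] at h3
  rw [unspin]
  nlinarith [norm_nonneg (cyl (planar (m := n + 2) p.1 *
    (axial (rest p.1) / ‖axial (rest (m := n + 2) p.1)‖) ^ k) (meridional (rest p.1)))]

theorem radial_of_norm_eq_one {m : ℕ} {v : EuclideanSpace ℝ (Fin (m + 2))} (h : ‖v‖ = 1) :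
    (radial v).1 = v :=
  congrArg Subtype.val (radial_self ⟨v, mem_sphere_zero_iff_norm.2 h⟩)

theorem rest_last (q : Sph (n + 2)) :
    rest (m := n + 1) q.1 (Fin.last n) = q.1 (Fin.last (n + 2)) := rfl

/-- Off the axis the spinning angle is the argument of the axial part, and multiplying the planar
part by the `k`-th power of the axial direction undoes the rotation. -/
theorem mem_twistSpinSet_iff {k : ℕ} {A : Set (Sph (n + 2))} {p : Sph (n + 3)}
    (hp : axial (rest (m := n + 2) p.1) ≠ 0) :
    p ∈ twistSpinSet k A ↔ radial (unspin k p.1) ∈ A := by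
  have hn : (‖axial (rest (m := n + 2) p.1)‖ : ℂ) ≠ 0 := by simpa using hp
  constructor
  · rintro ⟨q, hq, hq0, θ, h⟩
    obtain ⟨h1, h2, h3⟩ := isSpunPoint_iff.1 h
    rw [← rest_last] at hq0
    suffices unspin k p.1 = q.1 by rwa [this, radial_self]
    have h4 : ‖axial (rest (m := n + 2) p.1)‖ = rest (m := n + 1) q.1 (Fin.last n) := by
      rw [h3, norm_mul, Complex.norm_exp_ofReal_mul_I, Complex.norm_real, mul_one,
        Real.norm_of_nonneg hq0]
    have h5 : axial (rest (m := n + 2) p.1) / ‖axial (rest (m := n + 2) p.1)‖ =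
        Complex.exp (θ * Complex.I) := by
      rw [div_eq_iff hn, h4, h3]
      ring
    refine ext_planar_rest ?_ ?_
    · rw [unspin, planar_cyl, h5, h1, ← Complex.exp_nat_mul, mul_right_comm, ← Complex.exp_add]
      rw [show -((k * θ : ℝ) : ℂ) * Complex.I + k * (θ * Complex.I) = 0 by push_cast; ring]
      simp
    · rw [unspin, rest_cyl]
      funext i
      refine Fin.lastCases ?_ (fun i => ?_) i
      · simp [meridional, h4]
      · simp [meridional, h2]
  · intro h
    have hv := radial_of_norm_eq_one (norm_unspin k p hp)
    refine ⟨_, h, ?_, (axial (rest (m := n + 2) p.1)).arg, isSpunPoint_iff.2 ⟨?_, fun i => ?_, ?_⟩⟩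
    · rw [← rest_last, hv, unspin, rest_cyl]
      simp [meridional]
    · rw [hv, unspin, planar_cyl]
      have h1 := Complex.norm_mul_exp_arg_mul_I (axial (rest (m := n + 2) p.1))
      rw [mul_comm, ← eq_div_iff hn] at h1
      rw [← h1, ← Complex.exp_nat_mul, mul_left_comm, ← Complex.exp_add]
      rw [show ∀ x : ℝ, -((k * x : ℝ) : ℂ) * Complex.I + k * (x * Complex.I) = 0 by
        intro x; push_cast; ring]
      simp
    · rw [hv, unspin, rest_cyl]
      simp [meridional]
    · rw [hv, unspin, rest_cyl]
      simp only [meridional, Fin.snoc_last]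
      exact (Complex.norm_mul_exp_arg_mul_I _).symm

theorem InNormalPosition.exists_stdRegion {A : Set (Sph (n + 2))} (hA : InNormalPosition A) :
    ∃ ε, StdRegion (m := n + 1) A (fun r => r (Fin.last n)) ε := by
  obtain ⟨ε, hε, h⟩ := hA
  refine ⟨ε, by fun_prop, fun c _ r => rfl, hε, fun p hp => (h p hp).trans ?_⟩
  simp [standardSphere, planar, Complex.ext_iff]

/-- The last coordinate of the point being spun is the norm of the axial part, and the standard
sphere is fixed by the planar rotations, so the twisting is invisible near the axis. -/
theorem StdRegion.twistSpinSet {A : Set (Sph (n + 2))} {ε : ℝ}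
    (R : StdRegion (m := n + 1) A (fun r => r (Fin.last n)) ε) (k : ℕ) :
    StdRegion (m := n + 2) (twistSpinSet k A) (fun r => ‖axial r‖) ε := by
  refine ⟨continuous_axial.norm, fun c hc r => ?_, R.pos, fun p hp => ⟨?_, fun h => ?_⟩⟩
  · rw [axial_smul, norm_smul, Real.norm_of_nonneg hc]
  · rintro ⟨q, hq, hq0, θ, h⟩
    obtain ⟨h1, h2, h3⟩ := isSpunPoint_iff.1 h
    rw [← rest_last] at hq0
    rw [h3, norm_mul, Complex.norm_exp_ofReal_mul_I, Complex.norm_real, mul_one,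
        Real.norm_of_nonneg hq0] at hp
    rw [h1, (R.mem_iff q hp).1 hq, mul_zero]
  · have hn : ‖(cyl 0 (meridional (rest (m := n + 2) p.1)) : EuclideanSpace ℝ _)‖ = 1 := by
      have h1 := sph_norm (m := n + 2) p
      have h2 := norm_cyl_sq (planar (m := n + 2) p.1) (rest p.1)
      have h3 := norm_cyl_sq 0 (meridional (rest (m := n + 2) p.1))
      rw [cyl_planar_rest, h1, h] at h2
      rw [sum_sq_meridional, ← h2] at h3
      nlinarith [norm_nonneg (cyl 0 (meridional (rest (m := n + 2) p.1)))]
    have hv := radial_of_norm_eq_one hn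
    refine ⟨radial (cyl 0 (meridional (rest (m := n + 2) p.1))), ?_, ?_,
      (axial (rest (m := n + 2) p.1)).arg, isSpunPoint_iff.2 ⟨?_, fun i => ?_, ?_⟩⟩
    · rw [R.mem_iff _ (by
      rw [hv, rest_cyl, meridional, Fin.snoc_last]
      exact hp), hv, planar_cyl]
    · rw [← rest_last, hv, rest_cyl]
      simp [meridional]
    · rw [hv, h, planar_cyl, mul_zero]
    · rw [hv, rest_cyl]
      simp [meridional]
    · rw [hv, rest_cyl]
      simp only [meridional, Fin.snoc_last]
      exact (Complex.norm_mul_exp_arg_mul_I _).symm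

/-- The map from the sphere to the spun sphere which is the inclusion of the fibre at angle zero on
the upper hemisphere, and retracts the lower hemisphere to the axis. -/
noncomputable def fibreMap (q : Sph (n + 2)) : Sph (n + 3) :=
  radial (m := n + 2) (cyl (planar (m := n + 1) q.1) (halfCoords (rest q.1)))

theorem fibreMap_coe {q : Sph (n + 2)} (hq : 0 ≤ rest (m := n + 1) q.1 (Fin.last n)) :
    (fibreMap q).1 = cyl (planar (m := n + 1) q.1) (halfCoords (rest q.1)) := by
  refine radial_of_norm_eq_one ?_
  have h1 := sph_norm (m := n + 1) q
  have h2 := norm_cyl_sq (planar (m := n + 1) q.1) (rest q.1)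
  have h3 := norm_cyl_sq (planar (m := n + 1) q.1) (halfCoords (rest q.1))
  rw [← sum_sq_meridional, meridional_halfCoords hq, ← h2, cyl_planar_rest, h1] at h3
  nlinarith [norm_nonneg (cyl (planar (m := n + 1) q.1) (halfCoords (rest q.1)))]

theorem unspin_fibreMap (k : ℕ) {q : Sph (n + 2)}
    (hq : 0 < rest (m := n + 1) q.1 (Fin.last n)) : unspin k (fibreMap q).1 = q.1 := by
  rw [fibreMap_coe hq.le, unspin, rest_cyl, meridional_halfCoords hq.le, axial_halfCoords,
    max_eq_left hq.le, planar_cyl, Complex.norm_real, Real.norm_of_nonneg hq.le,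
    div_self (by exact_mod_cast hq.ne'), one_pow, mul_one, cyl_planar_rest]

/-- On the open upper hemisphere the axial part survives; on the rest a point off `A` has nonzero
planar part. The retraction to the axis can thus fail only on `A`. -/
theorem fibreMap_ne_zero {A : Set (Sph (n + 2))} {ε : ℝ}
    (R : StdRegion (m := n + 1) A (fun r => r (Fin.last n)) ε) {q : Sph (n + 2)} (hq : q ∉ A) :
    cyl (planar (m := n + 1) q.1) (halfCoords (rest q.1)) ≠ 0 := by
  rcases lt_or_ge 0 (rest (m := n + 1) q.1 (Fin.last n)) with h | h
  · intro h0
    have := congrArg (fun v => axial (rest v)) h0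
    simp only [rest_cyl, axial_halfCoords, max_eq_left h.le] at this
    have h1 := congrArg Complex.re this
    simp [axial, rest] at h1
    exact h.ne' h1
  · exact cyl_ne_zero (fun h0 => hq ((R.mem_iff q (h.trans_lt R.pos)).2 h0)) _

theorem continuousAt_fibreMap {A : Set (Sph (n + 2))} {ε : ℝ}
    (R : StdRegion (m := n + 1) A (fun r => r (Fin.last n)) ε) {q : Sph (n + 2)} (hq : q ∉ A) :
    ContinuousAt fibreMap q := by
  refine ContinuousAt.comp (g := radial (m := n + 2)) (f := fun q : Sph (n + 2) =>
    cyl (planar (m := n + 1) q.1) (halfCoords (rest q.1)))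
    (continuousAt_radial (fibreMap_ne_zero R hq)) (Continuous.continuousAt ?_)
  exact continuous_cyl.comp ((continuous_planar.comp continuous_subtype_val).prodMk
    (continuous_halfCoords.comp (continuous_rest.comp continuous_subtype_val)))

theorem axial_fibreMap_of_nonpos {A : Set (Sph (n + 2))} {ε : ℝ}
    (R : StdRegion (m := n + 1) A (fun r => r (Fin.last n)) ε) {q : Sph (n + 2)} (hq : q ∉ A)
    (h : rest (m := n + 1) q.1 (Fin.last n) ≤ 0) : axial (rest (fibreMap q).1) = 0 := by
  rw [fibreMap, rest_radial_cyl (fibreMap_ne_zero R hq), axial_smul, axial_halfCoords,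
    max_eq_right h]
  simp

theorem fibreMap_notMem {A : Set (Sph (n + 2))} {ε : ℝ}
    (R : StdRegion (m := n + 1) A (fun r => r (Fin.last n)) ε) (k : ℕ) {q : Sph (n + 2)}
    (hq : q ∉ A) : fibreMap q ∉ twistSpinSet k A := by
  rcases lt_or_ge 0 (rest (m := n + 1) q.1 (Fin.last n)) with h | h
  · rw [mem_twistSpinSet_iff, unspin_fibreMap k h, radial_self]
    · exact hq
    · rw [fibreMap_coe h.le, rest_cyl, axial_halfCoords, max_eq_left h.le]
      exact_mod_cast h.ne'
  · have h0 := axial_fibreMap_of_nonpos R hq h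
    rw [(R.twistSpinSet k).mem_iff _ (by rw [h0, norm_zero]; exact R.pos), fibreMap,
      planar_radial_cyl (fibreMap_ne_zero R hq)]
    exact smul_ne_zero (inv_ne_zero (norm_ne_zero_iff.2 (fibreMap_ne_zero R hq)))
      fun h1 => hq ((R.mem_iff q (h.trans_lt R.pos)).2 h1)

/-- The great circle lies on the common boundary of the hemispheres, hence on the axis of the
spinning. Conditions on meridians therefore pass between a knot and its twist spin. -/
theorem fibreMap_circlePoint {z : ℂ} (hz : z ≠ 0) :
    fibreMap (circlePoint (n + 1) z) = circlePoint (n + 2) z := by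
  have h0 := cyl_ne_zero hz (0 : Fin (n + 1) → ℝ)
  have h1 : halfCoords (0 : Fin (n + 1) → ℝ) = 0 := by
    funext i
    refine Fin.lastCases ?_ (fun i => ?_) i
    · simp [halfCoords]
    · refine Fin.lastCases ?_ (fun i => ?_) i <;> simp [halfCoords]
  rw [fibreMap, circlePoint, planar_radial_cyl h0, rest_radial_cyl h0, smul_zero, h1]
  exact circlePoint_smul (inv_pos.2 (norm_pos_iff.2 h0)) z

end TwistSpin

/-! ### Extension of a cocycle over the twist spun complement -/

section SpunCocycle

variable {n : ℕ} {G : Type*} [Group G]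

theorem CohomologousAt.congr_left {X : Type*} [TopologicalSpace X] {φ φ' ψ : X → X → G} {ξ : X → G}
    {p : X} (h : CohomologousAt φ ψ ξ p) {N : Set X} (hN : N ∈ 𝓝 p)
    (h' : ∀ a ∈ N, ∀ b ∈ N, φ' a b = φ a b) : CohomologousAt φ' ψ ξ p := by
  obtain ⟨M, hM, H⟩ := h
  exact ⟨M ∩ N, inter_mem hM hN, fun a ha b hb => by rw [h' a ha.2 b hb.2, H a ha.1 b hb.1]⟩

theorem CohomologousAt.congr_right {X : Type*} [TopologicalSpace X] {φ ψ ψ' : X → X → G}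
    {ξ : X → G} {p : X} (h : CohomologousAt φ ψ ξ p) {N : Set X} (hN : N ∈ 𝓝 p)
    (h' : ∀ a ∈ N, ∀ b ∈ N, ψ' a b = ψ a b) : CohomologousAt φ ψ' ξ p := by
  obtain ⟨M, hM, H⟩ := h
  exact ⟨M ∩ N, inter_mem hM hN, fun a ha b hb => by rw [h' a ha.2 b hb.2, H a ha.1 b hb.1]⟩

/-- The comparison function, near the axis, between the cocycle pulled back from the half space
and the cocycle pulled back from the plane. -/
noncomputable def axisTwist (φ : Sph (n + 2) → Sph (n + 2) → G) (f : ℝ → G) (k : ℕ)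
    (p : Sph (n + 3)) : G :=
  transport φ (pushToCircle (m := n + 1) (unspin k p.1)) 0 1 *
    ((f ((planar (m := n + 2) p.1).arg + k * (axial (rest p.1)).arg))⁻¹ *
      f (planar (m := n + 2) p.1).arg)

/-- The extension of a cocycle to the complement of the twist spun set. -/
noncomputable def spunCocycle (φ : Sph (n + 2) → Sph (n + 2) → G) (f : ℝ → G) (k : ℕ) (δ : ℝ)
    (a b : Sph (n + 3)) : G :=
  if ‖axial (rest (m := n + 2) a.1)‖ < δ ∧ ‖axial (rest (m := n + 2) b.1)‖ < δ then
    φ (circlePoint (n + 1) (planar (m := n + 2) a.1)) (circlePoint (n + 1) (planar (m := n + 2) b.1))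
  else (axisTwist φ f k a)⁻¹ * φ (radial (unspin k a.1)) (radial (unspin k b.1)) * axisTwist φ f k b

variable {A : Set (Sph (n + 2))} {ε : ℝ} {φ : Sph (n + 2) → Sph (n + 2) → G} {f : ℝ → G} {h : G}
  {k : ℕ}

theorem continuous_axial_rest :
    Continuous fun p : Sph (n + 3) => axial (rest (m := n + 2) p.1) :=
  continuous_axial.comp (continuous_rest.comp continuous_subtype_val)

theorem continuous_planar_coe {m : ℕ} : Continuous fun p : Sph (m + 1) => planar p.1 :=
  continuous_planar.comp continuous_subtype_val

theorem continuousAt_unspin_coe (k : ℕ) {p : Sph (n + 3)}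
    (hp : axial (rest (m := n + 2) p.1) ≠ 0) :
    ContinuousAt (fun p : Sph (n + 3) => unspin k p.1) p :=
  ContinuousAt.comp (g := unspin k) (f := fun p : Sph (n + 3) => p.1) (continuousAt_unspin k hp)
    continuous_subtype_val.continuousAt

theorem planar_unspin_ne_zero {p : Sph (n + 3)} (hp : axial (rest (m := n + 2) p.1) ≠ 0)
    (hp' : planar (m := n + 2) p.1 ≠ 0) : planar (unspin k p.1) ≠ 0 := by
  rw [unspin, planar_cyl]
  exact mul_ne_zero hp' (pow_ne_zero _ (div_ne_zero hp (by simpa using hp)))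

theorem circlePoint_planar_unspin {p₀ p : Sph (n + 3)}
    (hp : axial (rest (m := n + 2) p.1) ≠ 0) (hp' : planar (m := n + 2) p.1 ≠ 0)
    (hp₀ : axial (rest (m := n + 2) p₀.1) ≠ 0) (hp₀' : planar (m := n + 2) p₀.1 ≠ 0) :
    circlePoint (n + 1) (planar (unspin k p.1)) =
      anglePoint (n + 1) (argNear (planar (m := n + 2) p₀.1) (planar (m := n + 2) p.1) +
        k * argNear (axial (rest (m := n + 2) p₀.1)) (axial (rest (m := n + 2) p.1))) := by
  have h1 := norm_smul_exp_argNear hp₀' hp'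
  have h2 := norm_smul_exp_argNear hp₀ hp
  rw [unspin, planar_cyl, anglePoint]
  set α := argNear (planar (m := n + 2) p₀.1) (planar (m := n + 2) p.1)
  set ζ := argNear (axial (rest (m := n + 2) p₀.1)) (axial (rest (m := n + 2) p.1))
  have h3 : axial (rest (m := n + 2) p.1) / ‖axial (rest (m := n + 2) p.1)‖ =
      Complex.exp (ζ * Complex.I) := by
    rw [div_eq_iff (by simpa using hp), mul_comm]
    exact h2.symm
  rw [h3]
  conv_lhs => rw [← h1]
  rw [smul_mul_assoc, circlePoint_smul (norm_pos_iff.2 hp'), ← Complex.exp_nat_mul,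
    ← Complex.exp_add]
  congr 2
  push_cast
  ring

/-- Pushing to the plane replaces the unspun point by its planar direction, whose angle is that of
`p` plus `k` times the axial angle. Comparing the angular primitive at these two angles gives the
second factor of `axisTwist`. -/
theorem cohomologousAt_axisTwist (R : StdRegion (m := n + 1) A (fun r => r (Fin.last n)) ε)
    (hφ : ∀ p ∉ A, CocycleAt φ p) (F : IsAngularPrimitive (m := n + 1) φ f h) (hk : h ^ k = 1)
    {p : Sph (n + 3)} (hp : axial (rest (m := n + 2) p.1) ≠ 0)
    (hp' : planar (m := n + 2) p.1 ≠ 0) (hε : ‖axial (rest (m := n + 2) p.1)‖ < ε) :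
    CohomologousAt
      (pullCocycle (fun p : Sph (n + 3) => circlePoint (n + 1) (planar (m := n + 2) p.1)) φ)
      (pullCocycle (fun p : Sph (n + 3) => radial (m := n + 1) (unspin k p.1)) φ)
      (axisTwist φ f k) p := by
  have hU : IsOpen {p : Sph (n + 3) | axial (rest (m := n + 2) p.1) ≠ 0 ∧
      planar (m := n + 2) p.1 ≠ 0 ∧ ‖axial (rest (m := n + 2) p.1)‖ < ε} :=
    (isOpen_ne_fun continuous_axial_rest continuous_const).inter
      ((isOpen_ne_fun continuous_planar_coe continuous_const).inter
        (isOpen_lt continuous_axial_rest.norm continuous_const))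
  have h1 := homotopy_cohomologous (φ := φ)
    (W := fun p : Sph (n + 3) => pushToCircle (m := n + 1) (unspin k p.1)) hU
    (fun z hz s => ⟨ContinuousAt.comp (x := (z, s)) (g := Function.uncurry pushToCircle)
      (f := fun x : Sph (n + 3) × ℝ => (unspin k x.1.1, x.2))
      (continuousAt_pushToCircle (planar_unspin_ne_zero hz.1 hz.2.1) s)
      ((ContinuousAt.comp (x := (z, s)) (f := fun x : Sph (n + 3) × ℝ => x.1)
        (continuousAt_unspin_coe k hz.1) continuous_fst.continuousAt).prodMk
        continuous_snd.continuousAt),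
      hφ _ (R.pushToCircle_notMem (planar_unspin_ne_zero hz.1 hz.2.1) (by
        rw [norm_unspin k z hz.1, mul_one, unspin, rest_cyl, meridional, Fin.snoc_last]
        exact hz.2.2) s)⟩) ⟨hp, hp', hε⟩ 1
  simp only [pushToCircle_zero, pushToCircle_one] at h1
  refine CohomologousAt.trans ?_ h1
  have hα : ContinuousAt (fun q : Sph (n + 3) =>
      argNear (planar (m := n + 2) p.1) (planar (m := n + 2) q.1)) p :=
    ContinuousAt.comp (f := fun q : Sph (n + 3) => planar (m := n + 2) q.1)
      (continuousAt_argNear hp') continuous_planar_coe.continuousAt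
  have hζ : ContinuousAt (fun q : Sph (n + 3) =>
      argNear (axial (rest (m := n + 2) p.1)) (axial (rest (m := n + 2) q.1))) p :=
    ContinuousAt.comp (f := fun q : Sph (n + 3) => axial (rest (m := n + 2) q.1))
      (continuousAt_argNear hp) continuous_axial_rest.continuousAt
  have hne : ∀ᶠ q : Sph (n + 3) in 𝓝 p, axial (rest (m := n + 2) q.1) ≠ 0 ∧
      planar (m := n + 2) q.1 ≠ 0 ∧ ‖axial (rest (m := n + 2) q.1)‖ < ε :=
    hU.mem_nhds ⟨hp, hp', hε⟩
  obtain ⟨N₁, hN₁, H₁⟩ := F.primitiveAt_comp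
    (ζ := fun q : Sph (n + 3) => planar (m := n + 2) q.1) hα (by
      filter_upwards [hne] with q hq using circlePoint_eq_anglePoint hp' hq.2.1)
  obtain ⟨N₂, hN₂, H₂⟩ := F.primitiveAt_comp
    (ζ := fun q : Sph (n + 3) => planar (unspin k q.1)) (hα.add (hζ.const_mul (k : ℝ))) (by
      filter_upwards [hne] with q hq using circlePoint_planar_unspin hq.1 hq.2.1 hp hp')
  -- Jumps of the principal planar argument cancel between the two factors; a jump `j` of the axial
  -- one contributes a power of `h ^ k = 1`. So principal arguments may be replaced by continuous
  -- branches.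
  have hη : ∀ᶠ q : Sph (n + 3) in 𝓝 p,
      (f ((planar (m := n + 2) q.1).arg + k * (axial (rest q.1)).arg))⁻¹ *
        f (planar (m := n + 2) q.1).arg =
      (f (argNear (planar (m := n + 2) p.1) (planar (m := n + 2) q.1) +
        k * argNear (axial (rest (m := n + 2) p.1)) (axial (rest (m := n + 2) q.1))))⁻¹ *
        f (argNear (planar (m := n + 2) p.1) (planar (m := n + 2) q.1)) := by
    filter_upwards [hne] with q hq
    obtain ⟨i, hi⟩ := arg_eq_argNear_add hp' hq.2.1
    obtain ⟨j, hj⟩ := arg_eq_argNear_add hp hq.1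
    rw [hi, hj, F.period]
    rw [show ∀ x y : ℝ, x + i * (2 * Real.pi) + k * (y + j * (2 * Real.pi)) =
      x + k * y + ((i + k * j : ℤ) : ℝ) * (2 * Real.pi) by intro x y; push_cast; ring, F.period,
      zpow_add, zpow_mul, zpow_natCast, hk, one_zpow]
    group
  refine CohomologousAt.congr ⟨N₁ ∩ N₂, inter_mem hN₁ hN₂, fun a ha b hb => ?_⟩
    (hη.mono fun _ => Eq.symm)
  have e1 := H₁ a ha.1 b hb.1
  have e2 := H₂ a ha.2 b hb.2
  simp only [pullCocycle, Function.comp_apply, Pi.add_apply] at e1 e2 ⊢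
  rw [e1, e2]
  group

/-- For axial norm less than `ε` both branches of the definition satisfy the same relation, so
switching at `ε / 2` does no harm. Where the norm is at least `ε`, only the second branch occurs
nearby. -/
theorem cohomologousAt_spunCocycle (R : StdRegion (m := n + 1) A (fun r => r (Fin.last n)) ε)
    (hφ : ∀ p ∉ A, CocycleAt φ p) (F : IsAngularPrimitive (m := n + 1) φ f h) (hk : h ^ k = 1)
    {p : Sph (n + 3)} (hp : axial (rest (m := n + 2) p.1) ≠ 0) (hpA : p ∉ twistSpinSet k A) :
    CohomologousAt (spunCocycle φ f k (ε / 2))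
      (pullCocycle (fun p : Sph (n + 3) => radial (m := n + 1) (unspin k p.1)) φ)
      (axisTwist φ f k) p := by
  have hε := R.pos
  rcases lt_or_ge ‖axial (rest (m := n + 2) p.1)‖ ε with hlt | hge
  · have hp' : planar (m := n + 2) p.1 ≠ 0 := fun h0 =>
      hpA (((R.twistSpinSet k).mem_iff p hlt).2 h0)
    obtain ⟨N, hN, H⟩ := cohomologousAt_axisTwist R hφ F hk hp hp' hlt
    refine ⟨N, hN, fun a ha b hb => ?_⟩
    unfold spunCocycle
    split_ifs with hc
    · exact H a ha b hb
    · rfl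
  · refine ⟨_, (isOpen_lt (continuous_const (y := ε / 2))
      continuous_axial_rest.norm).mem_nhds (by
        rw [mem_ofPred_eq]; linarith : p ∈ {q : Sph (n + 3) | ε / 2 < ‖_‖}), fun a ha b hb => ?_⟩
    have ha' : ε / 2 < ‖axial (rest (m := n + 2) a.1)‖ := ha
    rw [spunCocycle, if_neg fun hc => ha'.not_gt hc.1]
    rfl

theorem spunCocycle_eq (φ : Sph (n + 2) → Sph (n + 2) → G) (f : ℝ → G) (k : ℕ) {δ : ℝ}
    {a b : Sph (n + 3)} (ha : ‖axial (rest (m := n + 2) a.1)‖ < δ)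
    (hb : ‖axial (rest (m := n + 2) b.1)‖ < δ) :
    spunCocycle φ f k δ a b = pullCocycle (fun p : Sph (n + 3) =>
      circlePoint (n + 1) (planar (m := n + 2) p.1)) φ a b := by
  rw [spunCocycle, if_pos ⟨ha, hb⟩]
  rfl

theorem cocycleAt_spunCocycle (R : StdRegion (m := n + 1) A (fun r => r (Fin.last n)) ε)
    (hφ : ∀ p ∉ A, CocycleAt φ p) (F : IsAngularPrimitive (m := n + 1) φ f h) (hk : h ^ k = 1)
    {p : Sph (n + 3)} (hpA : p ∉ twistSpinSet k A) :
    CocycleAt (spunCocycle φ f k (ε / 2)) p := by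
  have hε := R.pos
  by_cases hp : axial (rest (m := n + 2) p.1) = 0
  · have hp' : planar (m := n + 2) p.1 ≠ 0 := fun h0 =>
      hpA (((R.twistSpinSet k).mem_iff p (by rw [hp, norm_zero]; exact hε)).2 h0)
    have h1 : CocycleAt (pullCocycle (fun p : Sph (n + 3) =>
        circlePoint (n + 1) (planar (m := n + 2) p.1)) φ) p :=
      (hφ _ (R.circlePoint_notMem hp')).pull
        (f := fun p : Sph (n + 3) => circlePoint (n + 1) (planar (m := n + 2) p.1))
        (ContinuousAt.comp (f := fun p : Sph (n + 3) => planar (m := n + 2) p.1)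
          (continuousAt_circlePoint hp') continuous_planar_coe.continuousAt)
    obtain ⟨N, hN, H⟩ := h1
    refine ⟨_, inter_mem hN ((isOpen_lt continuous_axial_rest.norm
      (continuous_const (y := ε / 2))).mem_nhds (by
        rw [mem_ofPred_eq, hp, norm_zero]; linarith : p ∈ {q : Sph (n + 3) | ‖_‖ < ε / 2})),
      fun a ha b hb c hc => ?_⟩
    rw [spunCocycle_eq φ f k ha.2 hb.2, spunCocycle_eq φ f k hb.2 hc.2,
      spunCocycle_eq φ f k ha.2 hc.2]
    exact H a ha.1 b hb.1 c hc.1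
  · refine (cohomologousAt_spunCocycle R hφ F hk hp hpA).cocycleAt (CocycleAt.pull
      (f := fun p : Sph (n + 3) => radial (m := n + 1) (unspin k p.1)) (hφ _ fun h1 =>
        hpA ((mem_twistSpinSet_iff hp).2 h1)) ?_)
    exact ContinuousAt.comp (g := radial (m := n + 1)) (continuousAt_radial
      (norm_ne_zero_iff.1 (by rw [norm_unspin k p hp]; exact one_ne_zero)))
      (continuousAt_unspin_coe k hp)

/-- At angle zero the axial argument vanishes and only the pushing factor of `axisTwist` remains. On
the closed lower hemisphere, which is mapped to the axis, the homotopy pushing to the circle gives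
the same comparison function. -/
theorem cohomologousAt_pull_fibreMap
    (R : StdRegion (m := n + 1) A (fun r => r (Fin.last n)) ε) (hφ : ∀ p ∉ A, CocycleAt φ p)
    (F : IsAngularPrimitive (m := n + 1) φ f h) (hk : h ^ k = 1) {p : Sph (n + 2)} (hp : p ∉ A) :
    CohomologousAt (pullCocycle fibreMap (spunCocycle φ f k (ε / 2))) φ
      (fun q => transport φ (pushToCircle (m := n + 1) q.1) 0 1) p := by
  have hε := R.pos
  have hcont := continuousAt_fibreMap R hp
  have hlast : Continuous fun q : Sph (n + 2) => rest (m := n + 1) q.1 (Fin.last n) :=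
    (continuous_apply (Fin.last n)).comp (continuous_rest.comp continuous_subtype_val)
  rcases lt_or_ge 0 (rest (m := n + 1) p.1 (Fin.last n)) with h0 | h0
  · have hax : ∀ q : Sph (n + 2), 0 < rest (m := n + 1) q.1 (Fin.last n) →
        axial (rest (fibreMap q).1) = (rest (m := n + 1) q.1 (Fin.last n) : ℂ) := fun q hq => by
      rw [fibreMap_coe hq.le, rest_cyl, axial_halfCoords, max_eq_left hq.le]
    have h1 := (cohomologousAt_spunCocycle R hφ F hk
      (by rw [hax p h0]; exact_mod_cast h0.ne') (fibreMap_notMem R k hp)).pull hcont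
    have hpos := (isOpen_lt continuous_const hlast).mem_nhds h0
    refine (h1.congr_right hpos fun a ha b hb => ?_).congr ?_
    · simp only [pullCocycle]
      rw [unspin_fibreMap k ha, unspin_fibreMap k hb, radial_self (m := n + 1),
        radial_self (m := n + 1)]
    · filter_upwards [hpos] with q hq
      have hq' : 0 < rest (m := n + 1) q.1 (Fin.last n) := hq
      rw [Function.comp_apply, axisTwist, unspin_fibreMap k hq', hax q hq',
        Complex.arg_ofReal_of_nonneg hq'.le]
      simp
  · have hU : IsOpen {q : Sph (n + 2) | planar (m := n + 1) q.1 ≠ 0 ∧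
        rest (m := n + 1) q.1 (Fin.last n) < ε} :=
      (isOpen_ne_fun continuous_planar_coe continuous_const).inter
        (isOpen_lt hlast continuous_const)
    have hp' : planar (m := n + 1) p.1 ≠ 0 := fun h1 =>
      hp ((R.mem_iff p (h0.trans_lt hε)).2 h1)
    have h1 := homotopy_cohomologous (φ := φ)
      (W := fun q : Sph (n + 2) => pushToCircle (m := n + 1) q.1) hU
      (fun z hz s => ⟨ContinuousAt.comp (x := (z, s)) (g := Function.uncurry pushToCircle)
        (f := fun x : Sph (n + 2) × ℝ => (x.1.1, x.2)) (continuousAt_pushToCircle hz.1 s)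
        ((continuous_subtype_val.comp continuous_fst).prodMk continuous_snd).continuousAt,
        hφ _ (R.pushToCircle_notMem hz.1 (by
          rw [sph_norm (m := n + 1), mul_one]; exact hz.2) s)⟩) ⟨hp', h0.trans_lt hε⟩ 1
    simp only [pushToCircle_zero, pushToCircle_one, radial_self] at h1
    have hsmall : {q : Sph (n + 2) | ‖axial (rest (fibreMap q).1)‖ < ε / 2} ∈ 𝓝 p :=
      hcont ((isOpen_lt continuous_axial_rest.norm (continuous_const (y := ε / 2))).mem_nhds (by
        rw [mem_ofPred_eq, axial_fibreMap_of_nonpos R hp h0, norm_zero]; linarith))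
    refine h1.congr_left (inter_mem hsmall (hU.mem_nhds ⟨hp', h0.trans_lt hε⟩))
      fun a ha b hb => ?_
    have hc : ∀ q : Sph (n + 2), planar (m := n + 1) q.1 ≠ 0 →
        circlePoint (n + 1) (planar (fibreMap q).1) =
          circlePoint (n + 1) (planar (m := n + 1) q.1) := fun q hq => by
      rw [fibreMap, planar_radial_cyl (cyl_ne_zero hq _)]
      exact circlePoint_smul (inv_pos.2 (norm_pos_iff.2 (cyl_ne_zero hq _))) _
    rw [pullCocycle, spunCocycle_eq φ f k ha.1 hb.1]
    simp only [pullCocycle]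
    rw [hc a ha.2.1, hc b hb.2.1]

end SpunCocycle

/-! ### Meridian conditions, twist spins and trivial knots -/

section KnotCocycle

variable {n : ℕ}

/-- The `d`-th powers of the transports of `φ` along small loops around the knot are trivial. -/
def Knot.LoopsKilled {G : Type*} [Group G] (K : Knot n) (φ : Sph (n + 2) → Sph (n + 2) → G)
    (d : ℕ) : Prop :=
  ∀ p ∈ K.carrier, LoopsKilledAt φ K.carrier d p

/-- Connectedness of the knot reduces the condition to one point, chosen in the standard region,
where it concerns only the great circle. -/
theorem Knot.loopsKilled_iff {G : Type*} [Group G] (K : Knot (n + 1))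
    {φ : Sph (n + 1 + 2) → Sph (n + 1 + 2) → G} (hφ : ∀ p ∉ K.carrier, CocycleAt φ p)
    (e : Sph (n + 1 + 2) ≃ₜ Sph (n + 1 + 2)) {A : Set (Sph (n + 1 + 2))} (he : e '' K.carrier = A)
    {κ : (Fin (n + 1 + 1) → ℝ) → ℝ} {ε : ℝ} (R : StdRegion (m := n + 1 + 1) A κ ε)
    {r : Fin (n + 1 + 1) → ℝ} (hr : cyl 0 r ≠ 0) (hκ : κ r ≤ 0) (d : ℕ) :
    K.LoopsKilled φ d ↔
      transport (pullCocycle e.symm φ) (stdLoop (n + 1 + 1)) 0 1 ^ d = 1 := by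
  subst he
  have hφ' : ∀ p ∉ e '' K.carrier, CocycleAt (pullCocycle e.symm φ) p := fun p hp =>
    (hφ _ fun h => hp ⟨_, h, e.apply_symm_apply p⟩).pull e.symm.continuous.continuousAt
  set v : Sph (n + 1 + 1 + 1) := radial (cyl 0 r)
  have hvp : planar v.1 = 0 := by rw [planar_radial_cyl hr, smul_zero]
  have hvκ : κ (rest v.1) ≤ 0 := by
    rw [rest_radial_cyl hr, R.map_smul _ (by positivity)]
    exact mul_nonpos_of_nonneg_of_nonpos (by positivity) hκ
  have hvA : v ∈ e '' K.carrier := (R.mem_iff v (hvκ.trans_lt R.pos)).2 hvp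
  have hvK : e.symm v ∈ K.carrier := by
    obtain ⟨p, hp, hpv⟩ := hvA
    rw [← hpv]
    simpa using hp
  rw [← R.loopsKilledAt_iff hφ' hvp hvκ d]
  constructor
  · intro h
    have := (h _ hvK).pull e.symm
    rwa [e.symm_symm, e.apply_symm_apply, ← e.image_eq_preimage_symm] at this
  · intro h p hp
    refine LoopsKilledAt.of_isPreconnected hφ K.isPreconnected_carrier
      (fun q hq => K.flatAt hq) hvK hp ?_
    have := h.pull e
    rw [e.preimage_image] at this
    convert this using 1
    funext a b
    simp [pullCocycle]

theorem fibreMap_comp_stdLoop : fibreMap ∘ stdLoop (n + 1) = stdLoop (n + 2) :=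
  funext fun _ => fibreMap_circlePoint (Complex.exp_ne_zero _)

theorem cyl_single_ne_zero {m : ℕ} (i : Fin m) {c : ℝ} (hc : c ≠ 0) :
    cyl 0 (Pi.single i c) ≠ 0 := fun h => by
  have := congrFun (congrArg rest h) i
  simp only [rest_cyl, Pi.single_eq_same] at this
  exact hc (by simpa [rest] using this)

/-- The effect of twist spinning on cocycles on the complement of a knot. -/
theorem Knot.IsTwistSpunOf.exists_map {k : ℕ} {K : Knot (n + 1)} {L : Knot (n + 2)}
    (hL : L.IsTwistSpunOf k K) :
    ∃ θ : Sph (n + 1 + 2) → Sph (n + 2 + 2),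
      (∀ p ∉ K.carrier, ContinuousAt θ p ∧ θ p ∉ L.carrier) ∧
      (∀ {G : Type} [Group G] (φ : Sph (n + 2 + 2) → Sph (n + 2 + 2) → G),
        (∀ p ∉ L.carrier, CocycleAt φ p) → ∀ d, K.LoopsKilled (pullCocycle θ φ) d →
          L.LoopsKilled φ d) ∧
      ∀ {G : Type} [Group G] (φ : Sph (n + 1 + 2) → Sph (n + 1 + 2) → G),
        (∀ p ∉ K.carrier, CocycleAt φ p) → ∀ d, d ∣ k → K.LoopsKilled φ d →
          ∃ φ' : Sph (n + 2 + 2) → Sph (n + 2 + 2) → G, (∀ p ∉ L.carrier, CocycleAt φ' p) ∧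
            L.LoopsKilled φ' d ∧
            ∃ ξ, ∀ p ∉ K.carrier, CohomologousAt (pullCocycle θ φ') φ ξ p := by
  obtain ⟨χ, ψ, hχ, hψ⟩ := hL
  set e := χ.toHomeomorph
  set g := ψ.toHomeomorph
  have he : e '' K.carrier = χ '' K.carrier := rfl
  have hg : g '' L.carrier = twistSpinSet k (χ '' K.carrier) := hψ
  obtain ⟨ε, R⟩ := hχ.exists_stdRegion
  have R' := R.twistSpinSet k
  have hKe : ∀ {p}, p ∉ K.carrier → e p ∉ χ '' K.carrier := fun hp ⟨q, hq, hqp⟩ =>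
    hp (e.injective hqp ▸ hq)
  have hLg : ∀ {p}, p ∉ twistSpinSet k (χ '' K.carrier) → g.symm p ∉ L.carrier := fun hp h =>
    hp (hg ▸ ⟨_, h, g.apply_symm_apply _⟩)
  have hgL : ∀ {p}, p ∉ L.carrier → g p ∉ twistSpinSet k (χ '' K.carrier) := fun hp h => by
    rw [← hg] at h
    obtain ⟨q, hq, hqp⟩ := h
    exact hp (g.injective hqp ▸ hq)
  have hθ : ∀ p ∉ K.carrier, ContinuousAt (g.symm ∘ fibreMap ∘ e) p ∧
      (g.symm ∘ fibreMap ∘ e) p ∉ L.carrier := fun p hp =>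
    ⟨g.symm.continuous.continuousAt.comp (ContinuousAt.comp (g := fibreMap)
      (continuousAt_fibreMap R (hKe hp)) e.continuous.continuousAt),
      hLg (fibreMap_notMem R k (hKe hp))⟩
  have hpush : ∀ {G : Type} [Group G] (φ : Sph (n + 2 + 2) → Sph (n + 2 + 2) → G),
      (∀ p ∉ L.carrier, CocycleAt φ p) → ∀ d,
      K.LoopsKilled (pullCocycle (g.symm ∘ fibreMap ∘ e) φ) d → L.LoopsKilled φ d := by
    intro G _ φ hφ d h
    rw [K.loopsKilled_iff (fun p hp => (hφ _ (hθ p hp).2).pull (hθ p hp).1) e he R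
      (cyl_single_ne_zero (Fin.last (n + 1)) (neg_ne_zero.2 one_ne_zero)) (by simp)] at h
    -- For the spun knot the test point must lie on the axis; a non-axial coordinate is available
    -- because `K` has positive dimension.
    rw [L.loopsKilled_iff hφ g hg R' (cyl_single_ne_zero (0 : Fin (n + 1)).castSucc.castSucc
      one_ne_zero) (by simp [axial, Fin.ext_iff, Complex.ext_iff])]
    rw [transport_pull] at h ⊢
    rw [transport_pull] at h
    have : (g.symm ∘ fibreMap ∘ e) ∘ e.symm ∘ stdLoop (n + 1 + 1) =
        g.symm ∘ stdLoop (n + 1 + 2) := by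
      rw [← fibreMap_comp_stdLoop (n := n + 1)]
      funext t
      simp
    rwa [this] at h
  refine ⟨g.symm ∘ fibreMap ∘ e, hθ, hpush, fun {G} _ φ hφ d hdk h => ?_⟩
  have hφ' : ∀ p ∉ χ '' K.carrier, CocycleAt (pullCocycle e.symm φ) p := fun p hp =>
    (hφ _ fun h => hp ⟨_, h, e.apply_symm_apply p⟩).pull e.symm.continuous.continuousAt
  obtain ⟨f, c, F⟩ := exists_angularPrimitive (m := n + 1 + 1)
    (φ := pullCocycle e.symm φ) fun x => hφ' _ (R.anglePoint_notMem x)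
  have hc : c ^ k = 1 := by
    have h1 := h
    rw [K.loopsKilled_iff hφ e he R (cyl_single_ne_zero (Fin.last (n + 1))
      (neg_ne_zero.2 one_ne_zero)) (by simp)] at h1
    obtain ⟨i, rfl⟩ := hdk
    rw [pow_mul, (F.transport_stdLoop_pow d).1 h1, one_pow]
  have hcoc : ∀ p ∉ L.carrier, CocycleAt
      (pullCocycle g (spunCocycle (pullCocycle e.symm φ) f k (ε / 2))) p := fun p hp =>
    (cocycleAt_spunCocycle R hφ' F hc (hgL hp)).pull g.continuous.continuousAt
  have hcoh : ∀ p ∉ K.carrier, CohomologousAt (pullCocycle (g.symm ∘ fibreMap ∘ e)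
      (pullCocycle g (spunCocycle (pullCocycle e.symm φ) f k (ε / 2)))) φ
      ((fun q => transport (pullCocycle e.symm φ) (pushToCircle (m := n + 1 + 1) q.1) 0 1) ∘ e)
      p := by
    intro p hp
    have h1 := (cohomologousAt_pull_fibreMap R hφ' F hc (hKe hp)).pull e.continuous.continuousAt
    convert h1 using 1
    · funext a b; simp [pullCocycle]
    · funext a b; simp [pullCocycle]
  exact ⟨_, hcoc, hpush _ hcoc d fun p hp => CohomologousAt.loopsKilledAt hφ hcoh (h p hp), _, hcoh⟩

theorem stdRegion_standardSphere (n : ℕ) :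
    StdRegion (m := n + 1) (standardSphere n) (fun _ => 0) 1 :=
  ⟨continuous_const, fun c _ _ => by simp, one_pos, fun p _ => by
    simp [standardSphere, planar, Complex.ext_iff]⟩

/-- Transports along loops in the complement of a trivial knot commute. -/
theorem Knot.IsTrivial.commute_transport {G : Type*} [Group G] {L : Knot n} (hL : L.IsTrivial)
    {φ : Sph (n + 2) → Sph (n + 2) → G} (hφ : ∀ p ∉ L.carrier, CocycleAt φ p)
    {γ δ : ℝ → Sph (n + 2)} (hγ : Continuous γ) (hδ : Continuous δ) (hγ1 : γ 1 = γ 0)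
    (hδ0 : δ 0 = γ 0) (hδ1 : δ 1 = γ 0) (hγL : ∀ t, γ t ∉ L.carrier)
    (hδL : ∀ t, δ t ∉ L.carrier) :
    Commute (transport φ γ 0 1) (transport φ δ 0 1) := by
  obtain ⟨χ, hχ⟩ := hL
  set e := χ.toHomeomorph
  have he : e '' L.carrier = standardSphere n := hχ
  have hφ' : ∀ p ∉ standardSphere n, CocycleAt (pullCocycle e.symm φ) p := fun p hp =>
    (hφ _ fun h => hp (he ▸ ⟨_, h, e.apply_symm_apply p⟩)).pull e.symm.continuous.continuousAt
  have R := stdRegion_standardSphere n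
  obtain ⟨f, h, F⟩ := exists_angularPrimitive (m := n + 1)
    (φ := pullCocycle e.symm φ) fun x => hφ' _ (R.anglePoint_notMem x)
  obtain ⟨c, hc⟩ := R.exists_transport_eq hφ' F (e (γ 0))
  have key : ∀ ζ : ℝ → Sph (n + 2), Continuous ζ → ζ 0 = γ 0 → ζ 1 = γ 0 →
      (∀ t, ζ t ∉ L.carrier) → ∃ j : ℤ, transport φ ζ 0 1 = c⁻¹ * h ^ j * c := by
    intro ζ hζ h0 h1 hζL
    have hA : ∀ t, e (ζ t) ∉ standardSphere n := fun t hmem => by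
      rw [← he] at hmem
      obtain ⟨q, hq, hqt⟩ := hmem
      exact hζL t (e.injective hqt ▸ hq)
    obtain ⟨j, hj⟩ := hc (e ∘ ζ) (e.continuous.comp hζ) (congrArg e h0) (congrArg e h1)
      fun t => ⟨hA t, one_pos⟩
    have : e.symm ∘ e ∘ ζ = ζ := by funext t; simp
    exact ⟨j, by rw [← hj, transport_pull, this]⟩
  obtain ⟨i, hi⟩ := key γ hγ rfl hγ1 hγL
  obtain ⟨j, hj⟩ := key δ hδ hδ0 hδ1 hδL
  rw [hi, hj, commute_iff_eq]
  calc c⁻¹ * h ^ i * c * (c⁻¹ * h ^ j * c) = c⁻¹ * (h ^ i * h ^ j) * c := by group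
    _ = c⁻¹ * (h ^ j * h ^ i) * c := by rw [← zpow_add, ← zpow_add, add_comm]
    _ = _ := by group

/-- The winding number cocycle on the punctured plane, modulo `m`. -/
noncomputable def windingCocycle (m : ℕ) (z w : ℂ) : Multiplicative (ZMod m) :=
  Multiplicative.ofAdd ((round ((w.arg - z.arg) / (2 * Real.pi)) : ℤ) : ZMod m)

/-- Where the continuous branch `α` varies by less than `π`, rounding discards its variation and
leaves only the jumps of the principal argument. -/
theorem primitiveAt_windingCocycle (m : ℕ) {Y : Type*} [TopologicalSpace Y] {ζ : Y → ℂ} {α : Y → ℝ}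
    {N : Y → ℤ} {y : Y} (hα : ContinuousAt α y)
    (h : ∀ᶠ a in 𝓝 y, (ζ a).arg = α a + N a * (2 * Real.pi)) :
    PrimitiveAt (pullCocycle ζ (windingCocycle m))
      (fun a => Multiplicative.ofAdd (N a : ZMod m)) y := by
  have hpi := Real.pi_pos
  refine ⟨_, inter_mem h (hα (Metric.ball_mem_nhds (α y) (half_pos hpi))),
    fun a ha b hb => ?_⟩
  have ha1 : (ζ a).arg = α a + N a * (2 * Real.pi) := ha.1
  have hb1 : (ζ b).arg = α b + N b * (2 * Real.pi) := hb.1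
  have ha2 : |α a - α y| < Real.pi / 2 := ha.2
  have hb2 : |α b - α y| < Real.pi / 2 := hb.2
  have hr : round (((ζ b).arg - (ζ a).arg) / (2 * Real.pi)) = N b - N a := by
    have : ((ζ b).arg - (ζ a).arg) / (2 * Real.pi) =
        (α b - α a) / (2 * Real.pi) + ((N b - N a : ℤ) : ℝ) := by
      rw [ha1, hb1]
      field_simp
      push_cast
      ring
    rw [this, round_add_intCast, add_eq_right, round_eq_zero_iff]
    rw [abs_lt] at ha2 hb2
    constructor
    · rw [le_div_iff₀ (by positivity)]; linarith
    · rw [div_lt_iff₀ (by positivity)]; linarith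
  simp only [pullCocycle, windingCocycle, hr]
  rw [← ofAdd_neg, ← ofAdd_add]
  push_cast
  congr 1
  ring

/-- A cocycle on the complement of a trivial knot whose transport along the small loops around the
knot is not trivial. -/
theorem Knot.IsTrivial.exists_winding {L : Knot (n + 1)} (hL : L.IsTrivial) {m : ℕ} (hm : 2 ≤ m) :
    ∃ ν : Sph (n + 1 + 2) → Sph (n + 1 + 2) → Multiplicative (ZMod m),
      (∀ p ∉ L.carrier, CocycleAt ν p) ∧ ¬ L.LoopsKilled ν 1 := by
  obtain ⟨χ, hχ⟩ := hL
  set e := χ.toHomeomorph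
  have he : e '' L.carrier = standardSphere (n + 1) := hχ
  have R := stdRegion_standardSphere (n + 1)
  set ν₀ : Sph (n + 1 + 2) → Sph (n + 1 + 2) → Multiplicative (ZMod m) :=
    pullCocycle (fun p : Sph (n + 1 + 2) => planar (m := n + 1 + 1) p.1) (windingCocycle m)
  have hν₀ : ∀ p ∉ standardSphere (n + 1), CocycleAt ν₀ p := by
    intro p hp
    have hp' : planar (m := n + 1 + 1) p.1 ≠ 0 := fun h0 => hp ((R.mem_iff p one_pos).2 h0)
    choose! N hN using fun z : ℂ => arg_eq_argNear_add (w := planar (m := n + 1 + 1) p.1) (z := z) hp'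
    exact (primitiveAt_windingCocycle m
      (ζ := fun q : Sph (n + 1 + 2) => planar (m := n + 1 + 1) q.1)
      (N := fun q => N (planar (m := n + 1 + 1) q.1))
      (α := fun q => argNear (planar (m := n + 1 + 1) p.1) (planar (m := n + 1 + 1) q.1)) (y := p)
      (ContinuousAt.comp (f := fun q : Sph (n + 1 + 2) => planar (m := n + 1 + 1) q.1)
        (continuousAt_argNear hp') continuous_planar_coe.continuousAt)
      (by filter_upwards [continuous_planar_coe.continuousAt.eventually_ne hp'] with q hq
            using hN _ hq)).cocycleAt
  refine ⟨pullCocycle e ν₀, fun p hp => (hν₀ _ fun h => ?_).pull e.continuous.continuousAt, ?_⟩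
  · rw [← he] at h
    obtain ⟨q, hq, hqp⟩ := h
    exact hp (e.injective hqp ▸ hq)
  rw [L.loopsKilled_iff (fun p hp => (hν₀ _ fun h => ?_).pull e.continuous.continuousAt) e he R
    (cyl_single_ne_zero 0 one_ne_zero) le_rfl, pow_one]
  · have h1 : ∀ x : ℝ, ∃ N : ℤ, (Complex.exp (x * Complex.I)).arg = x + N * (2 * Real.pi) := by
      intro x
      have h2 := Complex.norm_mul_exp_arg_mul_I (Complex.exp (x * Complex.I))
      rw [Complex.norm_exp_ofReal_mul_I, Complex.ofReal_one, one_mul] at h2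
      obtain ⟨j, hj⟩ := Complex.exp_eq_exp_iff_exists_int.1 h2
      refine ⟨j, ?_⟩
      have := congrArg Complex.im hj
      simpa using this
    choose N hN using h1
    have h3 : ∀ t, PrimitiveAt (pullCocycle (stdLoop (n + 1 + 1))
        (pullCocycle e.symm (pullCocycle e ν₀)))
        (fun t => Multiplicative.ofAdd (N (2 * Real.pi * t) : ZMod m)) t := by
      intro t
      have h4 := primitiveAt_windingCocycle m
        (ζ := fun t => planar (stdLoop (n + 1 + 1) t).1) (N := fun t => N (2 * Real.pi * t))
        (α := fun t => 2 * Real.pi * t) (y := t) (by fun_prop) (Eventually.of_forall fun s => by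
          rw [← hN, stdLoop, anglePoint, circlePoint,
            planar_radial_cyl (cyl_ne_zero (Complex.exp_ne_zero _) _), Complex.real_smul,
            Complex.arg_real_mul _ (inv_pos.2 (norm_pos_iff.2
              (cyl_ne_zero (Complex.exp_ne_zero _) _)))])
      convert h4 using 1
      funext a b
      simp [pullCocycle, ν₀]
    rw [transport_eq h3]
    have e0 : N (2 * Real.pi * 0) = 0 := by
      have := hN (2 * Real.pi * 0)
      simpa [Real.pi_ne_zero] using this.symm
    -- After a full turn the principal argument is back at `0` while the continuous angle is `2π`.
    have e1 : N (2 * Real.pi * 1) = -1 := by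
      have := hN (2 * Real.pi * 1)
      have h5 : Complex.exp ((2 * Real.pi * 1 : ℝ) * Complex.I) = 1 := by
        push_cast
        rw [mul_one]
        exact Complex.exp_two_pi_mul_I
      rw [h5, Complex.arg_one] at this
      have h6 : (N (2 * Real.pi * 1) + 1 : ℝ) * (2 * Real.pi) = 0 := by linarith
      have h7 := (mul_eq_zero.1 h6).resolve_right (by positivity)
      exact_mod_cast (by linarith : (N (2 * Real.pi * 1) : ℝ) = -1)
    rw [e0, e1]
    have : Fact (1 < m) := ⟨hm⟩
    simp only [Int.cast_zero, ofAdd_zero, inv_one, one_mul, Int.cast_neg, Int.cast_one]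
    intro h
    have h8 := ofAdd_eq_one.1 h
    simp at h8
  · rw [← he] at h
    obtain ⟨q, hq, hqp⟩ := h
    exact hp (e.injective hqp ▸ hq)

end KnotCocycle

/-! ### The cocycle of a homomorphism on the knot group -/

section FundamentalGroupCocycle

variable {n : ℕ} {H : Type*} [Group H]

section Holonomy

variable {X : Type*} [TopologicalSpace X] [PathConnectedSpace X] {x₀ : X}

/-- The class of a path from the base point. -/
noncomputable def basePath (x₀ x : X) : Path.Homotopic.Quotient x₀ x :=
  .mk (PathConnectedSpace.somePath x₀ x)

/-- The inverse of the value of a homomorphism on a class of paths, made into a loop by means of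
paths from the base point. -/
noncomputable def holonomy (ρ : FundamentalGroup X x₀ →* H) {a b : X}
    (q : Path.Homotopic.Quotient a b) : H :=
  (ρ (FundamentalGroup.fromPath (((basePath x₀ a).trans q).trans (basePath x₀ b).symm)))⁻¹

/-- The product in `FundamentalGroup` composes loops from right to left; the inverse in `holonomy`
restores the order of concatenation. -/
theorem holonomy_trans (ρ : FundamentalGroup X x₀ →* H) {a b c : X}
    (q : Path.Homotopic.Quotient a b) (r : Path.Homotopic.Quotient b c) :
    holonomy ρ (q.trans r) = holonomy ρ q * holonomy ρ r := by
  rw [holonomy, holonomy, holonomy, ← mul_inv_rev, ← map_mul]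
  congr 2
  rw [FundamentalGroup.mul_def]
  simp only [Path.Homotopic.Quotient.trans_assoc]
  congr 2
  rw [← Path.Homotopic.Quotient.trans_assoc (basePath x₀ b).symm,
    Path.Homotopic.Quotient.symm_trans, Path.Homotopic.Quotient.refl_trans]

theorem holonomy_cast (ρ : FundamentalGroup X x₀ →* H) {a b a' b' : X} (γ : Path a b)
    (ha : a' = a) (hb : b' = b) :
    holonomy ρ (.mk (γ.cast ha hb)) = holonomy ρ (.mk γ) := by
  subst ha hb
  rfl

end Holonomy

/-- The segment between two points of a real normed space. -/
noncomputable def segPath {E : Type*} [NormedAddCommGroup E] [NormedSpace ℝ E] (a b : E) :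
    Path a b where
  toFun s := (1 - (s : ℝ)) • a + (s : ℝ) • b
  continuous_toFun := by fun_prop
  source' := by simp
  target' := by simp

/-- Two points of the sphere are close, relative to the knot, if the segment between them projects
to the complement of the knot. -/
def Knot.IsShort (K : Knot n) (a b : Sph (n + 2)) : Prop :=
  ∀ s : unitInterval, segPath a.1 b.1 s ≠ 0 ∧ radial (m := n + 1) (segPath a.1 b.1 s) ∉ K.carrier

/-- The geodesic between two close points. -/
noncomputable def Knot.shortPath (K : Knot n) {a b : K.Complement} (h : K.IsShort a.1 b.1) :
    Path a b where
  toFun s := ⟨radial (m := n + 1) (segPath a.1.1 b.1.1 s), (h s).2⟩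
  continuous_toFun := by
    refine Continuous.subtype_mk (continuous_iff_continuousAt.2 fun s => ?_) _
    exact ContinuousAt.comp (g := radial (m := n + 1)) (continuousAt_radial (h s).1)
      (segPath a.1.1 b.1.1).continuous.continuousAt
  source' := Subtype.ext (by simp [radial_self (m := n + 1)])
  target' := Subtype.ext (by simp [radial_self (m := n + 1)])

open Classical in
/-- The cocycle on the complement of a knot associated with a homomorphism on the knot group. -/
noncomputable def Knot.homCocycle (K : Knot n) {x₀ : K.Complement}
    [PathConnectedSpace K.Complement]
    (ρ : FundamentalGroup K.Complement x₀ →* H) (a b : Sph (n + 2)) : H :=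
  if h : (a ∉ K.carrier ∧ b ∉ K.carrier) ∧ K.IsShort a b then
    holonomy ρ (.mk (K.shortPath (a := ⟨a, h.1.1⟩) (b := ⟨b, h.1.2⟩) h.2)) else 1

variable {K : Knot n} {x₀ : K.Complement} [PathConnectedSpace K.Complement]

theorem Knot.homCocycle_eq (ρ : FundamentalGroup K.Complement x₀ →* H) {a b : K.Complement}
    (h : K.IsShort a.1 b.1) : K.homCocycle ρ a.1 b.1 = holonomy ρ (.mk (K.shortPath h)) := by
  rw [homCocycle, dif_pos ⟨⟨a.2, b.2⟩, h⟩]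

/-- Small balls around a point of the complement project to the complement. -/
theorem Knot.exists_ball (K : Knot n) {p : Sph (n + 2)} (hp : p ∉ K.carrier) :
    ∃ r > 0, ∀ v ∈ Metric.ball p.1 r, v ≠ 0 ∧ radial (m := n + 1) v ∉ K.carrier := by
  have h0 : p.1 ≠ 0 := norm_ne_zero_iff.1 (by rw [sph_norm (m := n + 1)]; exact one_ne_zero)
  have h1 : ∀ᶠ v in 𝓝 p.1, radial (m := n + 1) v ∉ K.carrier :=
    continuousAt_radial (m := n + 1) h0
      (K.isClosed_carrier.isOpen_compl.mem_nhds (by rwa [radial_self (m := n + 1)]))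
  have h2 : ∀ᶠ v in 𝓝 p.1, v ≠ 0 := isOpen_ne.mem_nhds h0
  exact Metric.eventually_nhds_iff_ball.1 (h2.and h1)

omit [PathConnectedSpace K.Complement] in
/-- Paths in the complement near a point with the same ends are homotopic. -/
theorem Knot.homotopic_of_ball {p : Sph (n + 2)} {r : ℝ}
    (hr : ∀ v ∈ Metric.ball p.1 r, v ≠ 0 ∧ radial (m := n + 1) v ∉ K.carrier) {a b : K.Complement}
    {γ δ : Path a b} {γ' δ' : Path a.1.1 b.1.1} (hγ' : ∀ s, γ' s ∈ Metric.ball p.1 r)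
    (hδ' : ∀ s, δ' s ∈ Metric.ball p.1 r) (hγ : ∀ s, (γ s).1 = radial (m := n + 1) (γ' s))
    (hδ : ∀ s, (δ s).1 = radial (m := n + 1) (δ' s)) : γ.Homotopic δ := by
  have hconv : Convex ℝ (Metric.ball p.1 r) := convex_ball _ _
  have : ContractibleSpace (Metric.ball p.1 r) := hconv.contractibleSpace ⟨_, hγ' 0⟩
  have ha : a.1.1 ∈ Metric.ball p.1 r := by simpa using hγ' 0
  have hb : b.1.1 ∈ Metric.ball p.1 r := by simpa using hγ' 1
  let π : C(Metric.ball p.1 r, K.Complement) :=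
    ⟨fun v => ⟨radial (m := n + 1) v.1, (hr v.1 v.2).2⟩, Continuous.subtype_mk
      (continuous_iff_continuousAt.2 fun v : Metric.ball p.1 r =>
        ContinuousAt.comp (g := radial (m := n + 1)) (f := fun v : Metric.ball p.1 r => v.1)
          (continuousAt_radial (hr v.1 v.2).1) continuous_subtype_val.continuousAt) _⟩
  let γ₁ : Path (⟨a.1.1, ha⟩ : Metric.ball p.1 r) ⟨b.1.1, hb⟩ :=
    ⟨⟨fun s => ⟨γ' s, hγ' s⟩, by fun_prop⟩, Subtype.ext γ'.source, Subtype.ext γ'.target⟩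
  let δ₁ : Path (⟨a.1.1, ha⟩ : Metric.ball p.1 r) ⟨b.1.1, hb⟩ :=
    ⟨⟨fun s => ⟨δ' s, hδ' s⟩, by fun_prop⟩, Subtype.ext δ'.source, Subtype.ext δ'.target⟩
  -- The homotopy is found in the contractible Euclidean ball and projected radially to the
  -- complement.
  have h := (SimplyConnectedSpace.paths_homotopic γ₁ δ₁).map π
  have ea : a = π ⟨a.1.1, ha⟩ := Subtype.ext (radial_self (m := n + 1) a.1).symm
  have eb : b = π ⟨b.1.1, hb⟩ := Subtype.ext (radial_self (m := n + 1) b.1).symm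
  have h' := h.pathCast ea eb
  convert h' using 1
  · ext s
    exact congrArg (fun x : Sph (n + 2) => x.1 _) (hγ s)
  · ext s
    exact congrArg (fun x : Sph (n + 2) => x.1 _) (hδ s)

theorem segPath_mem_ball {E : Type*} [NormedAddCommGroup E] [NormedSpace ℝ E] {p a b : E} {r : ℝ}
    (ha : a ∈ Metric.ball p r) (hb : b ∈ Metric.ball p r) (s : unitInterval) :
    segPath a b s ∈ Metric.ball p r :=
  convex_ball p r ha hb (by have := s.2.2; linarith) s.2.1 (by ring)

theorem Knot.homCocycle_eq_of_ball (ρ : FundamentalGroup K.Complement x₀ →* H) {p : Sph (n + 2)}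
    {r : ℝ} (hr : ∀ v ∈ Metric.ball p.1 r, v ≠ 0 ∧ radial (m := n + 1) v ∉ K.carrier)
    {a b : K.Complement} (γ : Path a b) (hγ : ∀ s, (γ s).1.1 ∈ Metric.ball p.1 r) :
    K.homCocycle ρ a.1 b.1 = holonomy ρ (.mk γ) := by
  have ha : a.1.1 ∈ Metric.ball p.1 r := by simpa using hγ 0
  have hb : b.1.1 ∈ Metric.ball p.1 r := by simpa using hγ 1
  have hs : K.IsShort a.1 b.1 := fun s => hr _ (segPath_mem_ball ha hb s)
  rw [K.homCocycle_eq ρ hs]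
  congr 1
  refine Path.Homotopic.Quotient.eq.2 (K.homotopic_of_ball hr (γ' := segPath a.1.1 b.1.1)
    (δ' := γ.map (continuous_subtype_val.comp continuous_subtype_val))
    (segPath_mem_ball ha hb) hγ (fun s => rfl) fun s => ?_)
  exact (radial_self (m := n + 1) _).symm

/-- The holonomy of the initial piece of the path, as a function of its end parameter, is a
primitive. -/
theorem Knot.transport_homCocycle (ρ : FundamentalGroup K.Complement x₀ →* H)
    (Γ : C(ℝ, K.Complement)) :
    transport (K.homCocycle ρ) (fun t => (Γ t).1) 0 1 =
      holonomy ρ (.mk ((segPath (0 : ℝ) 1).map Γ.continuous)) := by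
  have hseg : ∀ s t : ℝ, holonomy ρ (.mk ((segPath s t).map Γ.continuous)) =
      (holonomy ρ (.mk ((segPath 0 s).map Γ.continuous)))⁻¹ *
        holonomy ρ (.mk ((segPath 0 t).map Γ.continuous)) := by
    intro s t
    rw [eq_inv_mul_iff_mul_eq, ← holonomy_trans, ← Path.Homotopic.Quotient.mk_trans,
      ← Path.map_trans]
    congr 1
    exact Path.Homotopic.Quotient.eq.2
      ((SimplyConnectedSpace.paths_homotopic ((segPath (0 : ℝ) s).trans (segPath s t))
        (segPath 0 t)).map Γ)
  rw [transport_eq (f := fun t => holonomy ρ (.mk ((segPath (0 : ℝ) t).map Γ.continuous))),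
    ← hseg]
  intro t
  obtain ⟨r, hr, H⟩ := K.exists_ball (Γ t).2
  have hc : Continuous fun t => (Γ t).1.1 :=
    continuous_subtype_val.comp (continuous_subtype_val.comp Γ.continuous)
  obtain ⟨δ, hδ, hδr⟩ := Metric.mem_nhds_iff.1
    (hc.continuousAt (x := t) (Metric.ball_mem_nhds _ hr))
  refine ⟨Metric.ball t δ, Metric.ball_mem_nhds t hδ, fun a ha b hb => ?_⟩
  rw [← hseg]
  exact K.homCocycle_eq_of_ball ρ H _ fun s => hδr (segPath_mem_ball ha hb s)

theorem Knot.cocycleAt_homCocycle (ρ : FundamentalGroup K.Complement x₀ →* H) {p : Sph (n + 2)}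
    (hp : p ∉ K.carrier) : CocycleAt (K.homCocycle ρ) p := by
  obtain ⟨r, hr, H⟩ := K.exists_ball hp
  refine ⟨{q | q.1 ∈ Metric.ball p.1 r}, continuous_subtype_val.continuousAt
    (Metric.ball_mem_nhds _ hr), fun a ha b hb c hc => ?_⟩
  have hK : ∀ q : Sph (n + 2), q.1 ∈ Metric.ball p.1 r → q ∉ K.carrier := fun q hq => by
    have := (H _ hq).2
    rwa [radial_self (m := n + 1)] at this
  have hs : ∀ q q' : Sph (n + 2), q.1 ∈ Metric.ball p.1 r → q'.1 ∈ Metric.ball p.1 r →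
      K.IsShort q q' := fun q q' hq hq' s => H _ (segPath_mem_ball hq hq' s)
  rw [K.homCocycle_eq ρ (a := ⟨a, hK a ha⟩) (b := ⟨b, hK b hb⟩) (hs a b ha hb),
    K.homCocycle_eq ρ (a := ⟨b, hK b hb⟩) (b := ⟨c, hK c hc⟩) (hs b c hb hc),
    K.homCocycle_eq ρ (a := ⟨a, hK a ha⟩) (b := ⟨c, hK c hc⟩) (hs a c ha hc),
    ← holonomy_trans, ← Path.Homotopic.Quotient.mk_trans]
  congr 1
  refine Path.Homotopic.Quotient.eq.2 (K.homotopic_of_ball H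
    (γ' := (segPath a.1 b.1).trans (segPath b.1 c.1)) (δ' := segPath a.1 c.1) (fun s => ?_)
    (segPath_mem_ball ha hc) (fun s => ?_) fun s => rfl)
  · rw [Path.trans_apply]
    split_ifs
    · exact segPath_mem_ball ha hb _
    · exact segPath_mem_ball hb hc _
  · rw [Path.trans_apply, Path.trans_apply]
    split_ifs <;> rfl

/-- The transport of the cocycle of a homomorphism along a loop in the complement. -/
theorem Knot.transport_homCocycle_extend (ρ : FundamentalGroup K.Complement x₀ →* H)
    {a b : K.Complement} (γ : Path a b) :
    transport (K.homCocycle ρ) (fun t => (γ.extend t).1) 0 1 = holonomy ρ (.mk γ) := by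
  have h := K.transport_homCocycle ρ ⟨γ.extend, γ.continuous_extend⟩
  have e : (segPath (0 : ℝ) 1).map γ.continuous_extend =
      γ.cast γ.extend_zero γ.extend_one := by
    ext s
    have : segPath (0 : ℝ) 1 s = s := by simp [segPath]
    simp [this]
  rw [← holonomy_cast ρ γ γ.extend_zero γ.extend_one, ← e]
  exact h

end FundamentalGroupCocycle

/-! ### A slice chart from the gnomonic projection, and its meridian -/

section SliceChart

variable {n : ℕ}

/-- The lift of a point of a hyperplane to the next higher Euclidean space. -/
noncomputable def hyperplaneLift (x : EuclideanSpace ℝ (Fin (n + 2))) :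
    EuclideanSpace ℝ (Fin (n + 1 + 2)) :=
  cyl (planar x) (Fin.snoc (α := fun _ => ℝ) (rest x) (-1))

/-- The central projection onto the hyperplane. -/
noncomputable def hyperplaneProj (p : EuclideanSpace ℝ (Fin (n + 1 + 2))) :
    EuclideanSpace ℝ (Fin (n + 2)) :=
  (-rest p (Fin.last n))⁻¹ • cyl (planar p) fun i => rest p i.castSucc

/-- The gnomonic parametrization of the open lower hemisphere. -/
noncomputable def gnomonic (x : EuclideanSpace ℝ (Fin (n + 2))) : Sph (n + 2) :=
  radial (m := n + 1) (hyperplaneLift x)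

theorem hyperplaneLift_ne_zero (x : EuclideanSpace ℝ (Fin (n + 2))) : hyperplaneLift x ≠ 0 := by
  intro h
  have h1 : rest (hyperplaneLift x) (Fin.last n) = 0 := by rw [h]; rfl
  simp [hyperplaneLift] at h1

theorem hyperplaneProj_smul {c : ℝ} (hc : 0 < c) (p : EuclideanSpace ℝ (Fin (n + 1 + 2))) :
    hyperplaneProj (c • p) = hyperplaneProj p := by
  have h : (cyl (planar (c • p)) fun i : Fin n => rest (c • p) i.castSucc) =
      c • cyl (planar p) fun i => rest p i.castSucc := by
    rw [smul_cyl, planar_smul, rest_smul]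
    rfl
  rw [hyperplaneProj, h, hyperplaneProj, smul_smul, rest_smul]
  congr 1
  simp only [Pi.smul_apply, smul_eq_mul]
  rw [← mul_neg, mul_inv, mul_comm c⁻¹, mul_assoc, inv_mul_cancel₀ hc.ne', mul_one]

theorem hyperplaneProj_lift (x : EuclideanSpace ℝ (Fin (n + 2))) :
    hyperplaneProj (hyperplaneLift x) = x := by
  rw [hyperplaneProj, hyperplaneLift]
  simp

theorem hyperplaneProj_gnomonic (x : EuclideanSpace ℝ (Fin (n + 2))) :
    hyperplaneProj (gnomonic x).1 = x := by
  rw [gnomonic, radial_coe (hyperplaneLift_ne_zero x),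
    hyperplaneProj_smul (inv_pos.2 (norm_pos_iff.2 (hyperplaneLift_ne_zero x))),
    hyperplaneProj_lift]

theorem rest_gnomonic_last (x : EuclideanSpace ℝ (Fin (n + 2))) :
    rest (m := n + 1) (gnomonic x).1 (Fin.last n) < 0 := by
  rw [gnomonic, hyperplaneLift, rest_radial_cyl (hyperplaneLift_ne_zero x)]
  have := norm_pos_iff.2 (hyperplaneLift_ne_zero x)
  simpa [hyperplaneLift] using this

theorem hyperplaneLift_proj {p : EuclideanSpace ℝ (Fin (n + 1 + 2))}
    (hp : rest p (Fin.last n) < 0) :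
    hyperplaneLift (hyperplaneProj p) = (-rest p (Fin.last n))⁻¹ • p := by
  have h : hyperplaneProj p = cyl ((-rest p (Fin.last n))⁻¹ • planar p)
      ((-rest p (Fin.last n))⁻¹ • fun i => rest p i.castSucc) := smul_cyl _ _ _
  refine ext_planar_rest ?_ ?_
  · rw [planar_smul, h, hyperplaneLift, planar_cyl, planar_cyl]
  · rw [rest_smul, h, hyperplaneLift, rest_cyl, rest_cyl]
    funext i
    refine Fin.lastCases ?_ (fun i => ?_) i
    · simp only [Fin.snoc_last, Pi.smul_apply, smul_eq_mul]
      have := hp.ne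
      field_simp
    · simp

theorem gnomonic_proj {p : Sph (n + 2)} (hp : rest (m := n + 1) p.1 (Fin.last n) < 0) :
    gnomonic (hyperplaneProj p.1) = p := by
  rw [gnomonic, hyperplaneLift_proj hp, radial_smul (inv_pos.2 (neg_pos.2 hp))]
  exact radial_self (m := n + 1) p

theorem contDiff_hyperplaneLift : ContDiff ℝ ∞ (hyperplaneLift (n := n)) := by
  refine contDiff_euclidean.2 fun i => ?_
  refine Fin.cases ?_ (fun i => Fin.cases ?_ (fun i => Fin.lastCases ?_ (fun i => ?_) i) i) i
  · exact contDiff_euclidean.1 contDiff_id 0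
  · exact contDiff_euclidean.1 contDiff_id 1
  · simp only [hyperplaneLift, cyl, Fin.cons_succ, Fin.snoc_last]
    exact contDiff_const
  · simp only [hyperplaneLift, cyl, Fin.cons_succ, Fin.snoc_castSucc, rest]
    exact contDiff_euclidean.1 contDiff_id _

theorem contDiffOn_hyperplaneProj :
    ContDiffOn ℝ ∞ (hyperplaneProj (n := n)) {p | rest p (Fin.last n) < 0} := by
  have hc : ∀ i, ContDiff ℝ ∞ fun p : EuclideanSpace ℝ (Fin (n + 1 + 2)) => p i :=
    contDiff_euclidean.1 contDiff_id
  have h : ContDiffOn ℝ ∞ (fun p : EuclideanSpace ℝ (Fin (n + 1 + 2)) =>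
      (-rest p (Fin.last n))⁻¹) {p | rest p (Fin.last n) < 0} :=
    ContDiffOn.inv (hc _).neg.contDiffOn fun p hp => (neg_pos.2 hp).ne'
  refine h.smul (ContDiff.contDiffOn ?_)
  · refine contDiff_euclidean.2 fun i => ?_
    refine Fin.cases (hc 0) (fun i => Fin.cases (hc 1) (fun i => hc _) i) i

theorem contMDiff_gnomonic :
    ContMDiff (𝓡 (n + 2)) (𝓡 (n + 2)) ∞ (gnomonic (n := n)) := by
  have h : ContDiff ℝ ∞ fun x : EuclideanSpace ℝ (Fin (n + 2)) =>
      ‖hyperplaneLift x‖⁻¹ • hyperplaneLift x :=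
    ((contDiff_hyperplaneLift.norm ℝ hyperplaneLift_ne_zero).inv fun x =>
      norm_ne_zero_iff.2 (hyperplaneLift_ne_zero x)).smul contDiff_hyperplaneLift
  have h' : ∀ x : EuclideanSpace ℝ (Fin (n + 2)), ‖hyperplaneLift x‖⁻¹ • hyperplaneLift x ∈
      Metric.sphere (0 : EuclideanSpace ℝ (Fin (n + 1 + 2))) 1 := fun x => by
    simp [norm_smul, hyperplaneLift_ne_zero x]
  convert! ContMDiff.codRestrict_sphere (n := n + 2) h.contMDiff h' using 1
  funext x
  exact Subtype.ext (radial_coe (hyperplaneLift_ne_zero x))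

/-- The gnomonic parametrization, as a diffeomorphism onto the open lower hemisphere. -/
noncomputable def gnomonicPartialDiffeomorph (n : ℕ) : PartialDiffeomorph (𝓡 (n + 2)) (𝓡 (n + 2))
    (EuclideanSpace ℝ (Fin (n + 2))) (Sph (n + 2)) ∞ where
  toFun := gnomonic
  invFun p := hyperplaneProj p.1
  source := univ
  target := {p | rest (m := n + 1) p.1 (Fin.last n) < 0}
  map_source' x _ := rest_gnomonic_last x
  map_target' _ _ := mem_univ _
  left_inv' x _ := hyperplaneProj_gnomonic x
  right_inv' _ hp := gnomonic_proj hp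
  open_source := isOpen_univ
  open_target := isOpen_lt ((continuous_apply _).comp
    (continuous_rest.comp continuous_subtype_val)) continuous_const
  contMDiffOn_toFun := contMDiff_gnomonic.contMDiffOn
  contMDiffOn_invFun := by
    have := Fact.mk (finrank_euclideanSpace_fin (𝕜 := ℝ) (n := n + 2 + 1))
    have h : ContMDiff (𝓡 (n + 2)) 𝓘(ℝ, EuclideanSpace ℝ (Fin (n + 2 + 1))) ∞
        fun p : Sph (n + 2) => p.1 := contMDiff_coe_sphere
    exact contDiffOn_hyperplaneProj.contMDiffOn.comp h.contMDiffOn fun _ hp => hp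

theorem isLocalDiffeomorph_gnomonic :
    IsLocalDiffeomorph (𝓡 (n + 2)) (𝓡 (n + 2)) ∞ (gnomonic (n := n)) :=
  fun x => ⟨gnomonicPartialDiffeomorph n, mem_univ x, fun _ _ => rfl⟩

theorem gnomonic_injective : Function.Injective (gnomonic (n := n)) :=
  Function.LeftInverse.injective (g := fun p : Sph (n + 2) => hyperplaneProj p.1) hyperplaneProj_gnomonic

theorem planar_gnomonic_eq_zero (x : EuclideanSpace ℝ (Fin (n + 2))) :
    planar (m := n + 1) (gnomonic x).1 = 0 ↔ x 0 = 0 ∧ x 1 = 0 := by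
  have h := inv_ne_zero (norm_ne_zero_iff.2 (hyperplaneLift_ne_zero x))
  rw [hyperplaneLift] at h
  rw [gnomonic, hyperplaneLift, planar_radial_cyl (hyperplaneLift_ne_zero x), smul_eq_zero,
    or_iff_right h]
  simp [planar, Complex.ext_iff]

/-- In normal position the knot is standard on the lower hemisphere, and central projection carries
it to a linear subspace. This exhibits a concrete meridian. -/
theorem Knot.isSliceChart_gnomonic (K : Knot n) (χ : SphDiffeo (n + 2)) {ε : ℝ}
    (R : StdRegion (m := n + 1) (χ '' K.carrier) (fun r => r (Fin.last n)) ε) :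
    K.IsSliceChart (χ.symm ∘ gnomonic) := by
  refine ⟨χ.symm.injective.comp gnomonic_injective, fun x =>
    (isLocalDiffeomorph_gnomonic x).comp _ _ (χ.symm.isLocalDiffeomorph _), fun x => ?_⟩
  rw [← planar_gnomonic_eq_zero, ← R.mem_iff _ ((rest_gnomonic_last x).trans R.pos)]
  constructor
  · exact fun h => ⟨_, h, χ.apply_symm_apply _⟩
  · rintro ⟨p, hp, h⟩
    rwa [Function.comp_apply, ← h, χ.symm_apply_apply]

theorem continuous_linkingCircle : Continuous (Knot.linkingCircle n) := by
  refine (PiLp.continuous_toLp 2 _).comp (continuous_pi fun i => ?_)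
  refine Fin.cases ?_ (fun i => Fin.cases ?_ (fun i => ?_) i) i <;>
  simp only [Fin.cons_zero, Fin.cons_succ] <;> fun_prop

theorem continuous_gnomonic : Continuous (gnomonic (n := n)) := contMDiff_gnomonic.continuous

/-- The loop bounding the meridian disc and the standard great circle kill the same powers. -/
theorem StdRegion.transport_gnomonic_pow {A : Set (Sph (n + 2))} {ε : ℝ} {G : Type*} [Group G]
    (R : StdRegion (m := n + 1) A (fun r => r (Fin.last n)) ε)
    {φ : Sph (n + 2) → Sph (n + 2) → G} (hφ : ∀ p ∉ A, CocycleAt φ p) (d : ℕ) :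
    transport φ (gnomonic ∘ Knot.linkingCircle n) 0 1 ^ d = 1 ↔
      transport φ (stdLoop (n + 1)) 0 1 ^ d = 1 := by
  have hz : ∀ t : ℝ, Complex.exp ((2 * Real.pi * t : ℝ) * Complex.I) ≠ 0 :=
    fun t => Complex.exp_ne_zero _
  -- Lowering the last coordinate from `0` to `-1` deforms the great circle into the gnomonic image
  -- of the linking circle, within the standard region.
  have hW : ∀ t s : ℝ, ContinuousAt (Function.uncurry fun t s : ℝ => radial (m := n + 1)
      (cyl (Complex.exp ((2 * Real.pi * t : ℝ) * Complex.I))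
        (Pi.single (Fin.last n) (-clamp s)))) (t, s) ∧
      CocycleAt φ (radial (m := n + 1) (cyl (Complex.exp ((2 * Real.pi * t : ℝ) * Complex.I))
        (Pi.single (Fin.last n) (-clamp s)))) := by
    intro t s
    constructor
    · refine (continuousAt_radial (cyl_ne_zero (hz t) _)).comp
        (f := fun x : ℝ × ℝ => cyl (m := n + 1)
          (Complex.exp ((2 * Real.pi * x.1 : ℝ) * Complex.I))
          (Pi.single (Fin.last n) (-clamp x.2))) (Continuous.continuousAt ?_)
      have h1 : Continuous fun x : ℝ × ℝ =>
          (Complex.exp ((2 * Real.pi * x.1 : ℝ) * Complex.I),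
            (Pi.single (Fin.last n) (-clamp x.2) : Fin (n + 1) → ℝ)) := by
        refine Continuous.prodMk (by fun_prop) ?_
        exact (continuous_single (Fin.last n)).comp (continuous_clamp.comp continuous_snd).neg
      exact continuous_cyl.comp h1
    · refine hφ _ (R.radial_notMem (hz t) (R.lt_of_nonpos (hz t) ?_))
      simpa using (clamp_mem s).1
  have h := transport_pow_eq_one_of_homotopy hW (funext fun s => ?_) d 1
  · convert h using 3
    · congr 1
      funext t
      rw [Function.comp_apply, gnomonic]
      congr 1
      refine ext_planar_rest ?_ ?_
      · rw [hyperplaneLift, planar_cyl, planar_cyl]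
        exact Complex.ext (Complex.exp_ofReal_mul_I_re _).symm (Complex.exp_ofReal_mul_I_im _).symm
      · rw [hyperplaneLift, rest_cyl, rest_cyl]
        funext i
        refine Fin.lastCases ?_ (fun i => ?_) i
        · simp
        · simp [rest, Knot.linkingCircle]
    · congr 1
      funext t
      simp [stdLoop, anglePoint, circlePoint]
  · have : Complex.exp ((2 * Real.pi * 0 : ℝ) * Complex.I) =
        Complex.exp ((2 * Real.pi * 1 : ℝ) * Complex.I) := by
      simp [Complex.exp_two_pi_mul_I]
    simp only [this]

/-- If a homomorphism kills the `m`-th powers of the meridians, then its cocycle kills the `m`-th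
powers of the loops near the knot. -/
theorem Knot.loopsKilled_homCocycle {H : Type*} [Group H] (K : Knot (n + 1)) {x₀ : K.Complement}
    [PathConnectedSpace K.Complement] {χ : SphDiffeo (n + 1 + 2)}
    (hχ : InNormalPosition (χ '' K.carrier)) (ρ : FundamentalGroup K.Complement x₀ →* H) {m : ℕ}
    (hρ : ∀ μ, K.IsMeridian x₀ μ → ρ μ ^ m = 1) : K.LoopsKilled (K.homCocycle ρ) m := by
  obtain ⟨ε, R⟩ := hχ.exists_stdRegion
  rw [K.loopsKilled_iff (fun p hp => K.cocycleAt_homCocycle ρ hp) χ.toHomeomorph rfl R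
    (cyl_single_ne_zero (Fin.last (n + 1)) (neg_ne_zero.2 one_ne_zero)) (by simp)]
  have hφ : ∀ p ∉ χ.toHomeomorph '' K.carrier,
      CocycleAt (pullCocycle χ.toHomeomorph.symm (K.homCocycle ρ)) p := fun p hp =>
    (K.cocycleAt_homCocycle ρ fun h => hp ⟨_, h, χ.toHomeomorph.apply_symm_apply p⟩).pull
      χ.toHomeomorph.symm.continuous.continuousAt
  rw [← R.transport_gnomonic_pow hφ, transport_pull]
  have hg := K.isSliceChart_gnomonic χ R
  have hgK : ∀ t, χ.symm (gnomonic (linkingCircle (n + 1) t)) ∉ K.carrier := fun t h => by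
    obtain ⟨h1, h2⟩ := (hg.2.2 _).1 h
    have h3 := Real.cos_sq_add_sin_sq (2 * Real.pi * t)
    have h4 : Real.cos (2 * Real.pi * t) = 0 := h1
    have h5 : Real.sin (2 * Real.pi * t) = 0 := h2
    rw [h4, h5] at h3
    norm_num at h3
  have h01 : linkingCircle (n + 1) 1 = linkingCircle (n + 1) 0 := by simp [linkingCircle]
  have hc : Continuous fun t => χ.symm (gnomonic (linkingCircle (n + 1) t)) :=
    χ.symm.continuous.comp (continuous_gnomonic.comp continuous_linkingCircle)
  let Γ : C(ℝ, K.Complement) := ⟨fun t => ⟨_, hgK t⟩, hc.subtype_mk _⟩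
  let b := Γ 0
  let ℓ : Path b b := ((segPath (0 : ℝ) 1).map Γ.continuous).cast rfl
    (Subtype.ext (by simp only [b, Γ, ContinuousMap.coe_mk]; rw [h01]))
  have key : transport (K.homCocycle ρ) (fun t => (Γ t).1) 0 1 = holonomy ρ (.mk ℓ) := by
    rw [K.transport_homCocycle, holonomy_cast]
  change transport (K.homCocycle ρ) (fun t => (Γ t).1) 0 1 ^ m = 1
  rw [key, holonomy, inv_pow, inv_eq_one]
  refine hρ _ ⟨_, hg, b, PathConnectedSpace.somePath x₀ b, ℓ, fun t => ?_, rfl⟩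
  simp [ℓ, Γ, segPath]

end SliceChart

/-! ### Homomorphisms to commutative groups obtained by transport -/

section Monodromy

variable {X : Type*} [TopologicalSpace X]

theorem transport_refl {G : Type*} [Group G] {φ : X → X → G} (hφ : ∀ x, CocycleAt φ x) (p : X)
    (a b : ℝ) : transport φ (fun _ => p) a b = 1 := by
  obtain ⟨N, hN, H⟩ := hφ p
  have hp := mem_of_mem_nhds hN
  rw [transport_eq (f := fun _ => 1) fun t => ⟨univ, univ_mem, fun _ _ _ _ => ?_⟩]
  · simp
  · simpa [pullCocycle] using cocycle_self H hp

theorem transport_trans {G : Type*} [Group G] {φ : X → X → G} (hφ : ∀ x, CocycleAt φ x)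
    {a b c : X} (γ : Path a b) (δ : Path b c) :
    transport φ (γ.trans δ).extend 0 1 =
      transport φ γ.extend 0 1 * transport φ δ.extend 0 1 := by
  have hT : ∀ {f : ℝ → X}, Continuous f → Transportable φ f := fun hf t =>
    ⟨hf.continuousAt, hφ _⟩
  have h1 : Continuous fun t : ℝ => 2 * t := by fun_prop
  have h2 : Continuous fun t : ℝ => 2 * t - 1 := by fun_prop
  have e1 : transport φ (γ.trans δ).extend 0 (1 / 2) = transport φ γ.extend 0 1 := by
    rw [transport_congr (hT (γ.trans δ).continuous_extend)
      (hT (γ.continuous_extend.comp h1)) (by norm_num)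
      fun t ht => Path.extend_trans_of_le_half _ _ ht.2,
      transport_reparam (hT γ.continuous_extend) h1]
    norm_num
  have e2 : transport φ (γ.trans δ).extend (1 / 2) 1 = transport φ δ.extend 0 1 := by
    rw [transport_congr (hT (γ.trans δ).continuous_extend)
      (hT (δ.continuous_extend.comp h2)) (by norm_num)
      fun t ht => Path.extend_trans_of_half_le _ _ ht.1,
      transport_reparam (hT δ.continuous_extend) h2]
    norm_num
  rw [← e1, ← e2, transport_mul (hT (γ.trans δ).continuous_extend)]

/-- The ends stay fixed during the homotopy, so the two side transports are trivial. -/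
theorem Path.Homotopic.transport_eq {G : Type*} [Group G] {φ : X → X → G}
    (hφ : ∀ x, CocycleAt φ x) {a b : X} {γ δ : Path a b} (h : γ.Homotopic δ) :
    transport φ γ.extend 0 1 = transport φ δ.extend 0 1 := by
  obtain ⟨F⟩ := h
  set π : ℝ → unitInterval := projIcc 0 1 zero_le_one
  have hπ : Continuous π := continuous_projIcc
  have hW : ∀ t s : ℝ, ContinuousAt (Function.uncurry fun t s : ℝ => F (π s, π t)) (t, s) ∧
      CocycleAt φ (F (π s, π t)) := fun t s =>
    ⟨Continuous.continuousAt (F.continuous.comp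
      ((hπ.comp continuous_snd).prodMk (hπ.comp continuous_fst))), hφ _⟩
  have h := transport_homotopy hW 0 1 1
  have π0 : π 0 = 0 := projIcc_left _
  have π1 : π 1 = 1 := projIcc_right _
  have e0 : (fun t => F (π 0, π t)) = γ.extend := by
    funext t; rw [π0]; exact F.apply_zero _
  have e1 : (fun t => F (π 1, π t)) = δ.extend := by
    funext t; rw [π1]; exact F.apply_one _
  have f0 : (fun s => F (π s, π 0)) = fun _ => a := by funext s; rw [π0]; exact F.source _
  have f1 : (fun s => F (π s, π 1)) = fun _ => b := by funext s; rw [π1]; exact F.target _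
  rw [e0, e1, f0, f1, transport_refl hφ, transport_refl hφ] at h
  simpa using h.symm

/-- The homomorphism on the fundamental group given by transporting a cocycle with values in a
commutative group. -/
noncomputable def monodromy {A : Type*} [CommGroup A] {φ : X → X → A} (hφ : ∀ x, CocycleAt φ x)
    (x₀ : X) : FundamentalGroup X x₀ →* A where
  toFun q := Quotient.lift (fun γ : Path x₀ x₀ => transport φ γ.extend 0 1)
    (fun _ _ h => Path.Homotopic.transport_eq hφ h) (FundamentalGroup.toPath q)
  map_one' := by
    change transport φ (Path.refl x₀).extend 0 1 = 1
    rw [Path.refl_extend]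
    exact transport_refl hφ x₀ 0 1
  map_mul' p q := by
    induction p using Quotient.inductionOn with | _ γ
    induction q using Quotient.inductionOn with | _ δ
    -- Commutativity absorbs the reversed order of composition in `FundamentalGroup`.
    exact (transport_trans hφ δ γ).trans (mul_comm _ _)

theorem monodromy_mk {A : Type*} [CommGroup A] {φ : X → X → A} (hφ : ∀ x, CocycleAt φ x)
    {x₀ : X} (γ : Path x₀ x₀) :
    monodromy hφ x₀ (FundamentalGroup.fromPath (.mk γ)) = transport φ γ.extend 0 1 := rfl

/-- The transport along a loop at any point is the monodromy of the loop moved to the base point. -/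
theorem monodromy_trans_trans_symm [PathConnectedSpace X] {A : Type*} [CommGroup A] {φ : X → X → A}
    (hφ : ∀ x, CocycleAt φ x) {x₀ b : X} (c : Path x₀ b) (ℓ : Path b b) :
    monodromy hφ x₀ (FundamentalGroup.fromPath (.mk ((c.trans ℓ).trans c.symm))) =
      transport φ ℓ.extend 0 1 := by
  have h : transport φ (c.trans c.symm).extend 0 1 = 1 := by
    rw [Path.Homotopic.transport_eq hφ ⟨(Path.Homotopy.reflTransSymm c).symm⟩, Path.refl_extend]
    exact transport_refl hφ x₀ 0 1
  rw [transport_trans hφ] at h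
  rw [monodromy_mk, transport_trans hφ, transport_trans hφ, mul_right_comm, h, one_mul]

theorem transport_eq_transport_path {G : Type*} [Group G] {φ : X → X → G}
    (hφ : ∀ x, CocycleAt φ x) {γ : ℝ → X} (hγ : Continuous γ) {b : X} (h0 : γ 0 = b)
    (h1 : γ 1 = b) :
    transport φ γ 0 1 = transport φ (Path.ofLine hγ.continuousOn h0 h1).extend 0 1 := by
  refine transport_congr (fun t => ⟨hγ.continuousAt, hφ _⟩)
    (fun t => ⟨(Path.continuous_extend _).continuousAt, hφ _⟩) zero_le_one fun t ht => ?_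
  rw [Path.extend_apply _ ht]
  rfl

variable {n : ℕ}

theorem Knot.cocycleAt_complement {G : Type*} [Group G] (K : Knot n)
    {φ : Sph (n + 2) → Sph (n + 2) → G} (hφ : ∀ p ∉ K.carrier, CocycleAt φ p) (x : K.Complement) :
    CocycleAt (pullCocycle (Subtype.val : K.Complement → Sph (n + 2)) φ) x :=
  (hφ _ x.2).pull continuous_subtype_val.continuousAt

/-- If the `m`-th powers of the meridians generate the knot group as a normal subgroup, then every
cocycle with values in a commutative group of exponent `m` has trivial transports along loops. -/
theorem Knot.loopsKilled_one_of_normalClosure_eq_top {A : Type*} [CommGroup A] (K : Knot n)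
    {x₀ : K.Complement} [PathConnectedSpace K.Complement] {m : ℕ}
    (htop : Subgroup.normalClosure {a | ∃ μ, K.IsMeridian x₀ μ ∧ a = μ ^ m} = ⊤)
    (hA : ∀ a : A, a ^ m = 1) {ν : Sph (n + 2) → Sph (n + 2) → A}
    (hν : ∀ p ∉ K.carrier, CocycleAt ν p) : K.LoopsKilled ν 1 := by
  have hν' := K.cocycleAt_complement hν
  have hker : (monodromy hν' x₀).ker = ⊤ := by
    rw [eq_top_iff, ← htop]
    refine Subgroup.normalClosure_le_normal ?_
    rintro _ ⟨μ, -, rfl⟩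
    exact MonoidHom.mem_ker.2 (by rw [map_pow, hA])
  intro p _
  refine ⟨univ, univ_mem, fun γ hγ h01 hγK => ?_⟩
  let Γ : ℝ → K.Complement := fun t => ⟨γ t, (hγK t).2⟩
  have hΓ : Continuous Γ := hγ.subtype_mk _
  have h1 := transport_eq_transport_path hν' hΓ (Subtype.ext h01 : Γ 0 = Γ 1) rfl
  rw [← monodromy_trans_trans_symm hν' (PathConnectedSpace.somePath x₀ (Γ 1))] at h1
  rw [pow_one]
  refine Eq.trans h1 ?_
  rw [← MonoidHom.mem_ker, hker]
  exact Subgroup.mem_top _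

end Monodromy

/-! ### Commutativity forced by an extension over a trivial knot complement -/

section CommutativeExtension

/-- If the knot group of `K` maps to the complement of a trivial knot in such a way that the cocycle
of a homomorphism `ρ` extends, then the image of `ρ` is commutative. -/
theorem Knot.IsTrivial.commute_of_extension {n k : ℕ} {H : Type*} [Group H] {K : Knot n}
    {L : Knot k} (hL : L.IsTrivial) [PathConnectedSpace K.Complement] {x₀ : K.Complement}
    (ρ : FundamentalGroup K.Complement x₀ →* H) {θ : Sph (n + 2) → Sph (k + 2)}
    (hθ : ∀ p ∉ K.carrier, ContinuousAt θ p ∧ θ p ∉ L.carrier)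
    {φ : Sph (k + 2) → Sph (k + 2) → H} (hφ : ∀ p ∉ L.carrier, CocycleAt φ p)
    {ξ : Sph (n + 2) → H}
    (hξ : ∀ p ∉ K.carrier, CohomologousAt (pullCocycle θ φ) (K.homCocycle ρ) ξ p)
    (a b : FundamentalGroup K.Complement x₀) : Commute (ρ a) (ρ b) := by
  have hloop : ∀ a : FundamentalGroup K.Complement x₀, ∃ γ : Path x₀ x₀,
      transport φ (fun t => θ (γ.extend t).1) 0 1 = (ξ x₀.1)⁻¹ * (ρ a)⁻¹ * ξ x₀.1 := by
    intro a
    -- The chosen path from `x₀` to itself need not be constant; conjugating by it cancels its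
    -- effect on the holonomy.
    obtain ⟨γ, hγ⟩ := Quotient.exists_rep (((basePath x₀ x₀).symm.trans
      (FundamentalGroup.toPath a)).trans (basePath x₀ x₀))
    have hγ' : Path.Homotopic.Quotient.mk γ = _ := hγ
    refine ⟨γ, ?_⟩
    have h1 : holonomy ρ (.mk γ) = (ρ a)⁻¹ := by
      rw [hγ', holonomy]
      congr 2
      rw [Path.Homotopic.Quotient.trans_assoc, Path.Homotopic.Quotient.trans_assoc,
        Path.Homotopic.Quotient.trans_assoc, Path.Homotopic.Quotient.trans_symm,
        Path.Homotopic.Quotient.trans_refl, ← Path.Homotopic.Quotient.trans_assoc,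
        Path.Homotopic.Quotient.trans_symm, Path.Homotopic.Quotient.refl_trans]
    have h2 : Transportable (K.homCocycle ρ) fun t => (γ.extend t).1 := fun t =>
      ⟨(continuous_subtype_val.comp γ.continuous_extend).continuousAt,
        K.cocycleAt_homCocycle ρ (γ.extend t).2⟩
    have h3 := h2.cohomologous (fun t => hξ _ (γ.extend t).2) 0 1
    rw [K.transport_homCocycle_extend, h1, γ.extend_zero, γ.extend_one] at h3
    exact h3
  obtain ⟨γ, hγ⟩ := hloop a
  obtain ⟨δ, hδ⟩ := hloop b
  have hc : ∀ γ : Path x₀ x₀, Continuous fun t => θ (γ.extend t).1 := fun γ =>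
    continuous_iff_continuousAt.2 fun t => ContinuousAt.comp (g := θ)
      (f := fun t => (γ.extend t).1) (hθ _ (γ.extend t).2).1
      (continuous_subtype_val.comp γ.continuous_extend).continuousAt
  have h := hL.commute_transport hφ (hc γ) (hc δ) (by simp) (by simp) (by simp)
    (fun t => (hθ _ (γ.extend t).2).2) fun t => (hθ _ (δ.extend t).2).2
  rw [hγ, hδ] at h
  have hconj : ∀ g : H, (ξ x₀.1)⁻¹ * g * ξ x₀.1 = MulAut.conj (ξ x₀.1)⁻¹ g := fun g => by simp
  rw [hconj, hconj] at h
  have h' := h.map (MulAut.conj (ξ x₀.1)⁻¹).symm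
  simpa only [MulEquiv.symm_apply_apply, Commute.inv_inv_iff] using h'

end CommutativeExtension

/-! ### Conclusion for the twice twist spun knot -/

theorem theorem1p2 (K : Knot 1) (m₁ m₂ : ℕ) (hm₁ : 0 < m₁) (hm₂ : 0 < m₂)
    (hK : ¬ K.IsTrivial) (hm : 2 ≤ Nat.gcd m₁ m₂) (x₀ : K.Complement)
    (hcenter : Subgroup.center (K.OrbifoldGroup (Nat.gcd m₁ m₂) x₀) = ⊥)
    (L₁ : Knot 2) (hL₁ : L₁.IsTwistSpunOf m₁ K)
    (L₂ : Knot 3) (hL₂ : L₂.IsTwistSpunOf m₂ L₁) :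
    ¬ L₂.IsTrivial := by
  intro hL
  have := K.pathConnectedSpace_complement x₀
  set m := Nat.gcd m₁ m₂
  obtain ⟨θ₁, hθ₁, hkill₁, hext₁⟩ := Knot.IsTwistSpunOf.exists_map (n := 0) hL₁
  obtain ⟨θ₂, hθ₂, hkill₂, hext₂⟩ := Knot.IsTwistSpunOf.exists_map (n := 1) hL₂
  set N := Subgroup.normalClosure {a | ∃ μ, K.IsMeridian x₀ μ ∧ a = μ ^ m}
  let ρ : FundamentalGroup K.Complement x₀ →* K.OrbifoldGroup m x₀ := QuotientGroup.mk' N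
  have hρ : Function.Surjective ρ := QuotientGroup.mk'_surjective N
  have hcomm : ∀ a b : K.OrbifoldGroup m x₀, Commute a b := by
    have hχ := hL₁
    obtain ⟨χ, -, hχ, -⟩ := hχ
    obtain ⟨φ₁, hφ₁, hφ₁', ξ₁, hξ₁⟩ := hext₁ (K.homCocycle ρ)
      (fun p hp => K.cocycleAt_homCocycle ρ hp) m (Nat.gcd_dvd_left _ _)
      (Knot.loopsKilled_homCocycle (n := 0) K hχ ρ fun μ hμ => by
        rw [← map_pow]
        exact (QuotientGroup.eq_one_iff _).2 (Subgroup.subset_normalClosure ⟨μ, hμ, rfl⟩))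
    -- The first extension still kills `m`-th powers of meridians, so the second spinning can be
    -- treated in the same way.
    obtain ⟨φ₂, hφ₂, -, ξ₂, hξ₂⟩ := hext₂ φ₁ hφ₁ m (Nat.gcd_dvd_right _ _) hφ₁'
    intro a b
    obtain ⟨a, rfl⟩ := hρ a
    obtain ⟨b, rfl⟩ := hρ b
    refine hL.commute_of_extension ρ (θ := θ₂ ∘ θ₁) (fun p hp => ?_) hφ₂ (fun p hp =>
      ((hξ₂ _ (hθ₁ p hp).2).pull (hθ₁ p hp).1).trans (hξ₁ p hp)) a b
    have h := hθ₁ p hp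
    exact ⟨ContinuousAt.comp (g := θ₂) (hθ₂ _ h.2).1 h.1, (hθ₂ _ h.2).2⟩
  -- The orbifold group is abelian, hence equal to its trivial center.
  have htop : N = ⊤ := by
    rw [← QuotientGroup.ker_mk' N, eq_top_iff]
    intro a _
    have ha : ρ a ∈ Subgroup.center (K.OrbifoldGroup m x₀) :=
      Subgroup.mem_center_iff.2 fun b => hcomm b (ρ a)
    rw [hcenter] at ha
    exact ha
  obtain ⟨ν, hν, hν'⟩ := Knot.IsTrivial.exists_winding (n := 2) hL hm
  -- Triviality of the winding cocycle on meridians of `K` is carried up through both fibre maps to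
  -- meridians of `L₂`, where it is false.
  refine hν' (hkill₂ ν hν 1 (hkill₁ _ (fun p hp => (hν _ (hθ₂ p hp).2).pull (hθ₂ p hp).1) 1 ?_))
  refine K.loopsKilled_one_of_normalClosure_eq_top htop (fun a => ?_) fun p hp =>
    ((hν _ (hθ₂ _ (hθ₁ p hp).2).2).pull (hθ₂ _ (hθ₁ p hp).2).1).pull (hθ₁ p hp).1
  refine Multiplicative.toAdd.injective ?_
  simp
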